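/- Let $(M,\Omega)$ be a symplectic manifold of dimension $2n$ (smooth, Hausdorff, second countable; connectedness is not needed), let $\hbar>0$, and let $(L,\pi,M;\mathrm h,\nabla)$ be a prequantum line bundle of $(M,\Omega)$: a smooth complex line bundle $L\to M$ with a smooth hermitian metric $\mathrm h$ and a smooth connection $\nabla$ compatible with $\mathrm h$ such that $\mathrm{curv}\,\nabla=\Omega/(2\pi\hbar)$, i.e. $(\nabla_X\nabla_Y-\nabla_Y\nabla_X-\nabla_{[X,Y]})s=\frac{i}{\hbar}\Omega(X,Y)s$. Let $\Lambda_\Omega=(-1)^{n(n-1)/2}\,\Omega^n/n!$ be the Liouville volume, and put $$\langle\psi_1|\psi_2\rangle=\Big(\frac1{2\pi\hbar}\Big)^n\int_M \mathrm h(\psi_1,\psi_2)\,\Lambda_\Omega .$$ The prequantum Hilbert space $\mathcal H_P$ is the completion, with respect to this inner product, of the space of smooth compactly supported sections of $L$. It is regarded as the closure of that space in the Hilbert space completion of the space of all square integrable smooth sections of $L$. Let $\mathcal P\subset TM\otimes\mathbb C$ be a Kähler polarization: a smooth complex distribution that is Lagrangian ($\dim_{\mathbb C}\mathcal P_m=n$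 for all $m$, and $\Omega(\mathcal P,\mathcal P)=0$), involutive ($[\mathcal P,\mathcal P]\subset\mathcal P$), and satisfies $\mathcal P\cap\overline{\mathcal P}=0$. Let $\Gamma_{hol}(L)$ be the space of square integrable holomorphic sections of $L$, i.e. of the smooth sections $\psi$ with $\nabla_{\mathcal P}\psi=0$ and $\langle\psi|\psi\rangle<\infty$. Then (the image of) $\Gamma_{hol}(L)$ is contained in $\mathcal H_P$ and is a closed subspace of it. Hence $\Gamma_{hol}(L)$ is itself a Hilbert space: $\langle\cdot|\cdot\rangle$ is positive definite on $\Gamma_{hol}(L)$, and $\Gamma_{hol}(L)$ is complete. -/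

import Mathlib

open scoped Manifold ContDiff Bundle TensorProduct ComplexConjugate
open Bundle MeasureTheory

namespace GeometricQuantization

noncomputable section

set_option linter.unusedSectionVars false

/-- The model space `ℝ²ⁿ` of a `2n`-dimensional manifold. -/
abbrev Model (n : ℕ) : Type := EuclideanSpace ℝ (Fin (2 * n))

/-- The tangent space at `x` of a manifold modelled on `ℝ²ⁿ`. -/
abbrev Tan (n : ℕ) {M : Type*} [TopologicalSpace M] [ChartedSpace (Model n) M] (x : M) : Type :=
  TangentSpace 𝓘(ℝ, Model n) x

/-! ### Complexified tangent spaces -/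

section Complexification

variable {V : Type*} [AddCommGroup V] [Module ℝ V]

/-- The vector `v + i w` of the complexification `ℂ ⊗ V`. -/
def cvec (v w : V) : ℂ ⊗[ℝ] V := (1 : ℂ) ⊗ₜ[ℝ] v + Complex.I ⊗ₜ[ℝ] w

variable (V) in
/-- Complex conjugation `v + i w ↦ v - i w` on the complexification `ℂ ⊗ V`. -/
def cconj : (ℂ ⊗[ℝ] V) →ₛₗ[starRingEnd ℂ] (ℂ ⊗[ℝ] V) where
  toFun := TensorProduct.map Complex.conjAe.toLinearMap LinearMap.id
  map_add' := map_add _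
  map_smul' c u := by
    induction u using TensorProduct.induction_on with
    | zero => simp
    | tmul z v => simp [TensorProduct.smul_tmul']
    | add a b ha hb => simp only [smul_add, map_add, ha, hb]

/-- The complex conjugate of a complex subspace of `ℂ ⊗ V`. -/
def conjSubspace (W : Submodule ℂ (ℂ ⊗[ℝ] V)) : Submodule ℂ (ℂ ⊗[ℝ] V) := W.map (cconj V)

/-- The real subspace `W ∩ V` of real vectors of a complex subspace `W ⊆ ℂ ⊗ V`. -/
def realPart (W : Submodule ℂ (ℂ ⊗[ℝ] V)) : Submodule ℝ V :=
  (W.restrictScalars ℝ).comap (TensorProduct.mk ℝ ℂ V 1)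

end Complexification

/-! ### Vector fields and symplectic forms -/

section Symplectic

variable {n : ℕ} {M : Type*} [TopologicalSpace M] [ChartedSpace (Model n) M]
  [IsManifold 𝓘(ℝ, Model n) ∞ M]

/-- `X` is a smooth (real) vector field on the set `U`. -/
def SmoothFieldOn (X : ∀ x : M, Tan n x) (U : Set M) : Prop :=
  ContMDiffOn 𝓘(ℝ, Model n) 𝓘(ℝ, Model n).tangent ∞
    (fun x => (⟨x, X x⟩ : TangentBundle 𝓘(ℝ, Model n) M)) U

/-- The Lie bracket of real vector fields. -/
abbrev bracket (X Y : ∀ x : M, Tan n x) : ∀ x : M, Tan n x :=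
  VectorField.mlieBracket 𝓘(ℝ, Model n) X Y

/-- The derivative `(X f)(x)` of a function `f` along a vector `v` at `x`. -/
abbrev dirDeriv {F : Type*} [NormedAddCommGroup F] [NormedSpace ℝ F] (f : M → F) (x : M)
    (v : Tan n x) : F :=
  mvfderiv 𝓘(ℝ, Model n) f x v

variable (n M) in
/-- A symplectic form on `M`: a smooth, closed, nondegenerate 2-form. -/
structure SymplecticForm where
  /-- the bilinear form on each tangent space -/
  toFun : ∀ x : M, Tan n x →L[ℝ] Tan n x →L[ℝ] ℝ
  smooth : ContMDiff 𝓘(ℝ, Model n)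
    (𝓘(ℝ, Model n).prod 𝓘(ℝ, Model n →L[ℝ] Model n →L[ℝ] ℝ)) ∞
    (fun x => TotalSpace.mk' (Model n →L[ℝ] Model n →L[ℝ] ℝ)
      (E := fun x : M => Tan n x →L[ℝ] Tan n x →L[ℝ] ℝ) x (toFun x))
  alternating : ∀ (x : M) (v : Tan n x), toFun x v v = 0
  nondegenerate : ∀ (x : M) (v : Tan n x), (∀ w, toFun x v w = 0) → v = 0
  /-- `dΩ = 0`, by the invariant formula for the exterior derivative -/
  closed : ∀ X Y Z : ∀ x : M, Tan n x,
    SmoothFieldOn X Set.univ → SmoothFieldOn Y Set.univ → SmoothFieldOn Z Set.univ →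
    ∀ x : M,
      dirDeriv (fun y => toFun y (Y y) (Z y)) x (X x)
        - dirDeriv (fun y => toFun y (X y) (Z y)) x (Y x)
        + dirDeriv (fun y => toFun y (X y) (Y y)) x (Z x)
        - toFun x (bracket X Y x) (Z x)
        + toFun x (bracket X Z x) (Y x)
        - toFun x (bracket Y Z x) (X x) = 0

/-- `Ωₓ` as a bilinear form. -/
def SymplecticForm.bilin (Ω : SymplecticForm n M) (x : M) : LinearMap.BilinForm ℝ (Tan n x) :=
  (ContinuousLinearMap.coeLM ℝ).comp (Ω.toFun x).toLinearMap

/-! ### The Liouville measure -/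

/-- The value `(β ∧ ⋯ ∧ β)(v₁, …, v₂ₙ)` of the `n`-th exterior power of a 2-form `β`. -/
def wedgePow {V : Type*} (n : ℕ) (β : V → V → ℝ) (v : Fin (2 * n) → V) : ℝ :=
  (1 / 2 : ℝ) ^ n * ∑ σ : Equiv.Perm (Fin (2 * n)), ((Equiv.Perm.sign σ : ℤ) : ℝ) *
    ∏ i : Fin n, β (v (σ ⟨2 * i, by omega⟩)) (v (σ ⟨2 * i + 1, by omega⟩))

/-- The Liouville volume form `(-1)^(n(n-1)/2) Ωⁿ / n!` at `x`. -/
def SymplecticForm.liouvilleForm (Ω : SymplecticForm n M) (x : M) (v : Fin (2 * n) → Tan n x) :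
    ℝ :=
  (-1) ^ (n * (n - 1) / 2) * (1 / (n.factorial : ℝ)) *
    wedgePow n (fun a b => Ω.toFun x a b) v

/-- The density of the Liouville volume with respect to Lebesgue measure in the chart `e`: the
absolute value of the Liouville form on the coordinate frame. -/
def SymplecticForm.chartDensity (Ω : SymplecticForm n M) (e : OpenPartialHomeomorph M (Model n))
    (y : Model n) : ℝ :=
  |Ω.liouvilleForm (e.symm y) fun i =>
    mfderiv 𝓘(ℝ, Model n) 𝓘(ℝ, Model n) e.symm y (EuclideanSpace.single i (1 : ℝ))|

/-- The Liouville measure of the domain of the chart `e`, as a measure on `M` that vanishes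
outside of this domain. -/
def SymplecticForm.chartMeasure [MeasurableSpace M] (Ω : SymplecticForm n M)
    (e : OpenPartialHomeomorph M (Model n)) : Measure M :=
  (((volume : Measure (Model n)).restrict e.target).withDensity
    (fun y => ENNReal.ofReal (Ω.chartDensity e y))).map e.symm

/-- The Liouville measure of `(M, Ω)`. The chart measures agree on the overlaps of charts; the
measure on `M` that restricts to each of them is the least measure dominating all of them. -/
def SymplecticForm.liouville [MeasurableSpace M] (Ω : SymplecticForm n M) : Measure M :=
  ⨆ x : M, Ω.chartMeasure (chartAt (Model n) x)

/-! ### Polarizations -/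

/-- A complex polarization of `(M, Ω)`: a smooth Lagrangian involutive distribution `P` in the
complexified tangent bundle such that `P ∩ P̄ ∩ TM` has constant dimension. -/
structure ComplexPolarization (Ω : SymplecticForm n M) where
  /-- the subspace of the complexified tangent space at each point -/
  toFun : ∀ x : M, Submodule ℂ (ℂ ⊗[ℝ] Tan n x)
  /-- `P` is locally spanned by `n` smooth complex vector fields `Xⱼ + i Yⱼ` -/
  smooth : ∀ x : M, ∃ U : Set M, IsOpen U ∧ x ∈ U ∧ ∃ X Y : Fin n → ∀ y : M, Tan n y,
    (∀ j, SmoothFieldOn (X j) U ∧ SmoothFieldOn (Y j) U) ∧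
    ∀ y ∈ U, toFun y = Submodule.span ℂ (Set.range fun j => cvec (X j y) (Y j y))
  finrank_eq : ∀ x : M, Module.finrank ℂ (toFun x) = n
  /-- `Ω(P, P) = 0` for the complex bilinear extension of `Ω` -/
  isotropic : ∀ x : M, ∀ u ∈ toFun x, ∀ v ∈ toFun x, (Ω.bilin x).baseChange ℂ u v = 0
  /-- `[P, P] ⊆ P`, where
  `[X + iY, X' + iY'] = ([X, X'] - [Y, Y']) + i ([X, Y'] + [Y, X'])` -/
  involutive : ∀ U : Set M, IsOpen U → ∀ X Y X' Y' : ∀ x : M, Tan n x,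
    SmoothFieldOn X U → SmoothFieldOn Y U → SmoothFieldOn X' U → SmoothFieldOn Y' U →
    (∀ x ∈ U, cvec (X x) (Y x) ∈ toFun x) → (∀ x ∈ U, cvec (X' x) (Y' x) ∈ toFun x) →
    ∀ x ∈ U, cvec (bracket X X' x - bracket Y Y' x) (bracket X Y' x + bracket Y X' x) ∈ toFun x
  finrank_real : ∃ k : ℕ, ∀ x : M,
    Module.finrank ℝ (realPart (toFun x ⊓ conjSubspace (toFun x))) = k

/-- A Kähler polarization is a complex polarization with `P ∩ P̄ = 0`. -/
def ComplexPolarization.IsKahler {Ω : SymplecticForm n M} (P : ComplexPolarization Ω) : Prop :=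
  ∀ x : M, P.toFun x ⊓ conjSubspace (P.toFun x) = ⊥

end Symplectic

/-! ### Hermitian line bundles and prequantization -/

section Bundle

variable {n : ℕ} {M : Type*} [TopologicalSpace M] [ChartedSpace (Model n) M]
  [IsManifold 𝓘(ℝ, Model n) ∞ M]
  {L : M → Type*} [TopologicalSpace (TotalSpace ℂ L)] [∀ x, AddCommGroup (L x)]
  [∀ x, Module ℂ (L x)] [∀ x, TopologicalSpace (L x)] [∀ x, IsTopologicalAddGroup (L x)]
  [∀ x, ContinuousSMul ℝ (L x)] [FiberBundle ℂ L] [VectorBundle ℂ ℂ L] [VectorBundle ℝ ℂ L]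
  [ContMDiffVectorBundle ∞ ℂ L 𝓘(ℝ, Model n)]

variable (n) in
/-- `s` is a smooth section of `L` on the set `U`. -/
def SmoothSectionOn (s : ∀ x, L x) (U : Set M) : Prop :=
  ContMDiffOn 𝓘(ℝ, Model n) (𝓘(ℝ, Model n).prod 𝓘(ℝ, ℂ)) ∞
    (fun x => TotalSpace.mk' ℂ x (s x)) U

variable (n L) in
/-- A smooth hermitian metric on the line bundle `L`, complex linear in the first variable and
conjugate linear in the second. -/
structure HermitianMetric where
  /-- the hermitian form on each fibre -/
  toFun : ∀ x, L x →ₗ[ℂ] L x →ₗ⋆[ℂ] ℂ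
  conj_symm : ∀ (x : M) (u v : L x), toFun x u v = conj (toFun x v u)
  pos : ∀ (x : M) (u : L x), u ≠ 0 → 0 < (toFun x u u).re
  smooth : ∀ U : Set M, IsOpen U → ∀ s t : ∀ x, L x,
    SmoothSectionOn n s U → SmoothSectionOn n t U →
    ContMDiffOn 𝓘(ℝ, Model n) 𝓘(ℝ, ℂ) ∞ (fun x => toFun x (s x) (t x)) U

variable (L) in
/-- A prequantization of `(M, Ω)` with underlying complex line bundle `L`: a smooth hermitian
metric `h` and a smooth (complex linear) connection `∇` on `L`, compatible with `h`, such that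
`curv ∇ = Ω / (2πħ)`, with Planck's constant `ħ > 0`. -/
structure Prequantization (ħ : ℝ) (Ω : SymplecticForm n M) where
  hbar_pos : 0 < ħ
  /-- the hermitian metric -/
  h : HermitianMetric n L
  /-- the connection; `nabla s x v` is `(∇_v s)(x)` -/
  nabla : CovariantDerivative 𝓘(ℝ, Model n) ℂ L
  nabla_smooth : CovariantDerivative.ContMDiffCovariantDerivative nabla ∞
  nabla_smul : ∀ (c : ℂ) (s : ∀ x, L x), SmoothSectionOn n s Set.univ →
    ∀ (x : M) (v : Tan n x), nabla (fun y => c • s y) x v = c • nabla s x v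
  compatible : ∀ s t : ∀ x, L x, SmoothSectionOn n s Set.univ → SmoothSectionOn n t Set.univ →
    ∀ (x : M) (v : Tan n x),
      dirDeriv (fun y => h.toFun y (s y) (t y)) x v
        = h.toFun x (nabla s x v) (t x) + h.toFun x (s x) (nabla t x v)
  /-- `(∇_X ∇_Y - ∇_Y ∇_X - ∇_[X,Y]) s = 2πi curv(X, Y) s` with `curv = Ω / (2πħ)` -/
  curvature : ∀ X Y : ∀ x : M, Tan n x, SmoothFieldOn X Set.univ → SmoothFieldOn Y Set.univ →
    ∀ s : ∀ x, L x, SmoothSectionOn n s Set.univ → ∀ x : M,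
      nabla (fun y => nabla s y (Y y)) x (X x) - nabla (fun y => nabla s y (X y)) x (Y x)
          - nabla s x (bracket X Y x)
        = (2 * Real.pi * Complex.I * ((Ω.toFun x (X x) (Y x) / (2 * Real.pi * ħ) : ℝ) : ℂ)) • s x

/-! ### Square integrable sections and the prequantum Hilbert space -/

lemma SmoothSectionOn.add {s t : ∀ x, L x} {U : Set M} (hs : SmoothSectionOn n s U)
    (ht : SmoothSectionOn n t U) : SmoothSectionOn n (s + t) U :=
  ContMDiffOn.add_section hs ht

lemma SmoothSectionOn.smul {s : ∀ x, L x} {U : Set M} (hs : SmoothSectionOn n s U) (c : ℂ) :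
    SmoothSectionOn n (c • s) U := by
  intro x₀ hx₀
  have h := hs x₀ hx₀
  rw [contMDiffWithinAt_section] at h ⊢
  have hc : ContMDiff 𝓘(ℝ, ℂ) 𝓘(ℝ, ℂ) ∞ (fun z : ℂ => c * z) :=
    (contDiff_const.mul contDiff_id).contMDiff
  refine (hc.contMDiffAt.comp_contMDiffWithinAt x₀ h).congr_of_eventuallyEq ?_ ?_
  · filter_upwards [mem_nhdsWithin_of_mem_nhds ((trivializationAt ℂ L x₀).open_baseSet.mem_nhds
      (mem_baseSet_trivializationAt ℂ L x₀))] with x hx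
    exact ((trivializationAt ℂ L x₀).linear ℂ hx).map_smul c (s x)
  · exact ((trivializationAt ℂ L x₀).linear ℂ
      (mem_baseSet_trivializationAt ℂ L x₀)).map_smul c (s x₀)

lemma SmoothSectionOn.mdifferentiableAt_section {s : ∀ x, L x}
    (hs : SmoothSectionOn n s Set.univ) (x : M) :
    MDifferentiableAt 𝓘(ℝ, Model n) (𝓘(ℝ, Model n).prod 𝓘(ℝ, ℂ))
      (fun x => TotalSpace.mk' ℂ x (s x)) x :=
  (contMDiffOn_univ.mp hs).mdifferentiable (by simp) x

namespace HermitianMetric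

variable (h : HermitianMetric n L)

lemma continuous {s t : ∀ x, L x} (hs : SmoothSectionOn n s Set.univ)
    (ht : SmoothSectionOn n t Set.univ) : Continuous fun x => h.toFun x (s x) (t x) :=
  continuousOn_univ.mp (h.smooth Set.univ isOpen_univ s t hs ht).continuousOn

lemma self_re_nonneg (x : M) (u : L x) : 0 ≤ (h.toFun x u u).re := by
  by_cases hu : u = 0
  · simp [hu]
  · exact (h.pos x u hu).le

lemma norm_self (x : M) (u : L x) : ‖h.toFun x u u‖ = (h.toFun x u u).re := by
  have him : (h.toFun x u u).im = 0 := Complex.conj_eq_iff_im.mp (h.conj_symm x u u).symm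
  have : h.toFun x u u = ((h.toFun x u u).re : ℂ) := Complex.ext rfl (by simp [him])
  rw [this, Complex.norm_real, Complex.ofReal_re, Real.norm_of_nonneg (h.self_re_nonneg x u)]

lemma norm_le (x : M) (u v : L x) :
    ‖h.toFun x u v‖ ≤ ‖h.toFun x u u‖ + ‖h.toFun x v v‖ := by
  obtain ⟨c, hc, hcz⟩ : ∃ c : ℂ, ‖c‖ = 1 ∧ c * h.toFun x u v = (‖h.toFun x u v‖ : ℂ) := by
    by_cases hz : h.toFun x u v = 0
    · exact ⟨1, by simp, by simp [hz]⟩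
    · have hn : (‖h.toFun x u v‖ : ℂ) ≠ 0 := by simpa using hz
      refine ⟨‖h.toFun x u v‖ / h.toFun x u v, ?_, div_mul_cancel₀ _ hz⟩
      rw [norm_div, Complex.norm_real, norm_norm, div_self (by simpa using hz)]
  have hcc : c * conj c = 1 := by rw [Complex.mul_conj, Complex.normSq_eq_norm_sq, hc]; simp
  have hvu : conj c * h.toFun x v u = (‖h.toFun x u v‖ : ℂ) := by
    rw [h.conj_symm x v u, ← map_mul, hcz, Complex.conj_ofReal]
  have h0 := h.self_re_nonneg x (c • u - v)
  have hexp : h.toFun x (c • u - v) (c • u - v) =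
      h.toFun x u u + h.toFun x v v - 2 * (‖h.toFun x u v‖ : ℂ) := by
    simp only [map_sub, LinearMap.sub_apply, map_smul, LinearMap.smul_apply, smul_eq_mul,
      LinearMap.map_smulₛₗ]
    linear_combination (h.toFun x u u) * hcc - hcz - hvu
  rw [hexp] at h0
  simp only [Complex.sub_re, Complex.add_re, Complex.mul_re, Complex.ofReal_re, Complex.ofReal_im,
    Complex.re_ofNat, Complex.im_ofNat] at h0
  have h1 := h.self_re_nonneg x u
  have h2 := h.self_re_nonneg x v
  rw [h.norm_self, h.norm_self]
  linarith

lemma integrable [MeasurableSpace M] [BorelSpace M] [SecondCountableTopology M] {μ : Measure M}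
    {s t : ∀ x, L x}
    (hs : SmoothSectionOn n s Set.univ) (ht : SmoothSectionOn n t Set.univ)
    (hsi : Integrable (fun x => h.toFun x (s x) (s x)) μ)
    (hti : Integrable (fun x => h.toFun x (t x) (t x)) μ) :
    Integrable (fun x => h.toFun x (s x) (t x)) μ := by
  refine (hsi.norm.add hti.norm).mono' (h.continuous hs ht).aestronglyMeasurable ?_
  exact Filter.Eventually.of_forall fun x => h.norm_le x (s x) (t x)

end HermitianMetric

namespace Prequantization

variable [SecondCountableTopology M] [MeasurableSpace M] [BorelSpace M]
  {ħ : ℝ} {Ω : SymplecticForm n M} (Q : Prequantization L ħ Ω)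

/-- The complex vector space of smooth sections `ψ` of `L` with `∫ h(ψ, ψ) Λ_Ω < ∞`. -/
def sqIntSubmodule : Submodule ℂ (∀ x, L x) where
  carrier := {ψ | SmoothSectionOn n ψ Set.univ ∧
    Integrable (fun x => Q.h.toFun x (ψ x) (ψ x)) Ω.liouville}
  zero_mem' := by
    refine ⟨?_, by simp⟩
    exact (contMDiff_zeroSection ℝ L).contMDiffOn
  add_mem' := by
    rintro s t ⟨hs, hsi⟩ ⟨ht, hti⟩
    refine ⟨hs.add ht, ?_⟩
    have := ((hsi.add (Q.h.integrable hs ht hsi hti)).add (Q.h.integrable ht hs hti hsi)).add hti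
    refine this.congr (Filter.Eventually.of_forall fun x => ?_)
    simp only [Pi.add_apply, map_add, LinearMap.add_apply]
    ring
  smul_mem' := by
    rintro c s ⟨hs, hsi⟩
    refine ⟨hs.smul c, (hsi.const_mul (c * conj c)).congr
      (Filter.Eventually.of_forall fun x => ?_)⟩
    simp only [Pi.smul_apply, map_smul, LinearMap.smul_apply, smul_eq_mul, LinearMap.map_smulₛₗ]
    ring

/-- The space of square integrable smooth sections of `L`, with the inner product given below. -/
def SqInt : Type _ := Q.sqIntSubmodule

instance : AddCommGroup Q.SqInt := inferInstanceAs (AddCommGroup Q.sqIntSubmodule)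

instance : Module ℂ Q.SqInt := inferInstanceAs (Module ℂ Q.sqIntSubmodule)

/-- The section of `L` underlying an element of `SqInt`. -/
def SqInt.sec {Q : Prequantization L ħ Ω} (ψ : Q.SqInt) : ∀ x, L x := ψ.1

/-- The inner product `⟨ψ₁|ψ₂⟩ = (1 / 2πħ)ⁿ ∫ h(ψ₁, ψ₂) Λ_Ω`, linear in `ψ₁`. -/
def braket (ψ₁ ψ₂ : Q.SqInt) : ℂ :=
  (((1 / (2 * Real.pi * ħ)) ^ n : ℝ) : ℂ) *
    ∫ x, Q.h.toFun x (ψ₁.sec x) (ψ₂.sec x) ∂Ω.liouville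

lemma sqInt_integrable (φ ψ : Q.SqInt) :
    Integrable (fun x => Q.h.toFun x (φ.sec x) (ψ.sec x)) Ω.liouville :=
  Q.h.integrable φ.2.1 ψ.2.1 φ.2.2 ψ.2.2

/-- The inner product in Mathlib's convention (conjugate linear in the first variable):
`inner φ ψ = ⟨ψ|φ⟩`. -/
@[reducible] def innerCore : PreInnerProductSpace.Core ℂ Q.SqInt where
  inner φ ψ := Q.braket ψ φ
  conj_inner_symm φ ψ := by
    simp only [braket, map_mul, Complex.conj_ofReal, ← integral_conj]
    congr 2
    funext x
    exact (Q.h.conj_symm x _ _).symm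
  re_inner_nonneg φ := by
    have h0 : 0 ≤ (∫ x, Q.h.toFun x (φ.sec x) (φ.sec x) ∂Ω.liouville).re := by
      have := integral_re (Q.sqInt_integrable φ φ)
      simp only [RCLike.re_to_complex] at this
      rw [← this]
      exact integral_nonneg fun x => Q.h.self_re_nonneg x _
    have hħ := Q.hbar_pos
    simp only [braket, RCLike.re_to_complex, Complex.re_ofReal_mul]
    positivity
  add_left φ₁ φ₂ ψ := by
    simp only [braket, ← mul_add]
    rw [← integral_add (Q.sqInt_integrable _ _) (Q.sqInt_integrable _ _)]
    congr 2
    funext x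
    exact map_add _ _ _
  smul_left φ ψ c := by
    have : (fun x => Q.h.toFun x (ψ.sec x) ((c • φ).sec x)) =
        fun x => conj c * Q.h.toFun x (ψ.sec x) (φ.sec x) := by
      funext x
      exact LinearMap.map_smulₛₗ _ _ _
    simp only [braket, this, integral_const_mul]
    ring

instance : SeminormedAddCommGroup Q.SqInt :=
  @InnerProductSpace.Core.toSeminormedAddCommGroup ℂ Q.SqInt _ _ _ Q.innerCore

instance : InnerProductSpace ℂ Q.SqInt := InnerProductSpace.ofCore Q.innerCore

/-- The Hilbert space obtained by completing the square integrable smooth sections. -/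
abbrev L2 : Type _ := UniformSpace.Completion Q.SqInt

/-- The canonical isometry from square integrable smooth sections into the Hilbert space. -/
def toL2 : Q.SqInt →ₗᵢ[ℂ] Q.L2 := UniformSpace.Completion.toComplₗᵢ

/-- The smooth sections with compact support (they are all square integrable, as the Liouville
measure is finite on compact sets). -/
def compactlySupported : Submodule ℂ Q.SqInt where
  carrier := {ψ | IsCompact (closure {x | ψ.sec x ≠ 0})}
  zero_mem' := by
    have : {x | (0 : Q.SqInt).sec x ≠ 0} = ∅ := by
      ext x
      simp only [Set.mem_ofPred_eq, Set.mem_empty_iff_false, not_not, iff_false]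
      rfl
    simp only [Set.mem_ofPred_eq, this, closure_empty, isCompact_empty]
  add_mem' := by
    intro φ ψ hφ hψ
    refine (hφ.union hψ).of_isClosed_subset isClosed_closure ?_
    rw [← closure_union]
    refine closure_mono fun x hx => ?_
    by_contra hc
    simp only [Set.mem_union, Set.mem_ofPred_eq, not_or, not_not] at hc
    exact hx ((congrArg₂ (· + ·) hc.1 hc.2).trans (add_zero _))
  smul_mem' := by
    intro c ψ hψ
    refine hψ.of_isClosed_subset isClosed_closure (closure_mono fun x hx hc => hx ?_)
    exact (congrArg (c • ·) hc).trans (smul_zero c)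

/-- The prequantum Hilbert space `H_P`: the completion of the space of compactly supported smooth
sections, realized as its closure in the Hilbert space `L2`. -/
def HP : Submodule ℂ Q.L2 :=
  (Q.compactlySupported.map Q.toL2.toLinearMap).topologicalClosure

/-- The space `Γ_hol(L)` of holomorphic (that is, polarized: `∇_P ψ = 0`) square integrable
smooth sections of `L`, where `∇_{v + iw} = ∇_v + i ∇_w`. -/
def holSections (P : ComplexPolarization Ω) : Submodule ℂ Q.SqInt where
  carrier := {ψ | ∀ x, ∀ v w : Tan n x, cvec v w ∈ P.toFun x →
    Q.nabla ψ.sec x v + Complex.I • Q.nabla ψ.sec x w = 0}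
  zero_mem' := by
    intro x v w _
    have h0 : Q.nabla (0 : Q.SqInt).sec = 0 := Q.nabla.zero
    simp [h0]
  add_mem' := by
    intro φ ψ hφ hψ x v w hvw
    have hadd : Q.nabla (φ + ψ).sec x = Q.nabla φ.sec x + Q.nabla ψ.sec x :=
      Q.nabla.isCovariantDerivativeOnUniv.add (φ.2.1.mdifferentiableAt_section x)
        (ψ.2.1.mdifferentiableAt_section x)
    have := congrArg₂ (· + ·) (hφ x v w hvw) (hψ x v w hvw)
    simp only [add_zero] at this
    rw [hadd, ← this]
    simp only [add_apply, smul_add]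
    abel
  smul_mem' := by
    intro c ψ hψ x v w hvw
    have hsm : ∀ u, Q.nabla (c • ψ).sec x u = c • Q.nabla ψ.sec x u :=
      fun u => Q.nabla_smul c ψ.sec ψ.2.1 x u
    rw [hsm, hsm, smul_comm Complex.I c, ← smul_add, hψ x v w hvw, smul_zero]

end Prequantization

end Bundle

end

end GeometricQuantization

/-! Near any point, a polarized section is, in a chart and a trivialization, a function f with Zⱼf =
Aⱼf, where the Zⱼ = Xⱼ + iYⱼ span P. The condition P ∩ P̄ = 0 says that the n real parts and n
imaginary parts together span the tangent space (`span_re_im_eq_top`), so this first order system is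
elliptic. Everything follows from the mean value principle for such systems: L² bounds control
suprema of f and of all its derivatives on smaller balls. No holomorphic coordinates, and hence no
Newlander–Nirenberg theorem, are needed.

The estimate rests on an identity. For a compactly supported v = p + iq, the sum |Xp|² + |Yp|² +
|Xq|² + |Yq|² differs from |Zv|² only by a multiple of the Jacobian Xq·Yp − Xp·Yq. Integration by
parts turns the integral of the Jacobian into one of q times first derivatives of p
(`exists_drift`), which can be absorbed. This is `EllipticFrame.energy_estimate`; a cutoff turns it
into `interior_estimate`. Differentiating the system shows that a solution together with its first
derivatives solves a system with the same Zⱼ (`IsSolution.prolong`), so the estimate iterates to all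
orders. The elementary inequality |f| ≤ ∫ |∂₁⋯∂_N f| (`norm_le_integral_iterPderiv`) then gives the
supremum bound `exists_norm_le`, and with it the smoothness of L² limits
(`IsCauchyL2.contDiffOn_limit`).

Local L² norms are bounded by the global norm because the Liouville density is positive in every
chart: the top power of a nondegenerate 2-form is nonzero on every basis (`wedgePow_ne_zero`). Hence
a section in Γ_hol of norm zero vanishes, and a Cauchy sequence in Γ_hol converges pointwise, with
its first derivatives, to a smooth polarized section (`exists_limit_section`). Fatou's lemma makes
the pointwise limit a limit in norm (`exists_tendsto_of_pointwise`), so Γ_hol is complete, and its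
isometric image in a Hilbert space is closed. Containment in H_P holds for every square integrable
smooth section, by cutting off along a compact exhaustion (`mem_closure_compactlySupported`). -/

namespace GeometricQuantization

/-! ### Partial derivatives on Euclidean space -/

section PartialDerivatives

variable {N : ℕ} {F : Type*} [NormedAddCommGroup F] [NormedSpace ℝ F]

/-- The Euclidean space `ℝᴺ`. -/
abbrev Euc (N : ℕ) : Type := EuclideanSpace ℝ (Fin N)

/-- The `i`-th partial derivative. -/
noncomputable def pderiv (i : Fin N) (f : Euc N → F) (y : Euc N) : F :=
  fderiv ℝ f y (EuclideanSpace.single i 1)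

lemma contDiff_pderiv (i : Fin N) {f : Euc N → F} (hf : ContDiff ℝ ∞ f) :
    ContDiff ℝ ∞ (pderiv i f) :=
  (hf.fderiv_right (m := ∞) (by simp)).clm_apply contDiff_const

lemma fderiv_apply_eq_sum (f : Euc N → F) (y v : Euc N) :
    fderiv ℝ f y v = ∑ i, v i • pderiv i f y := by
  conv_lhs => rw [← (EuclideanSpace.basisFun (Fin N) ℝ).sum_repr v]
  simp [pderiv, map_sum]

lemma tsupport_pderiv_subset (i : Fin N) (f : Euc N → F) :
    tsupport (pderiv i f) ⊆ tsupport f :=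
  (closure_mono fun y hy => by
    contrapose! hy
    simp only [Function.mem_support, not_not] at hy ⊢
    simp [pderiv, hy]).trans (tsupport_fderiv_subset ℝ (f := f))

lemma hasCompactSupport_pderiv (i : Fin N) {f : Euc N → F} (hf : HasCompactSupport f) :
    HasCompactSupport (pderiv i f) :=
  hf.of_isClosed_subset (isClosed_tsupport _) (tsupport_pderiv_subset i f)

lemma pderiv_pderiv_comm (i j : Fin N) {f : Euc N → F} (hf : ContDiff ℝ ∞ f) :
    pderiv i (pderiv j f) = pderiv j (pderiv i f) := by
  have key : ∀ (i j : Fin N) (y : Euc N), pderiv i (pderiv j f) y =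
      fderiv ℝ (fderiv ℝ f) y (EuclideanSpace.single i 1) (EuclideanSpace.single j 1) := by
    intro i j y
    have h1 : DifferentiableAt ℝ (fderiv ℝ f) y :=
      (hf.fderiv_right (m := ∞) (by simp)).differentiable (by simp) y
    have : HasFDerivAt (pderiv j f)
        ((ContinuousLinearMap.apply ℝ F (EuclideanSpace.single j (1 : ℝ))).comp
          (fderiv ℝ (fderiv ℝ f) y)) y :=
      (ContinuousLinearMap.apply ℝ F (EuclideanSpace.single j (1 : ℝ))).hasFDerivAt.comp y
        h1.hasFDerivAt
    rw [pderiv, this.fderiv]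
    rfl
  funext y
  rw [key, key]
  exact (hf.contDiffAt (x := y)).isSymmSndFDerivAt
    (by simpa using WithTop.coe_le_coe.2 (le_top : (2 : ℕ∞) ≤ ⊤)) _ _

lemma pderiv_mul (i : Fin N) {f g : Euc N → ℝ} {y : Euc N} (hf : DifferentiableAt ℝ f y)
    (hg : DifferentiableAt ℝ g y) :
    pderiv i (fun y => f y * g y) y = f y * pderiv i g y + g y * pderiv i f y := by
  simp [pderiv, fderiv_fun_mul hf hg]

lemma integral_pderiv_eq_zero (i : Fin N) {f : Euc N → ℝ} (hf : ContDiff ℝ ∞ f)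
    (hc : HasCompactSupport f) : ∫ y, pderiv i f y = 0 := by
  have h1 := (contDiff_pderiv i hf).continuous.integrable_of_hasCompactSupport (μ := volume)
    (hasCompactSupport_pderiv i hc)
  have h2 := hf.continuous.integrable_of_hasCompactSupport (μ := volume) hc
  have h := integral_mul_fderiv_eq_neg_fderiv_mul_of_integrable (μ := (volume : Measure (Euc N)))
    (f := fun _ : Euc N => (1 : ℝ)) (g := f) (v := EuclideanSpace.single i 1) (by simp)
    (by simp only [one_mul]; exact h1) (by simpa using h2) (by fun_prop)
    (fun x _ => hf.differentiable (by simp) x)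
  simpa [pderiv] using h

/-- The two-dimensional Jacobian of a pair of functions is a divergence. -/
lemma integral_mul_jacobian (k l : Fin N) {c p q : Euc N → ℝ} (hc : ContDiff ℝ ∞ c)
    (hp : ContDiff ℝ ∞ p) (hq : ContDiff ℝ ∞ q) (hqc : HasCompactSupport q) :
    ∫ y, c y * (pderiv k q y * pderiv l p y - pderiv l q y * pderiv k p y) =
      ∫ y, q y * (pderiv l c y * pderiv k p y - pderiv k c y * pderiv l p y) := by
  have hpk := contDiff_pderiv k hp
  have hpl := contDiff_pderiv l hp
  have hqk := contDiff_pderiv k hq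
  have hql := contDiff_pderiv l hq
  have hck := contDiff_pderiv k hc
  have hcl := contDiff_pderiv l hc
  have hsk := hasCompactSupport_pderiv k hqc
  have hsl := hasCompactSupport_pderiv l hqc
  have e1 : ContDiff ℝ ∞ fun y => q y * (c y * pderiv l p y) := by fun_prop
  have e2 : ContDiff ℝ ∞ fun y => q y * (c y * pderiv k p y) := by fun_prop
  have s1 : HasCompactSupport fun y => q y * (c y * pderiv l p y) := hqc.mul_right
  have s2 : HasCompactSupport fun y => q y * (c y * pderiv k p y) := hqc.mul_right
  have d1 := integral_pderiv_eq_zero k e1 s1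
  have d2 := integral_pderiv_eq_zero l e2 s2
  have i1 : Integrable (pderiv k fun y => q y * (c y * pderiv l p y)) :=
    (contDiff_pderiv k e1).continuous.integrable_of_hasCompactSupport
      (hasCompactSupport_pderiv k s1)
  have i2 : Integrable (pderiv l fun y => q y * (c y * pderiv k p y)) :=
    (contDiff_pderiv l e2).continuous.integrable_of_hasCompactSupport
      (hasCompactSupport_pderiv l s2)
  have i3 : Integrable
      fun y => q y * (pderiv l c y * pderiv k p y - pderiv k c y * pderiv l p y) := by
    refine Continuous.integrable_of_hasCompactSupport ?_ hqc.mul_right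
    have := hq.continuous; have := hck.continuous; have := hcl.continuous
    have := hpk.continuous; have := hpl.continuous
    fun_prop
  -- The two divergences also produce the terms q c ∂ₖ∂ₗp and q c ∂ₗ∂ₖp. These cancel by symmetry,
  -- which leaves only first derivatives of p against q.
  have : (fun y => c y * (pderiv k q y * pderiv l p y - pderiv l q y * pderiv k p y)) =
      fun y => (pderiv k (fun y => q y * (c y * pderiv l p y)) y
        - pderiv l (fun y => q y * (c y * pderiv k p y)) y)
        + q y * (pderiv l c y * pderiv k p y - pderiv k c y * pderiv l p y) := by
    funext y
    have D : ∀ {f : Euc N → ℝ}, ContDiff ℝ ∞ f → DifferentiableAt ℝ f y :=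
      fun h => h.differentiable (by simp) y
    rw [pderiv_mul k (D hq) (D (hc.mul hpl)), pderiv_mul k (D hc) (D hpl),
      pderiv_mul l (D hq) (D (hc.mul hpk)), pderiv_mul l (D hc) (D hpk),
      pderiv_pderiv_comm l k hp]
    ring
  rw [this, integral_add (by exact i1.sub i2) i3, integral_sub i1 i2, d1, d2]
  simp

end PartialDerivatives

/-! ### The energy estimate for an elliptic family of complex vector fields -/

section EnergyEstimate

variable {N : ℕ}

/-- Finitely many smooth complex vector fields `Xⱼ + i Yⱼ` on `ℝᴺ` whose real and imaginary parts
span, with a uniform bound, at each point of a closed ball. -/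
structure EllipticFrame (N : ℕ) (J : Type*) [Fintype J] where
  /-- the centre of the ball -/
  center : Euc N
  /-- the radius of the ball -/
  radius : ℝ
  /-- the real parts -/
  X : J → Euc N → Euc N
  /-- the imaginary parts -/
  Y : J → Euc N → Euc N
  smooth_X : ∀ j, ContDiff ℝ ∞ (X j)
  smooth_Y : ∀ j, ContDiff ℝ ∞ (Y j)
  /-- the ellipticity constant -/
  const : ℝ
  const_nonneg : 0 ≤ const
  elliptic : ∀ y ∈ Metric.closedBall center radius, ∀ ℓ : Euc N →L[ℝ] ℝ,
    ∑ k, ℓ (EuclideanSpace.single k 1) ^ 2 ≤ const * ∑ j, (ℓ (X j y) ^ 2 + ℓ (Y j y) ^ 2)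

/-- The cross term in |(X + iY)(p + iq)|² is a combination of the Jacobians ∂ₖq ∂ₗp − ∂ₗq ∂ₖp with
coefficients XₖYₗ. It is quadratic in first derivatives, but its integral loses one order: no
derivative of q survives. The drift b depends on the fields alone, which is what makes the energy
constant uniform. -/
lemma exists_drift {X Y : Euc N → Euc N} (hX : ContDiff ℝ ∞ X) (hY : ContDiff ℝ ∞ Y) :
    ∃ b : Fin N → Euc N → ℝ, (∀ k, Continuous (b k)) ∧ ∀ p q : Euc N → ℝ,
      ContDiff ℝ ∞ p → ContDiff ℝ ∞ q → HasCompactSupport q →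
      ∫ y, (fderiv ℝ q y (X y) * fderiv ℝ p y (Y y) - fderiv ℝ p y (X y) * fderiv ℝ q y (Y y)) =
        ∫ y, q y * ∑ k, b k y * pderiv k p y := by
  let c : Fin N → Fin N → Euc N → ℝ := fun k l y => X y k * Y y l
  have hc : ∀ k l, ContDiff ℝ ∞ (c k l) := fun k l =>
    ((contDiff_euclidean (𝕜 := ℝ)).1 hX k).mul ((contDiff_euclidean (𝕜 := ℝ)).1 hY l)
  -- This is `integral_mul_jacobian` summed over k and l, with the indices exchanged in the second
  -- sum so that both contribute to the coefficient of ∂ₖp.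
  refine ⟨fun k y => ∑ l, (pderiv l (c k l) y - pderiv l (c l k) y), fun k =>
    continuous_finsetSum _ fun l _ => (contDiff_pderiv l (hc k l)).continuous.sub
      (contDiff_pderiv l (hc l k)).continuous, ?_⟩
  intro p q hp hq hqc
  have hpd := fun k => (contDiff_pderiv k hp).continuous
  have hqd := fun k => (contDiff_pderiv k hq).continuous
  have hcd := fun i k l => (contDiff_pderiv i (hc k l)).continuous
  have hcc := fun k l => (hc k l).continuous
  have hqcont := hq.continuous
  have hqs := fun k => hasCompactSupport_pderiv k hqc
  have i1 : ∀ k l, Integrable fun y =>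
      c k l y * (pderiv k q y * pderiv l p y - pderiv l q y * pderiv k p y) := by
    intro k l
    refine Continuous.integrable_of_hasCompactSupport ?_ (HasCompactSupport.mul_left ?_)
    · have := hpd k; have := hpd l; have := hqd k; have := hqd l; have := hcc k l
      fun_prop
    · exact (hqs k).mul_right.sub (hqs l).mul_right
  have i2 : ∀ k l, Integrable fun y =>
      q y * (pderiv l (c k l) y * pderiv k p y - pderiv k (c k l) y * pderiv l p y) := by
    intro k l
    refine Continuous.integrable_of_hasCompactSupport ?_ hqc.mul_right
    have := hpd k; have := hpd l; have := hcd k k l; have := hcd l k l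
    fun_prop
  calc ∫ y, (fderiv ℝ q y (X y) * fderiv ℝ p y (Y y) - fderiv ℝ p y (X y) * fderiv ℝ q y (Y y))
      = ∫ y, ∑ k, ∑ l,
          c k l y * (pderiv k q y * pderiv l p y - pderiv l q y * pderiv k p y) := by
        congr 1
        funext y
        simp only [fderiv_apply_eq_sum, Finset.sum_mul_sum, ← Finset.sum_sub_distrib, c,
          smul_eq_mul]
        refine Finset.sum_congr rfl fun k _ => Finset.sum_congr rfl fun l _ => ?_
        ring
    _ = ∑ k, ∑ l, ∫ y, c k l y * (pderiv k q y * pderiv l p y - pderiv l q y * pderiv k p y) := by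
        rw [integral_finsetSum _ fun k _ => integrable_finsetSum _ fun l _ => i1 k l]
        exact Finset.sum_congr rfl fun k _ => integral_finsetSum _ fun l _ => i1 k l
    _ = ∑ k, ∑ l, ∫ y,
          q y * (pderiv l (c k l) y * pderiv k p y - pderiv k (c k l) y * pderiv l p y) :=
        Finset.sum_congr rfl fun k _ => Finset.sum_congr rfl fun l _ =>
          integral_mul_jacobian k l (hc k l) hp hq hqc
    _ = ∫ y, ∑ k, ∑ l,
          q y * (pderiv l (c k l) y * pderiv k p y - pderiv k (c k l) y * pderiv l p y) := by
        rw [integral_finsetSum _ fun k _ => integrable_finsetSum _ fun l _ => i2 k l]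
        exact Finset.sum_congr rfl fun k _ => (integral_finsetSum _ fun l _ => i2 k l).symm
    _ = _ := by
        congr 1
        funext y
        simp only [mul_sub, Finset.sum_sub_distrib, sub_mul, Finset.sum_mul, Finset.mul_sum]
        congr 1
        exact Finset.sum_comm

variable {J : Type*} [Fintype J]

/-- The energy estimate for pairs `(p, q)`, regarded as complex valued functions `p + i q`,
supported in the ball of an elliptic frame. -/
lemma EllipticFrame.energy_estimate_real (Φ : EllipticFrame N J) :
    ∃ C : ℝ, 0 ≤ C ∧ ∀ p q : Euc N → ℝ, ContDiff ℝ ∞ p → ContDiff ℝ ∞ q →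
      tsupport p ⊆ Metric.closedBall Φ.center Φ.radius →
      tsupport q ⊆ Metric.closedBall Φ.center Φ.radius →
      ∫ y, ∑ k, (pderiv k p y ^ 2 + pderiv k q y ^ 2) ≤
        C * ((∑ j, ∫ y, ((fderiv ℝ p y (Φ.X j y) - fderiv ℝ q y (Φ.Y j y)) ^ 2 +
          (fderiv ℝ q y (Φ.X j y) + fderiv ℝ p y (Φ.Y j y)) ^ 2)) + ∫ y, q y ^ 2) := by
  choose b hb hbi using fun j => exists_drift (Φ.smooth_X j) (Φ.smooth_Y j)
  set c := Φ.const with hcdef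
  have hc0 : 0 ≤ c := Φ.const_nonneg
  let B : Fin N → Euc N → ℝ := fun k y => ∑ j, b j k y
  have hB : ∀ k, Continuous (B k) := fun k => continuous_finsetSum _ fun j _ => hb j k
  -- The weight 2c²B² is the price of the absorption 2cBq·∂p ≤ ½(∂p)² + 2c²B²q² made below; moving
  -- the half to the left then doubles the constants.
  obtain ⟨D, hD⟩ := (isCompact_closedBall Φ.center Φ.radius).bddAbove_image
    (f := fun y => ∑ k, 2 * c ^ 2 * B k y ^ 2) (by fun_prop)
  have hD' : ∀ y ∈ Metric.closedBall Φ.center Φ.radius, ∑ k, 2 * c ^ 2 * B k y ^ 2 ≤ max D 0 :=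
    fun y hy => (hD (Set.mem_image_of_mem _ hy)).trans (le_max_left _ _)
  refine ⟨2 * c + 2 * max D 0, by positivity, ?_⟩
  intro p q hp hq hps hqs
  have hpc : HasCompactSupport p :=
    (isCompact_closedBall _ _).of_isClosed_subset (isClosed_tsupport _) hps
  have hqc : HasCompactSupport q :=
    (isCompact_closedBall _ _).of_isClosed_subset (isClosed_tsupport _) hqs
  have hX := fun j => (Φ.smooth_X j).continuous
  have hY := fun j => (Φ.smooth_Y j).continuous
  have hfp : Continuous (fderiv ℝ p) := (hp.continuous_fderiv (by simp))
  have hfq : Continuous (fderiv ℝ q) := (hq.continuous_fderiv (by simp))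
  have hcp := hp.continuous
  have hcq := hq.continuous
  have hpd := fun k => (contDiff_pderiv k hp).continuous
  have hqd := fun k => (contDiff_pderiv k hq).continuous
  have sp : ∀ y, y ∉ Metric.closedBall Φ.center Φ.radius → fderiv ℝ p y = 0 := fun y hy =>
    image_eq_zero_of_notMem_tsupport fun h => hy (hps (tsupport_fderiv_subset ℝ h))
  have sq : ∀ y, y ∉ Metric.closedBall Φ.center Φ.radius → fderiv ℝ q y = 0 := fun y hy =>
    image_eq_zero_of_notMem_tsupport fun h => hy (hqs (tsupport_fderiv_subset ℝ h))
  have sq0 : ∀ y, y ∉ Metric.closedBall Φ.center Φ.radius → q y = 0 := fun y hy =>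
    image_eq_zero_of_notMem_tsupport fun h => hy (hqs h)
  have integ : ∀ {f : Euc N → ℝ}, Continuous f →
      (∀ y, y ∉ Metric.closedBall Φ.center Φ.radius → f y = 0) → Integrable f :=
    fun hf h0 => hf.integrable_of_hasCompactSupport
      (HasCompactSupport.intro (isCompact_closedBall _ _) h0)
  set G : Euc N → ℝ := fun y => ∑ k, (pderiv k p y ^ 2 + pderiv k q y ^ 2) with hG
  set Z : J → Euc N → ℝ := fun j y => (fderiv ℝ p y (Φ.X j y) - fderiv ℝ q y (Φ.Y j y)) ^ 2 +
          (fderiv ℝ q y (Φ.X j y) + fderiv ℝ p y (Φ.Y j y)) ^ 2 with hZ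
  set W : J → Euc N → ℝ := fun j y => fderiv ℝ q y (Φ.X j y) * fderiv ℝ p y (Φ.Y j y) -
    fderiv ℝ p y (Φ.X j y) * fderiv ℝ q y (Φ.Y j y) with hW
  have iG : Integrable G := integ (by fun_prop) fun y hy => by
    simp [hG, pderiv, sp y hy, sq y hy]
  have iZ : ∀ j, Integrable (Z j) := fun j => by
    have := hX j; have := hY j
    exact integ (by fun_prop) fun y hy => by simp [hZ, sp y hy, sq y hy]
  have iW : ∀ j, Integrable (W j) := fun j => by
    have := hX j; have := hY j
    exact integ (by fun_prop) fun y hy => by simp [hW, sp y hy, sq y hy]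
  have iQ : Integrable fun y => q y ^ 2 := integ (by fun_prop) fun y hy => by simp [sq0 y hy]
  have iB : ∀ j, Integrable fun y => q y * ∑ k, b j k y * pderiv k p y := fun j => by
    have := hb j
    exact integ (by fun_prop) fun y hy => by simp [sq0 y hy]
  -- Ellipticity is applied to dp and dq separately. Subtracting 2W removes the cross terms of |(Xⱼ
  -- + iYⱼ)(p + iq)|² exactly.
  have h1 : ∀ y, G y ≤ c * ∑ j, (Z j y - 2 * W j y) := by
    intro y
    by_cases hy : y ∈ Metric.closedBall Φ.center Φ.radius
    · have e1 := Φ.elliptic y hy (fderiv ℝ p y)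
      have e2 := Φ.elliptic y hy (fderiv ℝ q y)
      have : ∑ j, (Z j y - 2 * W j y) =
          ∑ j, (fderiv ℝ p y (Φ.X j y) ^ 2 + fderiv ℝ p y (Φ.Y j y) ^ 2) +
          ∑ j, (fderiv ℝ q y (Φ.X j y) ^ 2 + fderiv ℝ q y (Φ.Y j y) ^ 2) := by
        rw [← Finset.sum_add_distrib]
        refine Finset.sum_congr rfl fun j _ => ?_
        simp only [hZ, hW]
        ring
      rw [this, hG, mul_add]
      simp only [Finset.sum_add_distrib, pderiv] at e1 e2 ⊢
      exact add_le_add e1 e2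
    · simp [hG, hZ, hW, pderiv, sp y hy, sq y hy]
  have h2 : ∫ y, G y ≤ c * (∑ j, ∫ y, Z j y) + ∫ y, q y * ∑ k, (-2 * c * B k y) * pderiv k p y := by
    calc ∫ y, G y ≤ ∫ y, c * ∑ j, (Z j y - 2 * W j y) :=
          integral_mono iG ((integrable_finsetSum _ fun j _ =>
            (iZ j).sub ((iW j).const_mul 2)).const_mul c) h1
      _ = c * ∑ j, ((∫ y, Z j y) - 2 * ∫ y, W j y) := by
          rw [integral_const_mul,
            integral_finsetSum _ fun j _ => by exact (iZ j).sub ((iW j).const_mul 2)]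
          congr 1
          refine Finset.sum_congr rfl fun j _ => ?_
          rw [integral_sub (iZ j) ((iW j).const_mul 2), integral_const_mul]
      _ = c * ∑ j, ((∫ y, Z j y) - 2 * ∫ y, q y * ∑ k, b j k y * pderiv k p y) := by
          congr 1
          exact Finset.sum_congr rfl fun j _ => by rw [hbi j p q hp hq hqc]
      _ = _ := by
          have : (fun y => q y * ∑ k, (-2 * c * B k y) * pderiv k p y) =
              fun y => ∑ j, (-2 * c) * (q y * ∑ k, b j k y * pderiv k p y) := by
            funext y
            simp only [B, Finset.mul_sum, Finset.sum_mul]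
            rw [Finset.sum_comm]
            refine Finset.sum_congr rfl fun j _ => Finset.sum_congr rfl fun k _ => by ring
          rw [this, integral_finsetSum _ fun j _ => (iB j).const_mul _]
          simp only [integral_const_mul, Finset.sum_sub_distrib, mul_sub, ← Finset.mul_sum]
          ring
  -- Half of the gradient energy is given up here to absorb the drift term.
  have h3 : ∫ y, q y * ∑ k, (-2 * c * B k y) * pderiv k p y ≤
      ∫ y, (1 / 2 * G y + max D 0 * q y ^ 2) := by
    refine integral_mono (integ (by fun_prop) fun y hy => by simp [sq0 y hy])
      ((iG.const_mul _).add (iQ.const_mul _)) fun y => ?_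
    by_cases hy : y ∈ Metric.closedBall Φ.center Φ.radius
    · have hq2 : (∑ k, 2 * c ^ 2 * B k y ^ 2) * q y ^ 2 ≤ max D 0 * q y ^ 2 :=
        mul_le_mul_of_nonneg_right (hD' y hy) (sq_nonneg _)
      refine le_trans ?_ (add_le_add_right hq2 _)
      simp only [hG, Finset.mul_sum, Finset.sum_mul]
      rw [← Finset.sum_add_distrib]
      refine Finset.sum_le_sum fun k _ => ?_
      nlinarith [sq_nonneg (pderiv k p y + 2 * c * B k y * q y), sq_nonneg (pderiv k q y)]
    · have : G y = 0 := by simp [hG, pderiv, sp y hy, sq y hy]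
      simp [sq0 y hy, this]
  rw [integral_add (iG.const_mul _) (iQ.const_mul _), integral_const_mul, integral_const_mul] at h3
  have hZ0 : 0 ≤ ∑ j, ∫ y, Z j y :=
    Finset.sum_nonneg fun j _ => integral_nonneg fun y => by simp only [hZ]; positivity
  have hQ0 : 0 ≤ ∫ y, q y ^ 2 := integral_nonneg fun y => sq_nonneg _
  have hD0 : 0 ≤ max D 0 := le_max_right _ _
  nlinarith [mul_nonneg hD0 hZ0, mul_nonneg hc0 hQ0]

/-- The energy estimate for complex valued functions supported in the ball of an elliptic
frame. -/
lemma EllipticFrame.energy_estimate (Φ : EllipticFrame N J) :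
    ∃ C : ℝ, 0 ≤ C ∧ ∀ v : Euc N → ℂ, ContDiff ℝ ∞ v →
      tsupport v ⊆ Metric.closedBall Φ.center Φ.radius →
      ∫ y, ∑ k, ‖pderiv k v y‖ ^ 2 ≤
        C * ((∑ j, ∫ y, ‖fderiv ℝ v y (Φ.X j y) + Complex.I * fderiv ℝ v y (Φ.Y j y)‖ ^ 2) +
          ∫ y, ‖v y‖ ^ 2) := by
  obtain ⟨C, hC, H⟩ := Φ.energy_estimate_real
  refine ⟨C, hC, fun v hv hvs => ?_⟩
  have hre : ContDiff ℝ ∞ fun y => (v y).re := Complex.reCLM.contDiff.comp hv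
  have him : ContDiff ℝ ∞ fun y => (v y).im := Complex.imCLM.contDiff.comp hv
  have dv : ∀ y, DifferentiableAt ℝ v y := fun y => hv.differentiable (by simp) y
  have fre : ∀ y w, fderiv ℝ (fun y => (v y).re) y w = (fderiv ℝ v y w).re := fun y w => by
    have h : HasFDerivAt (fun y => (v y).re) (Complex.reCLM.comp (fderiv ℝ v y)) y :=
      Complex.reCLM.hasFDerivAt.comp y (dv y).hasFDerivAt
    rw [h.fderiv]
    rfl
  have fim : ∀ y w, fderiv ℝ (fun y => (v y).im) y w = (fderiv ℝ v y w).im := fun y w => by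
    have h : HasFDerivAt (fun y => (v y).im) (Complex.imCLM.comp (fderiv ℝ v y)) y :=
      Complex.imCLM.hasFDerivAt.comp y (dv y).hasFDerivAt
    rw [h.fderiv]
    rfl
  have hsub : ∀ g : ℂ → ℝ, g 0 = 0 → tsupport (fun y => g (v y)) ⊆ tsupport v := fun g hg =>
    closure_mono (Function.support_comp_subset hg v)
  have h := H _ _ hre him ((hsub Complex.re rfl).trans hvs) ((hsub Complex.im rfl).trans hvs)
  have nsq : ∀ z : ℂ, ‖z‖ ^ 2 = z.re ^ 2 + z.im ^ 2 := fun z => by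
    rw [← Complex.normSq_eq_norm_sq, Complex.normSq_apply]; ring
  have hvc : HasCompactSupport v :=
    (isCompact_closedBall _ _).of_isClosed_subset (isClosed_tsupport _) hvs
  have hle : ∫ y, (v y).im ^ 2 ≤ ∫ y, ‖v y‖ ^ 2 := by
    have hvcont := hv.continuous
    refine integral_mono ?_ ?_ fun y => by simp only [nsq]; nlinarith [sq_nonneg (v y).re]
    · exact Continuous.integrable_of_hasCompactSupport (by fun_prop)
        (hvc.comp_left (g := fun z : ℂ => z.im ^ 2) (by simp))
    · exact Continuous.integrable_of_hasCompactSupport (by fun_prop)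
        (hvc.comp_left (g := fun z : ℂ => ‖z‖ ^ 2) (by simp))
  simp only [pderiv, fre, fim] at h
  simp only [pderiv, nsq, Complex.add_re, Complex.add_im, Complex.mul_re, Complex.mul_im,
    Complex.I_re, Complex.I_im, zero_mul, one_mul, zero_sub, zero_add, ← sub_eq_add_neg]
  simp only [nsq] at hle
  exact h.trans (mul_le_mul_of_nonneg_left (add_le_add_right hle _) hC)

end EnergyEstimate

/-! ### First order elliptic systems and their prolongation -/

section EllipticSystems

variable {N : ℕ} {J : Type*} [Fintype J] {ι : Type*} [Fintype ι]

set_option linter.unusedSectionVars false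

namespace EllipticFrame

variable (Φ : EllipticFrame N J)

/-- The family `u` is smooth and solves `(Xⱼ + i Yⱼ) u = Aⱼ u` on the open ball of the frame. -/
def IsSolution (A : J → ι → ι → Euc N → ℂ) (u : ι → Euc N → ℂ) : Prop :=
  (∀ a, ContDiff ℝ ∞ (u a)) ∧ ∀ j a, ∀ y ∈ Metric.ball Φ.center Φ.radius,
    fderiv ℝ (u a) y (Φ.X j y) + Complex.I * fderiv ℝ (u a) y (Φ.Y j y) =
      ∑ b, A j a b y * u b y

/-- The squared `L²` norm on the concentric closed ball of radius `r`. -/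
noncomputable def normSq (u : ι → Euc N → ℂ) (r : ℝ) : ℝ :=
  ∫ y in Metric.closedBall Φ.center r, ∑ a, ‖u a y‖ ^ 2

lemma normSq_nonneg (u : ι → Euc N → ℂ) (r : ℝ) : 0 ≤ Φ.normSq u r :=
  integral_nonneg fun _ => by positivity

lemma integrableOn_closedBall {f : Euc N → ℝ} (hf : Continuous f) (r : ℝ) :
    IntegrableOn f (Metric.closedBall Φ.center r) :=
  hf.continuousOn.integrableOn_compact (isCompact_closedBall _ _)

lemma normSq_mono {u : ι → Euc N → ℂ} (hu : ∀ a, Continuous (u a)) {r r' : ℝ} (h : r ≤ r') :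
    Φ.normSq u r ≤ Φ.normSq u r' :=
  setIntegral_mono_set (Φ.integrableOn_closedBall (by fun_prop) r')
    (Filter.Eventually.of_forall fun _ => by positivity)
    (Metric.closedBall_subset_closedBall h).eventuallyLE

lemma integral_le_setIntegral_closedBall {f g : Euc N → ℝ} (hf : Continuous f)
    (hg : Continuous g) {r : ℝ} (h0 : ∀ y, y ∉ Metric.closedBall Φ.center r → f y = 0)
    (hfg : ∀ y ∈ Metric.closedBall Φ.center r, f y ≤ g y) :
    ∫ y, f y ≤ ∫ y in Metric.closedBall Φ.center r, g y := by
  rw [← setIntegral_eq_integral_of_forall_compl_eq_zero h0]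
  exact setIntegral_mono_on (Φ.integrableOn_closedBall hf r) (Φ.integrableOn_closedBall hg r)
    Metric.isClosed_closedBall.measurableSet hfg

variable {Φ}

lemma norm_sum_mul_sq_le (m u : ι → ℂ) :
    ‖∑ b, m b * u b‖ ^ 2 ≤ (∑ b, ‖m b‖ ^ 2) * ∑ b, ‖u b‖ ^ 2 := by
  refine le_trans ?_ (Finset.sum_mul_sq_le_sq_mul_sq Finset.univ (fun b => ‖m b‖) fun b => ‖u b‖)
  gcongr
  exact (norm_sum_le _ _).trans_eq (by simp)

lemma fderiv_mul_apply {f g : Euc N → ℂ} (hf : ContDiff ℝ ∞ f) (hg : ContDiff ℝ ∞ g)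
    (y v : Euc N) :
    fderiv ℝ (fun y => f y * g y) y v = fderiv ℝ f y v * g y + f y * fderiv ℝ g y v := by
  rw [fderiv_fun_mul (hf.differentiable (by simp) y) (hg.differentiable (by simp) y)]
  simp only [add_apply, smul_apply, smul_eq_mul]
  ring

/-- A cutoff function for two concentric balls. -/
lemma exists_cutoff (y₀ : Euc N) {r r' : ℝ} (hr : 0 < r) (hrr' : r < r') :
    ∃ χ : Euc N → ℂ, ContDiff ℝ ∞ χ ∧ tsupport χ ⊆ Metric.closedBall y₀ r' ∧
      (∀ y, ‖χ y‖ ≤ 1) ∧ (∀ y, y ∉ Metric.ball y₀ r' → χ y = 0) ∧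
      ∀ y ∈ Metric.closedBall y₀ r, χ =ᶠ[nhds y] fun _ => 1 := by
  let φ : ContDiffBump y₀ := ⟨(r + r') / 2, r', by linarith, by linarith⟩
  refine ⟨fun y => (φ y : ℂ), Complex.ofRealCLM.contDiff.comp φ.contDiff, ?_, ?_, ?_, ?_⟩
  · rw [← φ.tsupport_eq]
    exact closure_mono fun y hy h0 => hy (by simp [h0])
  · intro y
    simpa [abs_of_nonneg φ.nonneg] using φ.le_one
  · intro y hy
    have : φ y = 0 := φ.zero_of_le_dist (by simpa using hy)
    simp [this]
  · intro y hy
    have : y ∈ Metric.ball y₀ φ.rIn :=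
      Metric.closedBall_subset_ball (by show r < (r + r') / 2; linarith) hy
    filter_upwards [φ.eventuallyEq_one_of_mem_ball this] with z hz
    simp [hz]

/-- Interior estimate of the first derivatives of solutions. -/
lemma interior_estimate {A : J → ι → ι → Euc N → ℂ} (hA : ∀ j a b, Continuous (A j a b))
    {r r' : ℝ} (hr : 0 < r) (hrr' : r < r') (hr' : r' ≤ Φ.radius) :
    ∃ C : ℝ, 0 ≤ C ∧ ∀ u, Φ.IsSolution A u →
      ∫ y in Metric.closedBall Φ.center r, ∑ a, ∑ k, ‖pderiv k (u a) y‖ ^ 2 ≤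
        C * Φ.normSq u r' := by
  classical
  obtain ⟨C₀, hC₀, H⟩ := Φ.energy_estimate
  obtain ⟨χ, hχ, hχs, hχ1, hχ0, hχe⟩ := exists_cutoff Φ.center hr hrr'
  -- The localized family v = χu satisfies Zⱼv = (Zⱼχ)u + χAⱼu, again a zeroth order expression in
  -- u.
  let m : J → ι → ι → Euc N → ℂ := fun j a b y =>
    (if a = b then fderiv ℝ χ y (Φ.X j y) + Complex.I * fderiv ℝ χ y (Φ.Y j y) else 0) +
      χ y * A j a b y
  have hdχ : Continuous (fderiv ℝ χ) := hχ.continuous_fderiv (by simp)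
  have hX := fun j => (Φ.smooth_X j).continuous
  have hY := fun j => (Φ.smooth_Y j).continuous
  have hχc := hχ.continuous
  have hm : ∀ j a b, Continuous (m j a b) := by
    intro j a b
    have := hX j; have := hY j; have := hA j a b
    by_cases hab : a = b
    · simp only [m, hab, if_true]; subst hab; fun_prop
    · simp only [m, hab, if_false]; fun_prop
  obtain ⟨K, hK⟩ := (isCompact_closedBall Φ.center r').bddAbove_image
    (f := fun y => ∑ a, ∑ j, ∑ b, ‖m j a b y‖ ^ 2) (by fun_prop)
  have hK' : ∀ y ∈ Metric.closedBall Φ.center r', ∑ a, ∑ j, ∑ b, ‖m j a b y‖ ^ 2 ≤ max K 0 :=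
    fun y hy => (hK (Set.mem_image_of_mem _ hy)).trans (le_max_left _ _)
  refine ⟨C₀ * (max K 0 + 1), by positivity, fun u hu => ?_⟩
  have huc := fun a => (hu.1 a).continuous
  let v : ι → Euc N → ℂ := fun a y => χ y * u a y
  have hv : ∀ a, ContDiff ℝ ∞ (v a) := fun a => hχ.mul (hu.1 a)
  have hvs : ∀ a, tsupport (v a) ⊆ Metric.closedBall Φ.center r' := fun a =>
    (tsupport_mul_subset_left).trans hχs
  have hv0 : ∀ a y, y ∉ Metric.closedBall Φ.center r' → fderiv ℝ (v a) y = 0 := fun a y hy =>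
    image_eq_zero_of_notMem_tsupport fun h => hy (hvs a (tsupport_fderiv_subset ℝ h))
  have hZ : ∀ j a y, fderiv ℝ (v a) y (Φ.X j y) + Complex.I * fderiv ℝ (v a) y (Φ.Y j y) =
      ∑ b, m j a b y * u b y := by
    intro j a y
    simp only [v, m, fderiv_mul_apply hχ (hu.1 a), add_mul, Finset.sum_add_distrib, ite_mul,
      zero_mul, Finset.sum_ite_eq, Finset.mem_univ, if_true]
    -- The equation for u is available only on the open ball. On the bounding sphere and outside it,
    -- χ itself vanishes, so the terms with A and with du both disappear.
    by_cases hy : y ∈ Metric.ball Φ.center r'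
    · have := hu.2 j a y (Metric.ball_subset_ball hr' hy)
      simp only [mul_assoc, ← Finset.mul_sum, ← this]
      ring
    · simp only [hχ0 y hy, zero_mul, Finset.sum_const_zero]
      ring
  have hdv := fun a => (hv a).continuous_fderiv (by simp)
  have hpv := fun a k => (contDiff_pderiv k (hv a)).continuous
  have hpu := fun a k => (contDiff_pderiv k (hu.1 a)).continuous
  have hvc := fun a => (hv a).continuous
  have e1 : ∫ y in Metric.closedBall Φ.center r, ∑ a, ∑ k, ‖pderiv k (u a) y‖ ^ 2 ≤
      ∑ a, ∫ y, ∑ k, ‖pderiv k (v a) y‖ ^ 2 := by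
    have i : ∀ a, Integrable fun y => ∑ k, ‖pderiv k (v a) y‖ ^ 2 := fun a =>
      Continuous.integrable_of_hasCompactSupport (by have := hpv a; fun_prop)
        (HasCompactSupport.intro (isCompact_closedBall Φ.center r') fun y hy => by
          simp [pderiv, hv0 a y hy])
    rw [← integral_finsetSum _ fun a _ => i a]
    refine le_trans (le_of_eq ?_) (setIntegral_le_integral
      (s := Metric.closedBall Φ.center r) (integrable_finsetSum _ fun a _ => i a)
      (Filter.Eventually.of_forall fun y => by positivity))
    refine setIntegral_congr_fun Metric.isClosed_closedBall.measurableSet fun y hy => ?_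
    have : ∀ a, fderiv ℝ (v a) y = fderiv ℝ (u a) y := fun a => by
      apply Filter.EventuallyEq.fderiv_eq
      filter_upwards [hχe y hy] with z hz
      simp [v, hz]
    simp only [pderiv, this]
  have e2 : ∑ a, ∑ j, ∫ y, ‖fderiv ℝ (v a) y (Φ.X j y) +
      Complex.I * fderiv ℝ (v a) y (Φ.Y j y)‖ ^ 2 ≤ max K 0 * Φ.normSq u r' := by
    have c : ∀ a j, Continuous fun y => ‖fderiv ℝ (v a) y (Φ.X j y) +
      Complex.I * fderiv ℝ (v a) y (Φ.Y j y)‖ ^ 2 := fun a j => by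
        have := hdv a; have := hX j; have := hY j
        fun_prop
    have i : ∀ a j, Integrable fun y => ‖fderiv ℝ (v a) y (Φ.X j y) +
      Complex.I * fderiv ℝ (v a) y (Φ.Y j y)‖ ^ 2 := fun a j =>
      (c a j).integrable_of_hasCompactSupport
        (HasCompactSupport.intro (isCompact_closedBall Φ.center r') fun y hy => by
          simp [hv0 a y hy])
    simp only [← integral_finsetSum _ fun j _ => i _ j]
    rw [← integral_finsetSum _ fun a _ => integrable_finsetSum _ fun j _ => i a j, normSq,
      ← integral_const_mul]
    refine Φ.integral_le_setIntegral_closedBall (by fun_prop) (by fun_prop)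
      (fun y hy => by simp [hv0 _ y hy]) fun y hy => ?_
    refine le_trans ?_ (mul_le_mul_of_nonneg_right (hK' y hy) (by positivity))
    simp only [hZ, Finset.sum_mul]
    refine Finset.sum_le_sum fun a _ => Finset.sum_le_sum fun j _ => ?_
    rw [← Finset.sum_mul]
    exact norm_sum_mul_sq_le _ _
  have e3 : ∑ a, ∫ y, ‖v a y‖ ^ 2 ≤ Φ.normSq u r' := by
    have hv00 : ∀ a y, y ∉ Metric.closedBall Φ.center r' → v a y = 0 := fun a y hy =>
      image_eq_zero_of_notMem_tsupport fun h => hy (hvs a h)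
    have i : ∀ a, Integrable fun y => ‖v a y‖ ^ 2 := fun a =>
      Continuous.integrable_of_hasCompactSupport (by have := hvc a; fun_prop)
        (HasCompactSupport.intro (isCompact_closedBall Φ.center r') fun y hy => by
          simp [hv00 a y hy])
    rw [← integral_finsetSum _ fun a _ => i a]
    refine Φ.integral_le_setIntegral_closedBall (by fun_prop) (by fun_prop)
      (fun y hy => by simp [hv00 _ y hy]) fun y hy => Finset.sum_le_sum fun a _ => ?_
    simp only [v, norm_mul, mul_pow]
    exact mul_le_of_le_one_left (by positivity) (pow_le_one₀ (norm_nonneg _) (hχ1 y))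
  calc _ ≤ ∑ a, ∫ y, ∑ k, ‖pderiv k (v a) y‖ ^ 2 := e1
    _ ≤ ∑ a, C₀ * ((∑ j, ∫ y, ‖fderiv ℝ (v a) y (Φ.X j y) +
          Complex.I * fderiv ℝ (v a) y (Φ.Y j y)‖ ^ 2) + ∫ y, ‖v a y‖ ^ 2) :=
        Finset.sum_le_sum fun a _ => H _ (hv a)
          ((hvs a).trans (Metric.closedBall_subset_closedBall hr'))
    _ ≤ C₀ * (max K 0 * Φ.normSq u r' + Φ.normSq u r') := by
        rw [← Finset.mul_sum, Finset.sum_add_distrib]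
        exact mul_le_mul_of_nonneg_left (add_le_add e2 e3) hC₀
    _ = _ := by ring

/-- A family of functions together with its first partial derivatives. -/
noncomputable def prolong (u : ι → Euc N → ℂ) : Option (Fin N) × ι → Euc N → ℂ
  | (none, a) => u a
  | (some i, a) => pderiv i (u a)

variable (Φ) in
open Classical in
/-- The coefficients of the first order system solved by the prolongation of a solution. -/
noncomputable def prolongCoeff (A : J → ι → ι → Euc N → ℂ) :
    J → Option (Fin N) × ι → Option (Fin N) × ι → Euc N → ℂ
  | j, (none, a), (none, b) => A j a b
  | _, (none, _), (some _, _) => 0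
  | j, (some i, a), (none, b) => pderiv i (A j a b)
  | j, (some i, a), (some k, b) => fun y => (if i = k then A j a b y else 0) -
      if a = b then ((pderiv i (Φ.X j) y k : ℂ) + Complex.I * (pderiv i (Φ.Y j) y k : ℂ)) else 0

lemma contDiff_prolongCoeff {A : J → ι → ι → Euc N → ℂ} (hA : ∀ j a b, ContDiff ℝ ∞ (A j a b)) :
    ∀ j a b, ContDiff ℝ ∞ (Φ.prolongCoeff A j a b) := by
  rintro j ⟨_ | i, a⟩ ⟨_ | k, b⟩
  · exact hA j a b
  · exact contDiff_const
  · exact contDiff_pderiv i (hA j a b)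
  · have hX := Complex.ofRealCLM.contDiff.comp
      ((contDiff_euclidean (𝕜 := ℝ)).1 (contDiff_pderiv i (Φ.smooth_X j)) k)
    have hY := Complex.ofRealCLM.contDiff.comp
      ((contDiff_euclidean (𝕜 := ℝ)).1 (contDiff_pderiv i (Φ.smooth_Y j)) k)
    refine ContDiff.sub ?_ ?_
    · split_ifs
      exacts [hA j a b, contDiff_const]
    · split_ifs
      exacts [hX.add (contDiff_const.mul hY), contDiff_const]

lemma contDiff_prolong {u : ι → Euc N → ℂ} (hu : ∀ a, ContDiff ℝ ∞ (u a)) :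
    ∀ a, ContDiff ℝ ∞ (prolong u a)
  | (none, a) => hu a
  | (some i, a) => contDiff_pderiv i (hu a)

/-- The commutator [∂ᵢ, V] is the first order operator with coefficients ∂ᵢVᵏ. It accounts for the
subtracted term in `prolongCoeff`. -/
lemma pderiv_fderiv_apply (i : Fin N) {f : Euc N → ℂ} (hf : ContDiff ℝ ∞ f)
    {V : Euc N → Euc N} (hV : ContDiff ℝ ∞ V) (y : Euc N) :
    pderiv i (fun y => fderiv ℝ f y (V y)) y =
      fderiv ℝ (pderiv i f) y (V y) + ∑ k, (pderiv i V y k : ℂ) * pderiv k f y := by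
  have h1 : ContDiff ℝ ∞ fun y => fderiv ℝ f y (V y) :=
    (hf.fderiv_right (m := ∞) (by simp)).clm_apply hV
  have h2 : (fun y => fderiv ℝ f y (V y)) = fun y => ∑ k, V y k • pderiv k f y :=
    funext fun y => fderiv_apply_eq_sum f y (V y)
  have hVk : ∀ k, ContDiff ℝ ∞ fun y => V y k := fun k => (contDiff_euclidean (𝕜 := ℝ)).1 hV k
  have hpf := fun k => contDiff_pderiv k hf
  have h3 : ∀ k, fderiv ℝ (fun y => V y k) y (EuclideanSpace.single i 1) = pderiv i V y k := by
    intro k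
    have : HasFDerivAt (fun y => V y k) ((EuclideanSpace.proj (𝕜 := ℝ) k).comp (fderiv ℝ V y)) y :=
      (EuclideanSpace.proj (𝕜 := ℝ) k).hasFDerivAt.comp y
        (hV.differentiable (by simp) y).hasFDerivAt
    rw [this.fderiv]
    rfl
  rw [h2, pderiv, fderiv_fun_sum fun k _ => by
      exact ((hVk k).smul (hpf k)).differentiable (by simp) y,
    fderiv_apply_eq_sum (pderiv i f), sum_apply, ← Finset.sum_add_distrib]
  refine Finset.sum_congr rfl fun k _ => ?_
  rw [fderiv_fun_smul ((hVk k).differentiable (by simp) y) ((hpf k).differentiable (by simp) y)]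
  simp only [add_apply, smul_apply,
    ContinuousLinearMap.smulRight_apply, h3, pderiv_pderiv_comm k i hf]
  rw [← Complex.real_smul]
  rfl

/-- Applying ∂ᵢ to Zⱼu = Aⱼu gives Zⱼ(∂ᵢu) = ∂ᵢ(Aⱼu) − [∂ᵢ, Zⱼ]u, whose right side involves only u
and its first derivatives. The principal part Zⱼ is unchanged, so the same elliptic frame serves at
every order. -/
lemma IsSolution.prolong {A : J → ι → ι → Euc N → ℂ} (hA : ∀ j a b, ContDiff ℝ ∞ (A j a b))
    {u : ι → Euc N → ℂ} (hu : Φ.IsSolution A u) :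
    Φ.IsSolution (Φ.prolongCoeff A) (prolong u) := by
  classical
  refine ⟨contDiff_prolong hu.1, ?_⟩
  rintro j ⟨_ | i, a⟩ y hy
  · simpa [Fintype.sum_prod_type, Fintype.sum_option, prolongCoeff, EllipticFrame.prolong]
      using hu.2 j a y hy
  · have hd : ∀ V : Euc N → Euc N, ContDiff ℝ ∞ V →
        ContDiff ℝ ∞ fun y => fderiv ℝ (u a) y (V y) := fun V hV =>
      ((hu.1 a).fderiv_right (m := ∞) (by simp)).clm_apply hV
    have key : pderiv i (fun y => fderiv ℝ (u a) y (Φ.X j y) +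
        Complex.I * fderiv ℝ (u a) y (Φ.Y j y)) y = pderiv i (fun y => ∑ b, A j a b y * u b y) y := by
      have : (fun y => fderiv ℝ (u a) y (Φ.X j y) + Complex.I * fderiv ℝ (u a) y (Φ.Y j y))
          =ᶠ[nhds y] fun y => ∑ b, A j a b y * u b y :=
        Filter.eventually_of_mem (Metric.isOpen_ball.mem_nhds hy) fun z hz => hu.2 j a z hz
      rw [pderiv, this.fderiv_eq, pderiv]
    have l1 : pderiv i (fun y => fderiv ℝ (u a) y (Φ.X j y) +
        Complex.I * fderiv ℝ (u a) y (Φ.Y j y)) y =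
        pderiv i (fun y => fderiv ℝ (u a) y (Φ.X j y)) y +
          Complex.I * pderiv i (fun y => fderiv ℝ (u a) y (Φ.Y j y)) y := by
      have d1 := (hd _ (Φ.smooth_X j)).differentiable (by simp) y
      have d2 := (hd _ (Φ.smooth_Y j)).differentiable (by simp) y
      rw [pderiv, fderiv_fun_add d1 (d2.const_mul _), fderiv_const_mul d2]
      rfl
    have r1 : pderiv i (fun y => ∑ b, A j a b y * u b y) y =
        ∑ b, (pderiv i (A j a b) y * u b y + A j a b y * pderiv i (u b) y) := by
      rw [pderiv, fderiv_fun_sum fun b _ =>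
        ((hA j a b).mul (hu.1 b)).differentiable (by simp) y, sum_apply]
      exact Finset.sum_congr rfl fun b _ => fderiv_mul_apply (hA j a b) (hu.1 b) _ _
    rw [l1, r1, pderiv_fderiv_apply i (hu.1 a) (Φ.smooth_X j),
      pderiv_fderiv_apply i (hu.1 a) (Φ.smooth_Y j)] at key
    simp only [EllipticFrame.prolong, prolongCoeff, Fintype.sum_prod_type, Fintype.sum_option,
      sub_mul, ite_mul, zero_mul, Finset.sum_sub_distrib, Finset.sum_ite_eq, Finset.mem_univ,
      if_true, add_mul, Finset.sum_add_distrib, mul_add, Finset.mul_sum, mul_assoc] at key ⊢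
    rw [Finset.sum_comm (s := (Finset.univ : Finset (Fin N))) (t := (Finset.univ : Finset ι))]
    simp only [Finset.sum_ite_eq, Finset.mem_univ, if_true]
    linear_combination key

/-- This is the interior estimate in a form that iterates: one prolongation costs one shrinking of
the ball and a constant independent of the solution. -/
lemma normSq_prolong_le {A : J → ι → ι → Euc N → ℂ} (hA : ∀ j a b, Continuous (A j a b))
    {r r' : ℝ} (hr : 0 < r) (hrr' : r < r') (hr' : r' ≤ Φ.radius) :
    ∃ C : ℝ, 0 ≤ C ∧ ∀ u, Φ.IsSolution A u →
      Φ.normSq (EllipticFrame.prolong u) r ≤ C * Φ.normSq u r' := by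
  obtain ⟨C, hC, H⟩ := interior_estimate (Φ := Φ) hA hr hrr' hr'
  refine ⟨1 + C, by positivity, fun u hu => ?_⟩
  have huc := fun a => (hu.1 a).continuous
  have hpu := fun a k => (contDiff_pderiv k (hu.1 a)).continuous
  have : Φ.normSq (EllipticFrame.prolong u) r = Φ.normSq u r +
      ∫ y in Metric.closedBall Φ.center r, ∑ a, ∑ k, ‖pderiv k (u a) y‖ ^ 2 := by
    rw [normSq, normSq, ← integral_add (Φ.integrableOn_closedBall (by fun_prop) r)
      (Φ.integrableOn_closedBall (by fun_prop) r)]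
    congr 1
    funext y
    rw [Fintype.sum_prod_type, Fintype.sum_option, Finset.sum_comm]
    rfl
  rw [this, add_mul, one_mul]
  exact add_le_add (Φ.normSq_mono huc hrr'.le) (H u hu)

end EllipticFrame

end EllipticSystems

/-! ### A Sobolev inequality, and the supremum estimate for solutions -/

section Sobolev

variable {N : ℕ}

set_option linter.unusedSectionVars false

/-- Iterated partial derivatives; the head of the list is applied first. -/
noncomputable def iterPderiv : List (Fin N) → (Euc N → ℂ) → Euc N → ℂ
  | [], f => f
  | i :: l, f => iterPderiv l (pderiv i f)

lemma contDiff_iterPderiv (l : List (Fin N)) {f : Euc N → ℂ} (hf : ContDiff ℝ ∞ f) :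
    ContDiff ℝ ∞ (iterPderiv l f) := by
  induction l generalizing f with
  | nil => exact hf
  | cons i l ih => exact ih (contDiff_pderiv i hf)

lemma hasCompactSupport_iterPderiv (l : List (Fin N)) {f : Euc N → ℂ} (hf : HasCompactSupport f) :
    HasCompactSupport (iterPderiv l f) := by
  induction l generalizing f with
  | nil => exact hf
  | cons i l ih => exact ih (hasCompactSupport_pderiv i hf)

lemma iterPderiv_add (l : List (Fin N)) {f g : Euc N → ℂ} (hf : ContDiff ℝ ∞ f)
    (hg : ContDiff ℝ ∞ g) (y : Euc N) :
    iterPderiv l (fun y => f y + g y) y = iterPderiv l f y + iterPderiv l g y := by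
  induction l generalizing f g with
  | nil => rfl
  | cons i l ih =>
    have : pderiv i (fun y => f y + g y) = fun y => pderiv i f y + pderiv i g y := by
      funext y
      rw [pderiv, fderiv_fun_add (hf.differentiable (by simp) y) (hg.differentiable (by simp) y)]
      rfl
    rw [iterPderiv, this]
    exact ih (contDiff_pderiv i hf) (contDiff_pderiv i hg)

/-- The fundamental theorem of calculus on the line through x in direction i, on which f still has
compact support. -/
lemma enorm_le_lintegral_pderiv (i : Fin N) {f : Euc N → ℂ} (hf : ContDiff ℝ ∞ f)
    (hc : HasCompactSupport f) (x : Fin N → ℝ) :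
    ‖f (WithLp.toLp 2 x)‖ₑ ≤ ∫⁻ t, ‖pderiv i f (WithLp.toLp 2 (Function.update x i t))‖ₑ := by
  have hγ : ∀ t, HasDerivAt (fun t => WithLp.toLp 2 (Function.update x i t))
      (EuclideanSpace.single i (1 : ℝ)) t := fun t =>
    (PiLp.continuousLinearEquiv 2 ℝ (fun _ : Fin N => ℝ)).symm.toContinuousLinearMap.hasFDerivAt
      |>.comp_hasDerivAt t (hasDerivAt_update x i t)
  have hd : ∀ t, deriv (fun t => f (WithLp.toLp 2 (Function.update x i t))) t =
      pderiv i f (WithLp.toLp 2 (Function.update x i t)) := fun t =>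
    ((hf.differentiable (by simp) _).hasFDerivAt.comp_hasDerivAt t (hγ t)).deriv
  have hsm : ContDiff ℝ 1 fun t => WithLp.toLp 2 (Function.update x i t) :=
    (PiLp.continuousLinearEquiv 2 ℝ (fun _ : Fin N => ℝ)).symm.contDiff.comp
      (contDiff_update 1 x i)
  have hcl : Topology.IsClosedEmbedding fun t => WithLp.toLp 2 (Function.update x i t) :=
    (PiLp.continuousLinearEquiv 2 ℝ (fun _ : Fin N => ℝ)).symm.toHomeomorph.isClosedEmbedding.comp
      (isClosedEmbedding_update x i)
  calc ‖f (WithLp.toLp 2 x)‖ₑ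
      = ‖f (WithLp.toLp 2 (Function.update x i (x i)))‖ₑ := by rw [Function.update_eq_self]
    _ ≤ ∫⁻ t in Set.Iic (x i), ‖deriv (fun t => f (WithLp.toLp 2 (Function.update x i t))) t‖ₑ :=
        HasCompactSupport.enorm_le_lintegral_Ici_deriv ((hf.of_le (by simp)).comp hsm)
          (hc.comp_isClosedEmbedding hcl) _
    _ ≤ ∫⁻ t, ‖pderiv i f (WithLp.toLp 2 (Function.update x i t))‖ₑ := by
        simp only [hd]
        exact setLIntegral_le_lintegral _ _

/-- One application of the one-variable bound for each coordinate in the list. The absence of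
repetitions makes each new integration run over a fresh variable. -/
lemma enorm_le_lmarginal_iterPderiv (l : List (Fin N)) (hl : l.Nodup) {f : Euc N → ℂ}
    (hf : ContDiff ℝ ∞ f) (hc : HasCompactSupport f) (x : Fin N → ℝ) :
    ‖f (WithLp.toLp 2 x)‖ₑ ≤
      (∫⋯∫⁻_l.toFinset, (fun x => ‖iterPderiv l f (WithLp.toLp 2 x)‖ₑ) ∂fun _ => volume) x := by
  induction l generalizing f x with
  | nil => simp [iterPderiv]
  | cons i l ih =>
    rw [List.nodup_cons] at hl
    have hm : Measurable fun x : Fin N → ℝ => ‖iterPderiv (i :: l) f (WithLp.toLp 2 x)‖ₑ :=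
      ((contDiff_iterPderiv _ hf).continuous.comp (PiLp.continuous_toLp 2 _)).enorm.measurable
    rw [List.toFinset_cons, lmarginal_insert _ hm (by simpa using hl.1)]
    refine (enorm_le_lintegral_pderiv i hf hc x).trans (lintegral_mono fun t => ?_)
    exact ih hl.2 (contDiff_pderiv i hf) (hasCompactSupport_pderiv i hc) _

/-- A smooth function with compact support is bounded by the integral of its mixed partial
derivative of order one in each variable. -/
lemma norm_le_integral_iterPderiv {f : Euc N → ℂ} (hf : ContDiff ℝ ∞ f)
    (hc : HasCompactSupport f) (y : Euc N) :
    ‖f y‖ ≤ ∫ z, ‖iterPderiv (List.finRange N) f z‖ := by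
  have h := enorm_le_lmarginal_iterPderiv (List.finRange N) (List.nodup_finRange N) hf hc
    (WithLp.ofLp y)
  have hu : (List.finRange N).toFinset = Finset.univ := by ext; simp
  rw [hu, lmarginal_univ, ← volume_pi] at h
  have hi := (contDiff_iterPderiv (List.finRange N) hf).continuous.integrable_of_hasCompactSupport
    (μ := volume) (hasCompactSupport_iterPderiv _ hc)
  rw [(PiLp.volume_preserving_toLp (Fin N)).lintegral_comp
    (f := fun z => ‖iterPderiv (List.finRange N) f z‖ₑ)
    (contDiff_iterPderiv (List.finRange N) hf).continuous.enorm.measurable,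
    ← ofReal_integral_norm_eq_lintegral_enorm hi, ← ofReal_norm] at h
  exact (ENNReal.ofReal_le_ofReal_iff (integral_nonneg fun _ => norm_nonneg _)).1 h

variable {J : Type*} [Fintype J]

namespace EllipticFrame

variable {Φ : EllipticFrame N J}

/-- Cauchy–Schwarz on the ball. It starts the induction over derivatives, where no derivative is
left to be taken. -/
lemma integral_norm_mul_le {ι : Type*} [Fintype ι] {χ : Euc N → ℂ} (hχ : Continuous χ) {r : ℝ}
    (hχs : tsupport χ ⊆ Metric.closedBall Φ.center r) {u : ι → Euc N → ℂ}
    (hu : ∀ a, Continuous (u a)) (a : ι) :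
    ∫ y, ‖χ y * u a y‖ ≤ √(∫ y in Metric.closedBall Φ.center r, ‖χ y‖ ^ 2) * √(Φ.normSq u r) := by
  have hua := hu a
  have h1 : ∫ y, ‖χ y * u a y‖ ≤ ∫ y in Metric.closedBall Φ.center r, ‖χ y‖ * ‖u a y‖ :=
    Φ.integral_le_setIntegral_closedBall (by fun_prop) (by fun_prop)
      (fun y hy => by simp [image_eq_zero_of_notMem_tsupport fun h => hy (hχs h)])
      fun y _ => (norm_mul _ _).le
  have hm : ∀ {f : Euc N → ℂ}, Continuous f → MemLp (fun y => ‖f y‖) (ENNReal.ofReal 2)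
      (volume.restrict (Metric.closedBall Φ.center r)) := fun {f} hf => by
    rw [show ENNReal.ofReal 2 = 2 by simp, memLp_two_iff_integrable_sq
      (by fun_prop : Continuous fun y => ‖f y‖).aestronglyMeasurable]
    exact Φ.integrableOn_closedBall (by fun_prop) r
  refine h1.trans ?_
  have h2 := integral_mul_le_Lp_mul_Lq_of_nonneg (μ := volume.restrict
    (Metric.closedBall Φ.center r)) Real.HolderConjugate.two_two
    (Filter.Eventually.of_forall fun y => norm_nonneg (χ y))
    (Filter.Eventually.of_forall fun y => norm_nonneg (u a y)) (hm hχ) (hm hua)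
  simp only [Real.rpow_two, ← Real.sqrt_eq_rpow] at h2
  refine h2.trans (mul_le_mul_of_nonneg_left (Real.sqrt_le_sqrt ?_) (Real.sqrt_nonneg _))
  refine integral_mono (Φ.integrableOn_closedBall (by fun_prop) r)
    (Φ.integrableOn_closedBall (by fun_prop) r) fun y => ?_
  exact Finset.single_le_sum (f := fun a => ‖u a y‖ ^ 2) (fun _ _ => by positivity)
    (Finset.mem_univ a)

/-- The iterated derivatives of a localized solution are bounded in `L¹` by the `L²` norm of the
solution. -/
lemma integral_iterPderiv_le (l : List (Fin N)) {ι : Type} [Fintype ι]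
    {A : J → ι → ι → Euc N → ℂ} (hA : ∀ j a b, ContDiff ℝ ∞ (A j a b)) {r r' : ℝ} (hr : 0 < r)
    (hrr' : r < r') (hr' : r' ≤ Φ.radius) {χ : Euc N → ℂ} (hχ : ContDiff ℝ ∞ χ)
    (hχs : tsupport χ ⊆ Metric.closedBall Φ.center r) :
    ∃ C : ℝ, 0 ≤ C ∧ ∀ u, Φ.IsSolution A u → ∀ a,
      ∫ y, ‖iterPderiv l (fun y => χ y * u a y) y‖ ≤ C * √(Φ.normSq u r') := by
  -- In ∂ᵢ(χu) = (∂ᵢχ)u + χ∂ᵢu the first term has a new cutoff, and the second is a component of the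
  -- prolongation, a solution of a larger system controlled on a smaller ball. Hence the cutoff, the
  -- index type and the radii must all vary in the induction.
  induction l generalizing ι χ r r' with
  | nil =>
    refine ⟨√(∫ y in Metric.closedBall Φ.center r, ‖χ y‖ ^ 2), Real.sqrt_nonneg _,
      fun u hu a => ?_⟩
    have huc := fun a => (hu.1 a).continuous
    exact (integral_norm_mul_le hχ.continuous hχs huc a).trans
      (mul_le_mul_of_nonneg_left (Real.sqrt_le_sqrt (Φ.normSq_mono huc hrr'.le))
        (Real.sqrt_nonneg _))
  | cons i l ih =>
    -- The outer half of the gap between the radii pays for the prolongation; the inner half is left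
    -- for the induction hypothesis.
    have hm : r < (r + r') / 2 := by linarith
    have hm' : (r + r') / 2 < r' := by linarith
    obtain ⟨C₁, hC₁, H₁⟩ := ih hA hr hrr' hr' (contDiff_pderiv i hχ)
      ((tsupport_pderiv_subset i χ).trans hχs)
    obtain ⟨C₂, hC₂, H₂⟩ := ih (contDiff_prolongCoeff (Φ := Φ) hA) hr hm (hm'.le.trans hr') hχ hχs
    obtain ⟨C₃, hC₃, H₃⟩ := normSq_prolong_le (Φ := Φ) (fun j a b => (hA j a b).continuous)
      (hr.trans hm) hm' hr'
    refine ⟨C₁ + C₂ * √C₃, by positivity, fun u hu a => ?_⟩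
    have hd : pderiv i (fun y => χ y * u a y) =
        fun y => pderiv i χ y * u a y + χ y * pderiv i (u a) y :=
      funext fun y => fderiv_mul_apply hχ (hu.1 a) y _
    have c1 : ContDiff ℝ ∞ fun y => pderiv i χ y * u a y := (contDiff_pderiv i hχ).mul (hu.1 a)
    have c2 : ContDiff ℝ ∞ fun y => χ y * pderiv i (u a) y := hχ.mul (contDiff_pderiv i (hu.1 a))
    have hχc : HasCompactSupport χ :=
      (isCompact_closedBall _ _).of_isClosed_subset (isClosed_tsupport _) hχs
    have s1 : HasCompactSupport fun y => pderiv i χ y * u a y :=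
      (hasCompactSupport_pderiv i hχc).mul_right
    have s2 : HasCompactSupport fun y => χ y * pderiv i (u a) y := hχc.mul_right
    have i1 := (contDiff_iterPderiv l c1).continuous.integrable_of_hasCompactSupport
      (μ := volume) (hasCompactSupport_iterPderiv l s1)
    have i2 := (contDiff_iterPderiv l c2).continuous.integrable_of_hasCompactSupport
      (μ := volume) (hasCompactSupport_iterPderiv l s2)
    have i3 := (contDiff_iterPderiv l (c1.add c2)).continuous.integrable_of_hasCompactSupport
      (μ := volume) (hasCompactSupport_iterPderiv l (s1.add s2))
    calc ∫ y, ‖iterPderiv (i :: l) (fun y => χ y * u a y) y‖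
        = ∫ y, ‖iterPderiv l (fun y => pderiv i χ y * u a y + χ y * pderiv i (u a) y) y‖ := by
          rw [iterPderiv, hd]
      _ ≤ ∫ y, (‖iterPderiv l (fun y => pderiv i χ y * u a y) y‖ +
            ‖iterPderiv l (fun y => χ y * pderiv i (u a) y) y‖) :=
          integral_mono i3.norm (i1.norm.add i2.norm) fun y => by
            simp only [iterPderiv_add l c1 c2]
            exact norm_add_le _ _
      _ ≤ C₁ * √(Φ.normSq u r') + C₂ * √(Φ.normSq (EllipticFrame.prolong u) ((r + r') / 2)) := by
          rw [integral_add i1.norm i2.norm]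
          exact add_le_add (H₁ u hu a) (H₂ _ (hu.prolong hA) (some i, a))
      _ ≤ C₁ * √(Φ.normSq u r') + C₂ * (√C₃ * √(Φ.normSq u r')) := by
          rw [← Real.sqrt_mul hC₃]
          gcongr
          exact H₃ u hu
      _ = _ := by ring

/-- Solutions are bounded on smaller balls by their `L²` norm. -/
lemma exists_norm_le {ι : Type} [Fintype ι] {A : J → ι → ι → Euc N → ℂ}
    (hA : ∀ j a b, ContDiff ℝ ∞ (A j a b)) {r r' : ℝ} (hr : 0 < r) (hrr' : r < r')
    (hr' : r' ≤ Φ.radius) :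
    ∃ C : ℝ, 0 ≤ C ∧ ∀ u, Φ.IsSolution A u → ∀ a, ∀ y ∈ Metric.closedBall Φ.center r,
      ‖u a y‖ ≤ C * √(Φ.normSq u r') := by
  obtain ⟨χ, hχ, hχs, -, -, hχe⟩ := exists_cutoff Φ.center hr (show r < (r + r') / 2 by linarith)
  obtain ⟨C, hC, H⟩ := integral_iterPderiv_le (List.finRange N) hA
    (show 0 < (r + r') / 2 by linarith) (by linarith) hr' hχ hχs
  refine ⟨C, hC, fun u hu a y hy => le_trans ?_ (H u hu a)⟩
  have := norm_le_integral_iterPderiv (hχ.mul (hu.1 a)) (HasCompactSupport.mul_right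
    ((isCompact_closedBall _ _).of_isClosed_subset (isClosed_tsupport _) hχs)) y
  simpa [(hχe y hy).eq_of_nhds] using this

/-! ### Limits of solutions -/

variable {ι : Type} [Fintype ι] {A : J → ι → ι → Euc N → ℂ}

lemma IsSolution.sub {u v : ι → Euc N → ℂ} (hu : Φ.IsSolution A u) (hv : Φ.IsSolution A v) :
    Φ.IsSolution A (u - v) := by
  refine ⟨fun a => (hu.1 a).sub (hv.1 a), fun j a y hy => ?_⟩
  have h1 := hu.2 j a y hy
  have h2 := hv.2 j a y hy
  rw [Pi.sub_apply, fderiv_sub ((hu.1 a).differentiable (by simp) y)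
    ((hv.1 a).differentiable (by simp) y)]
  simp only [sub_apply, Pi.sub_apply, mul_sub, Finset.sum_sub_distrib]
  linear_combination h1 - h2

lemma prolong_sub {u v : ι → Euc N → ℂ} (hu : ∀ a, ContDiff ℝ ∞ (u a))
    (hv : ∀ a, ContDiff ℝ ∞ (v a)) :
    EllipticFrame.prolong (u - v) = EllipticFrame.prolong u - EllipticFrame.prolong v := by
  funext ⟨i, a⟩ y
  cases i with
  | none => rfl
  | some i =>
    simp only [EllipticFrame.prolong, Pi.sub_apply, pderiv]
    rw [fderiv_sub ((hu a).differentiable (by simp) y) ((hv a).differentiable (by simp) y)]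
    rfl

lemma norm_fderiv_le (f : Euc N → ℂ) (y : Euc N) : ‖fderiv ℝ f y‖ ≤ ∑ i, ‖pderiv i f y‖ := by
  refine ContinuousLinearMap.opNorm_le_bound _ (by positivity) fun v => ?_
  rw [fderiv_apply_eq_sum, Finset.sum_mul]
  refine (norm_sum_le _ _).trans (Finset.sum_le_sum fun i _ => ?_)
  rw [norm_smul, mul_comm]
  exact mul_le_mul_of_nonneg_left (PiLp.norm_apply_le v i) (norm_nonneg _)

variable (Φ) in
/-- The sequence `u` is Cauchy in `L²` of the ball of radius `r`. -/
def IsCauchyL2 (u : ℕ → ι → Euc N → ℂ) (r : ℝ) : Prop :=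
  ∀ ε > 0, ∃ K, ∀ k ≥ K, ∀ l ≥ K, Φ.normSq (u k - u l) r < ε

/-- By linearity the differences of members of the sequence are solutions, so the estimate for one
solution applies to them. -/
lemma IsCauchyL2.prolong (hA : ∀ j a b, ContDiff ℝ ∞ (A j a b)) {r r' : ℝ} (hr : 0 < r)
    (hrr' : r < r') (hr' : r' ≤ Φ.radius) {u : ℕ → ι → Euc N → ℂ}
    (hu : ∀ k, Φ.IsSolution A (u k)) (hc : Φ.IsCauchyL2 u r') :
    Φ.IsCauchyL2 (fun k => EllipticFrame.prolong (u k)) r := by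
  obtain ⟨C, hC, H⟩ := normSq_prolong_le (Φ := Φ) (fun j a b => (hA j a b).continuous) hr hrr' hr'
  intro ε hε
  obtain ⟨K, hK⟩ := hc (ε / (C + 1)) (by positivity)
  refine ⟨K, fun k hk l hl => ?_⟩
  rw [← prolong_sub (hu k).1 (hu l).1]
  refine (H _ ((hu k).sub (hu l))).trans_lt ?_
  have h1 := hK k hk l hl
  rw [lt_div_iff₀ (by positivity)] at h1
  nlinarith [Φ.normSq_nonneg (u k - u l) r']

/-- The supremum bound `exists_norm_le` applied to differences of solutions upgrades L² convergence
to uniform convergence on a smaller ball. -/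
lemma IsCauchyL2.uniformCauchySeqOn (hA : ∀ j a b, ContDiff ℝ ∞ (A j a b)) {r r' : ℝ} (hr : 0 < r)
    (hrr' : r < r') (hr' : r' ≤ Φ.radius) {u : ℕ → ι → Euc N → ℂ}
    (hu : ∀ k, Φ.IsSolution A (u k)) (hc : Φ.IsCauchyL2 u r') (a : ι) :
    UniformCauchySeqOn (fun k => u k a) Filter.atTop (Metric.closedBall Φ.center r) := by
  obtain ⟨C, hC, H⟩ := exists_norm_le (Φ := Φ) hA hr hrr' hr'
  rw [Metric.uniformCauchySeqOn_iff]
  intro ε hε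
  obtain ⟨K, hK⟩ := hc ((ε / (C + 1)) ^ 2) (by positivity)
  refine ⟨K, fun k hk l hl y hy => ?_⟩
  rw [dist_eq_norm]
  refine (H _ ((hu k).sub (hu l)) a y hy).trans_lt ?_
  have h1 : √(Φ.normSq (u k - u l) r') < ε / (C + 1) :=
    (Real.sqrt_lt' (by positivity)).2 (hK k hk l hl)
  rw [lt_div_iff₀ (by positivity)] at h1
  nlinarith [Real.sqrt_nonneg (Φ.normSq (u k - u l) r')]

/-- The partial derivatives are components of the prolonged sequence, which is again an L² Cauchy
sequence of solutions. The intermediate radius separates the two losses of domain. -/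
lemma IsCauchyL2.uniformCauchySeqOn_fderiv (hA : ∀ j a b, ContDiff ℝ ∞ (A j a b)) {r r' : ℝ}
    (hr : 0 < r) (hrr' : r < r') (hr' : r' ≤ Φ.radius) {u : ℕ → ι → Euc N → ℂ}
    (hu : ∀ k, Φ.IsSolution A (u k)) (hc : Φ.IsCauchyL2 u r') (a : ι) :
    UniformCauchySeqOn (fun k => fderiv ℝ (u k a)) Filter.atTop
      (Metric.closedBall Φ.center r) := by
  have hm : r < (r + r') / 2 := by linarith
  have hm' : (r + r') / 2 < r' := by linarith
  have h := fun i => (hc.prolong hA (hr.trans hm) hm' hr' hu).uniformCauchySeqOn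
    (contDiff_prolongCoeff hA) hr hm (hm'.le.trans hr') (fun k => (hu k).prolong hA) (some i, a)
  simp only [Metric.uniformCauchySeqOn_iff] at h ⊢
  intro ε hε
  -- Dividing by N + 1 instead of N keeps the sum of N bounds strictly below ε, also when N = 0.
  choose K hK using fun i => h i (ε / (N + 1)) (by positivity)
  refine ⟨Finset.univ.sup K, fun k hk l hl y hy => ?_⟩
  rw [dist_eq_norm, ← fderiv_sub (((hu k).1 a).differentiable (by simp) y)
    (((hu l).1 a).differentiable (by simp) y)]
  have hb : ∀ i, ‖pderiv i (u k a - u l a) y‖ ≤ ε / (N + 1) := fun i => by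
    have h1 := hK i k ((Finset.le_sup (Finset.mem_univ i)).trans hk) l
      ((Finset.le_sup (Finset.mem_univ i)).trans hl) y hy
    rw [dist_eq_norm] at h1
    refine le_trans (le_of_eq ?_) h1.le
    rw [pderiv, fderiv_sub (((hu k).1 a).differentiable (by simp) y)
      (((hu l).1 a).differentiable (by simp) y)]
    rfl
  refine (norm_fderiv_le _ y).trans_lt ((Finset.sum_le_sum fun i _ => hb i).trans_lt ?_)
  simp only [Finset.sum_const, Finset.card_univ, Fintype.card_fin, nsmul_eq_mul]
  rw [mul_div_assoc', div_lt_iff₀ (by positivity)]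
  nlinarith

/-- A pointwise limit of an `L²` Cauchy sequence of solutions is differentiable, and the
derivatives converge. -/
lemma IsCauchyL2.hasFDerivAt_limit (hA : ∀ j a b, ContDiff ℝ ∞ (A j a b)) {r r' : ℝ}
    (hr : 0 < r) (hrr' : r < r') (hr' : r' ≤ Φ.radius) {u : ℕ → ι → Euc N → ℂ}
    (hu : ∀ k, Φ.IsSolution A (u k)) (hc : Φ.IsCauchyL2 u r') {w : ι → Euc N → ℂ}
    (hw : ∀ a, ∀ y ∈ Metric.ball Φ.center r,
      Filter.Tendsto (fun k => u k a y) Filter.atTop (nhds (w a y))) (a : ι) :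
    ∀ y ∈ Metric.ball Φ.center r, DifferentiableAt ℝ (w a) y ∧
      Filter.Tendsto (fun k => fderiv ℝ (u k a) y) Filter.atTop (nhds (fderiv ℝ (w a) y)) := by
  have hC := (hc.uniformCauchySeqOn_fderiv hA hr hrr' hr' hu a).mono Metric.ball_subset_closedBall
  choose! G hG using fun y (hy : y ∈ Metric.ball Φ.center r) =>
    cauchySeq_tendsto_of_complete (hC.cauchySeq hy)
  have hU := hC.tendstoUniformlyOn_of_tendsto hG
  intro y hy
  have hd := hasFDerivAt_of_tendstoUniformlyOn Metric.isOpen_ball hU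
    (fun k y _ => (((hu k).1 a).differentiable (by simp) y).hasFDerivAt) (hw a) hy
  exact ⟨hd.differentiableAt, hd.fderiv ▸ hG y hy⟩

/-- A pointwise limit of an `L²` Cauchy sequence of solutions is smooth. -/
lemma IsCauchyL2.contDiffOn_limit (m : ℕ) {ι : Type} [Fintype ι] {A : J → ι → ι → Euc N → ℂ}
    (hA : ∀ j a b, ContDiff ℝ ∞ (A j a b)) {r r' : ℝ}
    (hr : 0 < r) (hrr' : r < r') (hr' : r' ≤ Φ.radius) {u : ℕ → ι → Euc N → ℂ}
    (hu : ∀ k, Φ.IsSolution A (u k)) (hc : Φ.IsCauchyL2 u r') {w : ι → Euc N → ℂ}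
    (hw : ∀ a, ∀ y ∈ Metric.ball Φ.center r,
      Filter.Tendsto (fun k => u k a y) Filter.atTop (nhds (w a y))) (a : ι) :
    ContDiffOn ℝ m (w a) (Metric.ball Φ.center r) := by
  -- The partial derivatives of the limit are the pointwise limits of the partial derivatives, so
  -- the prolonged limit is the limit of the prolonged sequence. The induction hypothesis is used
  -- for that larger system on a smaller outer ball; the ball on which smoothness is claimed stays
  -- the same.
  induction m generalizing ι r r' with
  | zero =>
    exact contDiffOn_zero.2 fun y hy =>
      (hc.hasFDerivAt_limit hA hr hrr' hr' hu hw a y hy).1.continuousAt.continuousWithinAt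
  | succ m ih =>
    have hd := hc.hasFDerivAt_limit hA hr hrr' hr' hu hw
    have hm : r < (r + r') / 2 := by linarith
    have hm' : (r + r') / 2 < r' := by linarith
    rw [Nat.cast_add, Nat.cast_one, contDiffOn_succ_iff_fderiv_of_isOpen Metric.isOpen_ball]
    refine ⟨fun y hy => (hd a y hy).1.differentiableWithinAt, by simp, ?_⟩
    have hi := fun i => ih (contDiff_prolongCoeff hA) hr hm (hm'.le.trans hr')
      (fun k => (hu k).prolong hA) (hc.prolong hA (hr.trans hm) hm' hr' hu)
      (w := EllipticFrame.prolong w) (by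
        rintro ⟨_ | i, b⟩ y hy
        · exact hw b y hy
        · exact ((ContinuousLinearMap.apply ℝ ℂ
            (EuclideanSpace.single i (1 : ℝ))).continuous.tendsto _).comp (hd b y hy).2) (some i, a)
    rw [contDiffOn_clm_apply]
    intro v
    simp only [fderiv_apply_eq_sum]
    exact ContDiffOn.sum fun i _ => contDiffOn_const.smul (hi i)

end EllipticFrame

end Sobolev

/-! ### The top exterior power of a nondegenerate 2-form does not vanish -/

section TopPower

variable {V : Type*} [AddCommGroup V] [Module ℝ V]

/-- The pairs `(e i, f i)`, `i < k`, are a symplectic family. -/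
structure IsSymplecticFamily (β : LinearMap.BilinForm ℝ V) (k : ℕ) (e f : ℕ → V) : Prop where
  ee : ∀ i < k, ∀ j < k, β (e i) (e j) = 0
  ff : ∀ i < k, ∀ j < k, β (f i) (f j) = 0
  ef : ∀ i < k, ∀ j < k, β (e i) (f j) = if i = j then 1 else 0

/-- Symplectic Gram–Schmidt: the projection to the span is Σ β(v, fᵢ)eᵢ − β(v, eᵢ)fᵢ. The signs come
from β(fᵢ, eᵢ) = −1. -/
lemma IsSymplecticFamily.exists_proj {β : LinearMap.BilinForm ℝ V} (hβ : β.IsAlt) {k : ℕ}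
    {e f : ℕ → V} (h : IsSymplecticFamily β k e f) (v : V) :
    ∃ w ∈ Submodule.span ℝ (Set.range (Sum.elim (fun i : Fin k => e i) fun i : Fin k => f i)),
      ∀ j < k, β (v - w) (e j) = 0 ∧ β (v - w) (f j) = 0 := by
  refine ⟨∑ i : Fin k, (β v (f i) • e i - β v (e i) • f i),
    Submodule.sum_mem _ fun i _ => Submodule.sub_mem _
      (Submodule.smul_mem _ _ (Submodule.subset_span ⟨Sum.inl i, rfl⟩))
      (Submodule.smul_mem _ _ (Submodule.subset_span ⟨Sum.inr i, rfl⟩)), fun j hj => ?_⟩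
  have hfe : ∀ i < k, β (f i) (e j) = -if j = i then 1 else 0 := fun i hi => by
    rw [← h.ef j hj i hi, hβ.neg_eq]
  have key : ∀ c : Fin k → ℝ, ∑ i : Fin k, c i * (if (i : ℕ) = j then 1 else 0) = c ⟨j, hj⟩ := by
    intro c
    rw [Finset.sum_eq_single ⟨j, hj⟩]
    · simp
    · intro b _ hb
      have : (b : ℕ) ≠ j := fun hh => hb (Fin.ext hh)
      simp [this]
    · simp
  constructor
  · simp only [map_sub, map_sum, map_smul, LinearMap.sub_apply, LinearMap.sum_apply,
      LinearMap.smul_apply, smul_eq_mul]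
    have : ∀ i : Fin k, β v (f i) * β (e i) (e j) - β v (e i) * β (f i) (e j) =
        β v (e i) * (if (i : ℕ) = j then 1 else 0) := fun i => by
      rw [h.ee i i.2 j hj, hfe i i.2]
      simp [eq_comm]
    simp only [this, key, sub_self]
  · simp only [map_sub, map_sum, map_smul, LinearMap.sub_apply, LinearMap.sum_apply,
      LinearMap.smul_apply, smul_eq_mul]
    have : ∀ i : Fin k, β v (f i) * β (e i) (f j) - β v (e i) * β (f i) (f j) =
        β v (f i) * (if (i : ℕ) = j then 1 else 0) := fun i => by
      rw [h.ff i i.2 j hj, h.ef i i.2 j hj]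
      simp
    simp only [this, key, sub_self]

/-- As long as k < n, the 2k vectors found so far do not span. A vector outside their span, made
orthogonal to it, is nonzero and so pairs nontrivially with some vector; this partner is rescaled
and then made orthogonal to the span too. -/
lemma exists_isSymplecticFamily [FiniteDimensional ℝ V] {β : LinearMap.BilinForm ℝ V}
    (hβ : β.IsAlt) (hnd : ∀ v, (∀ w, β v w = 0) → v = 0) {n : ℕ}
    (hn : Module.finrank ℝ V = 2 * n) :
    ∀ k ≤ n, ∃ e f : ℕ → V, IsSymplecticFamily β k e f := by
  intro k
  induction k with
  | zero => exact fun _ => ⟨0, 0, by simp, by simp, by simp⟩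
  | succ k ih =>
    intro hk
    obtain ⟨e, f, h⟩ := ih (by omega)
    set S := Submodule.span ℝ
      (Set.range (Sum.elim (fun i : Fin k => e i) fun i : Fin k => f i)) with hS
    have hSt : S ≠ ⊤ := by
      intro ht
      have h1 := finrank_range_le_card (R := ℝ)
        (Sum.elim (fun i : Fin k => e i) fun i : Fin k => f i)
      rw [Set.finrank, ← hS, ht, finrank_top, hn] at h1
      simp at h1
      omega
    obtain ⟨v, hv⟩ : ∃ v, v ∉ S := by
      by_contra! hc
      exact hSt (Submodule.eq_top_iff'.2 hc)
    obtain ⟨w, hw, hwo⟩ := h.exists_proj hβ v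
    have hx : v - w ≠ 0 := fun h0 => hv (by rwa [sub_eq_zero.1 h0])
    obtain ⟨y₀, hy₀⟩ : ∃ y, β (v - w) y ≠ 0 := by
      by_contra! hc
      exact hx (hnd _ hc)
    obtain ⟨z, hz, hzo⟩ := h.exists_proj hβ ((β (v - w) y₀)⁻¹ • y₀)
    set x := v - w
    set y := (β x y₀)⁻¹ • y₀ - z
    -- Since x is orthogonal to the whole span, projecting the partner does not disturb its
    -- normalized pairing with x.
    have hxz : β x z = 0 := by
      have : S ≤ LinearMap.ker (β x) := by
        rw [hS, Submodule.span_le]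
        rintro _ ⟨i | i, rfl⟩
        · exact (hwo i i.2).1
        · exact (hwo i i.2).2
      exact this hz
    have hxy : β x y = 1 := by
      simp only [y, map_sub, map_smul, hxz, sub_zero, smul_eq_mul]
      exact inv_mul_cancel₀ hy₀
    have sym : ∀ {a b : V}, β a b = 0 → β b a = 0 := fun hab => by rw [← hβ.neg_eq, hab, neg_zero]
    have upd : ∀ (g : ℕ → V) (a : V) (i : ℕ), i < k → Function.update g k a i = g i :=
      fun g a i hi => Function.update_of_ne hi.ne _ _
    refine ⟨Function.update e k x, Function.update f k y, ⟨?_, ?_, ?_⟩⟩ <;> intro i hi j hj <;>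
      rcases Nat.lt_succ_iff_lt_or_eq.1 hi with hi | rfl <;>
      rcases Nat.lt_succ_iff_lt_or_eq.1 hj with hj | rfl
    · rw [upd _ _ _ hi, upd _ _ _ hj, h.ee i hi j hj]
    · rw [upd _ _ _ hi, Function.update_self]
      exact sym (hwo i hi).1
    · rw [upd _ _ _ hj, Function.update_self, (hwo j hj).1]
    · simp only [Function.update_self]
      exact hβ x
    · rw [upd _ _ _ hi, upd _ _ _ hj, h.ff i hi j hj]
    · rw [upd _ _ _ hi, Function.update_self]
      exact sym (hzo i hi).2
    · rw [upd _ _ _ hj, Function.update_self, (hzo j hj).2]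
    · simp only [Function.update_self]
      exact hβ y
    · rw [upd _ _ _ hi, upd _ _ _ hj, h.ef i hi j hj]
    · rw [upd _ _ _ hi, Function.update_self, if_neg hi.ne]
      exact sym (hzo i hi).1
    · rw [upd _ _ _ hj, Function.update_self, (hwo j hj).2, if_neg hj.ne']
    · simp only [Function.update_self, hxy, if_true]

/-- The multilinear map `b ↦ ∏ᵢ β (b (i, 0)) (b (i, 1))`. -/
def pairingProd (β : LinearMap.BilinForm ℝ V) (n : ℕ) :
    MultilinearMap ℝ (fun _ : Fin n × Fin 2 => V) ℝ where
  toFun b := ∏ i, β (b (i, 0)) (b (i, 1))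
  map_update_add' := by
    intro _ b ⟨i, a⟩ x y
    have key : ∀ z : V, ∏ j, β (Function.update b (i, a) z (j, 0))
        (Function.update b (i, a) z (j, 1)) = β (Function.update b (i, a) z (i, 0))
        (Function.update b (i, a) z (i, 1)) *
          ∏ j ∈ Finset.univ.erase i, β (b (j, 0)) (b (j, 1)) := by
      intro z
      rw [← Finset.mul_prod_erase _ _ (Finset.mem_univ i)]
      congr 1
      refine Finset.prod_congr rfl fun j hj => ?_
      have hji := Finset.ne_of_mem_erase hj
      rw [Function.update_of_ne (by simp [hji]), Function.update_of_ne (by simp [hji])]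
    simp only [key]
    fin_cases a <;> simp [add_mul]
  map_update_smul' := by
    intro _ b ⟨i, a⟩ c x
    have key : ∀ z : V, ∏ j, β (Function.update b (i, a) z (j, 0))
        (Function.update b (i, a) z (j, 1)) = β (Function.update b (i, a) z (i, 0))
        (Function.update b (i, a) z (i, 1)) *
          ∏ j ∈ Finset.univ.erase i, β (b (j, 0)) (b (j, 1)) := by
      intro z
      rw [← Finset.mul_prod_erase _ _ (Finset.mem_univ i)]
      congr 1
      refine Finset.prod_congr rfl fun j hj => ?_
      have hji := Finset.ne_of_mem_erase hj
      rw [Function.update_of_ne (by simp [hji]), Function.update_of_ne (by simp [hji])]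
    simp only [key]
    fin_cases a <;> simp [mul_assoc]

/-- The matrix of the standard symplectic form. -/
def stdSymp {n : ℕ} (a b : Fin n × Fin 2) : ℝ :=
  if a.1 = b.1 then (b.2 : ℕ) - (a.2 : ℕ) else 0

/-- The contribution of each permutation to the Pfaffian of the standard symplectic form is
nonnegative. -/
lemma sign_mul_prod_stdSymp_nonneg {n : ℕ} (σ : Equiv.Perm (Fin n × Fin 2)) :
    0 ≤ ((Equiv.Perm.sign σ : ℤ) : ℝ) * ∏ i, stdSymp (σ (i, 0)) (σ (i, 1)) := by
  by_cases h0 : ∏ i, stdSymp (σ (i, 0)) (σ (i, 1)) = 0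
  · simp [h0]
  have hne : ∀ i, stdSymp (σ (i, 0)) (σ (i, 1)) ≠ 0 := fun i hi =>
    h0 (Finset.prod_eq_zero (Finset.mem_univ i) hi)
  have h1 : ∀ i, (σ (i, 0)).1 = (σ (i, 1)).1 := fun i => by
    by_contra hc
    exact hne i (by simp [stdSymp, hc])
  have h2 : ∀ i, (σ (i, 0)).2 ≠ (σ (i, 1)).2 := fun i hc => hne i (by simp [stdSymp, hc])
  -- A nonzero product forces σ to send each pair {(i, 0), (i, 1)} onto a whole pair, so no second
  -- pair can land there.
  have hinj : Function.Injective fun i => (σ (i, 0)).1 := by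
    intro i j hij
    have hij : (σ (i, 0)).1 = (σ (j, 0)).1 := hij
    have hcase : (σ (j, 0)).2 = (σ (i, 0)).2 ∨ (σ (j, 0)).2 = (σ (i, 1)).2 := by
      have := h2 i
      omega
    rcases hcase with hc | hc
    · have := σ.injective (Prod.ext hij.symm hc)
      exact (congrArg Prod.fst this).symm
    · have := σ.injective (Prod.ext (hij.symm.trans (h1 i)) hc)
      exact absurd (congrArg Prod.snd this) (by simp)
  let ρ : Equiv.Perm (Fin n) := Equiv.ofBijective _ (Finite.injective_iff_bijective.1 hinj)
  let ε : Fin n → Equiv.Perm (Fin 2) := fun i =>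
    if (σ (i, 0)).2 = 0 then 1 else Equiv.swap 0 1
  -- Thus σ flips some pairs by ε and then permutes the pairs by ρ. The permutation ρ acts on two
  -- copies and contributes sign(ρ)² = 1; each flip contributes the same sign to sign(σ) and to the
  -- product, so the total is a square.
  have hσ : σ = (Equiv.prodCongrLeft fun _ => ρ) * Equiv.prodCongrRight ε := by
    ext1 ⟨i, b⟩
    have hρ : ρ i = (σ (i, 0)).1 := rfl
    have hb : σ (i, b) = (ρ i, ε i b) := by
      have h2i := h2 i
      by_cases hs : (σ (i, 0)).2 = 0
      · have hs1 : (σ (i, 1)).2 = 1 := by omega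
        fin_cases b
        · exact Prod.ext rfl (by simp [ε, hs])
        · exact Prod.ext (h1 i).symm (by simp [ε, hs, hs1])
      · have hs0 : (σ (i, 0)).2 = 1 := by omega
        have hs1 : (σ (i, 1)).2 = 0 := by omega
        fin_cases b
        · exact Prod.ext rfl (by simp [ε, hs0])
        · exact Prod.ext (h1 i).symm (by simp [ε, hs0, hs1])
    rw [hb]
    rfl
  have hsign : Equiv.Perm.sign σ = ∏ i, Equiv.Perm.sign (ε i) := by
    rw [hσ, Equiv.Perm.sign_mul, Equiv.Perm.sign_prodCongrLeft, Equiv.Perm.sign_prodCongrRight]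
    simp
  have hval : ∀ i, stdSymp (σ (i, 0)) (σ (i, 1)) = ((Equiv.Perm.sign (ε i) : ℤ) : ℝ) := by
    intro i
    have h2i := h2 i
    by_cases hs : (σ (i, 0)).2 = 0
    · have hs1 : (σ (i, 1)).2 = 1 := by omega
      simp [stdSymp, h1 i, ε, hs, hs1]
    · have hs0 : (σ (i, 0)).2 = 1 := by omega
      have hs1 : (σ (i, 1)).2 = 0 := by omega
      simp [stdSymp, h1 i, ε, hs0, hs1]
  rw [hsign]
  simp only [hval]
  push_cast
  exact mul_self_nonneg _

/-- Up to a nonzero factor, `wedgePow` is the alternatization of `pairingProd`. On a symplectic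
family its terms are nonnegative and the identity contributes 1, so the alternating form is nonzero;
being of top degree, it is then nonzero on every basis. -/
lemma wedgePow_ne_zero [FiniteDimensional ℝ V] {β : LinearMap.BilinForm ℝ V}
    (hβ : β.IsAlt) (hnd : ∀ v, (∀ w, β v w = 0) → v = 0) {n : ℕ}
    (hn : Module.finrank ℝ V = 2 * n) (b : Module.Basis (Fin (2 * n)) ℝ V) :
    wedgePow n (fun v w => β v w) b ≠ 0 := by
  -- The ordering (i, a) ↦ 2i + a is the one in which `wedgePow` forms its pairs.
  let E : Fin n × Fin 2 ≃ Fin (2 * n) := finProdFinEquiv.trans (finCongr (mul_comm n 2))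
  have hE0 : ∀ i : Fin n, E (i, 0) = ⟨2 * i, by omega⟩ := fun i => Fin.ext (by simp [E])
  have hE1 : ∀ i : Fin n, E (i, 1) = ⟨2 * i + 1, by omega⟩ := fun i =>
    Fin.ext (by simp [E, add_comm])
  have halt : ∀ c : Fin n × Fin 2 → V, (pairingProd β n).alternatization c =
      ∑ σ : Equiv.Perm (Fin n × Fin 2), ((Equiv.Perm.sign σ : ℤ) : ℝ) *
        ∏ i, β (c (σ (i, 0))) (c (σ (i, 1))) := by
    intro c
    rw [MultilinearMap.alternatization_apply]
    refine Finset.sum_congr rfl fun σ _ => ?_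
    rw [Units.smul_def, zsmul_eq_mul]
    rfl
  have hne : (pairingProd β n).alternatization ≠ 0 := by
    obtain ⟨e, f, h⟩ := exists_isSymplecticFamily hβ hnd hn n le_rfl
    intro h0
    have h1 := halt fun p => if p.2 = 0 then e p.1 else f p.1
    rw [h0] at h1
    have hJ : ∀ p q : Fin n × Fin 2, β (if p.2 = 0 then e p.1 else f p.1)
        (if q.2 = 0 then e q.1 else f q.1) = stdSymp p q := by
      rintro ⟨i, a⟩ ⟨j, b⟩
      have hfe : β (f i) (e j) = if (j : ℕ) = i then -1 else 0 := by
        rw [← hβ.neg_eq, h.ef j j.2 i i.2]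
        split_ifs <;> simp
      fin_cases a <;> fin_cases b <;>
        simp [stdSymp, h.ee i i.2 j j.2, h.ff i i.2 j j.2, h.ef i i.2 j j.2, hfe, Fin.ext_iff,
          eq_comm]
    simp only [hJ] at h1
    have h2 : (0 : ℝ) < ∑ σ : Equiv.Perm (Fin n × Fin 2), ((Equiv.Perm.sign σ : ℤ) : ℝ) *
        ∏ i, stdSymp (σ (i, 0)) (σ (i, 1)) := by
      refine Finset.sum_pos' (fun σ _ => sign_mul_prod_stdSymp_nonneg σ)
        ⟨1, Finset.mem_univ _, ?_⟩
      simp [stdSymp]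
    rw [← h1] at h2
    simp at h2
  have hb := ((pairingProd β n).alternatization).map_basis_ne_zero_iff (b.reindex E.symm) |>.2 hne
  rw [halt] at hb
  intro hw
  rw [wedgePow, mul_eq_zero] at hw
  refine hb ?_
  rcases hw with hw | hw
  · exact absurd hw (by positivity)
  · rw [← hw]
    refine Fintype.sum_equiv E.permCongr _ _ fun σ => ?_
    simp [Equiv.Perm.sign_permCongr, ← hE0, ← hE1, Equiv.permCongr_apply]

end TopPower

/-! ### Line bundle coordinates -/

section LineBundleCoordinates

set_option linter.unusedSectionVars false

variable {n : ℕ} {M : Type*} [TopologicalSpace M] [ChartedSpace (Model n) M]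
  [IsManifold 𝓘(ℝ, Model n) ∞ M]
  {L : M → Type*} [TopologicalSpace (TotalSpace ℂ L)] [∀ x, AddCommGroup (L x)]
  [∀ x, Module ℂ (L x)] [∀ x, TopologicalSpace (L x)] [∀ x, IsTopologicalAddGroup (L x)]
  [∀ x, ContinuousSMul ℝ (L x)] [FiberBundle ℂ L] [VectorBundle ℂ ℂ L] [VectorBundle ℝ ℂ L]
  [ContMDiffVectorBundle ∞ ℂ L 𝓘(ℝ, Model n)]

variable (L) in
/-- The domain of the preferred trivialization of `L` at `x₀`. -/
abbrev bundleDomain (x₀ : M) : Set M := (trivializationAt ℂ L x₀).baseSet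

/-- The coordinate of a vector of `L` in the preferred trivialization at `x₀`. -/
noncomputable def coord (x₀ x : M) : L x →ₗ[ℂ] ℂ := (trivializationAt ℂ L x₀).linearMapAt ℂ x

lemma coord_apply {x₀ x : M} (hx : x ∈ bundleDomain L x₀) (u : L x) :
    coord x₀ x u = (trivializationAt ℂ L x₀ ⟨x, u⟩).2 :=
  congrFun ((trivializationAt ℂ L x₀).coe_linearMapAt_of_mem hx) u

lemma coord_injective {x₀ x : M} (hx : x ∈ bundleDomain L x₀) :
    Function.Injective (coord (L := L) x₀ x) := by
  have h : ⇑(coord (L := L) x₀ x) = ((trivializationAt ℂ L x₀).linearEquivAt ℂ x hx) :=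
    funext fun u => coord_apply hx u
  rw [h]
  exact LinearEquiv.injective _

lemma coord_surjective {x₀ x : M} (hx : x ∈ bundleDomain L x₀) :
    Function.Surjective (coord (L := L) x₀ x) := by
  have h : ⇑(coord (L := L) x₀ x) = ((trivializationAt ℂ L x₀).linearEquivAt ℂ x hx) :=
    funext fun u => coord_apply hx u
  rw [h]
  exact LinearEquiv.surjective _

lemma continuous_coord {x₀ x : M} (hx : x ∈ bundleDomain L x₀) :
    Continuous (coord (L := L) x₀ x) := by
  have h : ⇑(coord (L := L) x₀ x) =
      ((trivializationAt ℂ L x₀).continuousLinearEquivAt ℂ x hx) :=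
    funext fun u => coord_apply hx u
  rw [h]
  exact ContinuousLinearEquiv.continuous _

lemma tendsto_of_coord {x₀ x : M} (hx : x ∈ bundleDomain L x₀) {ι : Type*} {l : Filter ι}
    {s : ι → L x} {t : L x}
    (h : Filter.Tendsto (fun k => coord x₀ x (s k)) l (nhds (coord x₀ x t))) :
    Filter.Tendsto s l (nhds t) := by
  let E := (trivializationAt ℂ L x₀).continuousLinearEquivAt ℂ x hx
  have hE : ∀ u, E u = coord x₀ x u := fun u => (coord_apply hx u).symm
  have := (E.symm.continuous.tendsto (coord x₀ x t)).comp h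
  simpa [← hE, Function.comp_def] using this

lemma coord_smul_real (x₀ x : M) (r : ℝ) (u : L x) : coord x₀ x (r • u) = r * coord x₀ x u := by
  rw [← Complex.coe_smul, map_smul, smul_eq_mul]

lemma SmoothSectionOn.contMDiffAt_coord {s : ∀ x, L x} (hs : SmoothSectionOn n s Set.univ)
    {x₀ x : M} (hx : x ∈ bundleDomain L x₀) :
    ContMDiffAt 𝓘(ℝ, Model n) 𝓘(ℝ, ℂ) ∞ (fun y => coord x₀ y (s y)) x := by
  have h := (hs x trivial).contMDiffAt Filter.univ_mem
  rw [(trivializationAt ℂ L x₀).contMDiffAt_section_iff hx] at h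
  refine h.congr_of_eventuallyEq ?_
  filter_upwards [(trivializationAt ℂ L x₀).open_baseSet.mem_nhds hx] with y hy
  exact coord_apply hy _

lemma smoothSectionOn_univ_of_coord {s : ∀ x, L x}
    (h : ∀ x₀, ContMDiffAt 𝓘(ℝ, Model n) 𝓘(ℝ, ℂ) ∞ (fun y => coord x₀ y (s y)) x₀) :
    SmoothSectionOn n s Set.univ := by
  intro x₀ _
  have hx := mem_baseSet_trivializationAt ℂ L x₀
  refine ContMDiffAt.contMDiffWithinAt ?_
  rw [(trivializationAt ℂ L x₀).contMDiffAt_section_iff hx]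
  refine (h x₀).congr_of_eventuallyEq ?_
  filter_upwards [(trivializationAt ℂ L x₀).open_baseSet.mem_nhds hx] with y hy
  exact (coord_apply hy _).symm

variable (n L) in
/-- The local frame of coordinate `1`. -/
lemma exists_frame (x₀ : M) : ∃ τ : ∀ x, L x, SmoothSectionOn n τ (bundleDomain L x₀) ∧
    ∀ x ∈ bundleDomain L x₀, coord x₀ x (τ x) = 1 := by
  choose! τ hτ using fun x (hx : x ∈ bundleDomain L x₀) => coord_surjective (L := L) hx 1
  refine ⟨τ, ?_, hτ⟩
  rw [SmoothSectionOn, (trivializationAt ℂ L x₀).contMDiffOn_section_iff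
    (trivializationAt ℂ L x₀).open_baseSet subset_rfl]
  refine contMDiffOn_const (c := (1 : ℂ)) |>.congr fun x hx => ?_
  rw [← coord_apply hx, hτ x hx]

variable (n L) in
/-- A global smooth section with constant coordinate `1` near a given point. -/
lemma exists_section_coord_eq_one [T2Space M] (x₀ : M) : ∃ σ : ∀ x, L x,
    SmoothSectionOn n σ Set.univ ∧
      ∀ᶠ x in nhds x₀, x ∈ bundleDomain L x₀ ∧ coord x₀ x (σ x) = 1 := by
  have hbase := (trivializationAt ℂ L x₀).open_baseSet.mem_nhds
    (mem_baseSet_trivializationAt ℂ L x₀)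
  obtain ⟨τ, hτs, hτ⟩ := exists_frame n L x₀
  -- The local frame is cut off to a global section because the complex linearity of the connection
  -- is assumed for global smooth sections.
  obtain ⟨ρ, -, hρ⟩ :=
    (SmoothBumpFunction.nhds_basis_tsupport (I := 𝓘(ℝ, Model n)) x₀).mem_iff.1 hbase
  refine ⟨(ρ : M → ℝ) • τ, contMDiffOn_univ.2 (ContMDiffOn.smul_section_of_tsupport
    ρ.contMDiff.contMDiffOn (trivializationAt ℂ L x₀).open_baseSet hρ hτs), ?_⟩
  filter_upwards [hbase, ρ.eventuallyEq_one] with x hx hρx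
  refine ⟨hx, ?_⟩
  rw [Pi.smul_apply', coord_smul_real, hρx, hτ x hx]
  simp

variable {ħ : ℝ} {Ω : SymplecticForm n M} (Q : Prequantization L ħ Ω)

lemma mvfderiv_comp_clm {F G : Type*} [NormedAddCommGroup F] [NormedSpace ℝ F]
    [NormedAddCommGroup G] [NormedSpace ℝ G] (A : F →L[ℝ] G) {f : M → F} {x : M}
    (hf : MDifferentiableAt 𝓘(ℝ, Model n) 𝓘(ℝ, F) f x) (v : Tan n x) :
    dirDeriv (fun y => A (f y)) x v = A (dirDeriv f x v) := by
  have h : HasMFDerivAt 𝓘(ℝ, Model n) 𝓘(ℝ, G) (fun y => A (f y)) x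
      (A.comp (mfderiv 𝓘(ℝ, Model n) 𝓘(ℝ, F) f x)) :=
    A.hasMFDerivAt.comp x hf.hasMFDerivAt
  simp only [dirDeriv, mvfderiv, h.mfderiv]
  rfl

/-- The connection in terms of a local frame. -/
lemma Prequantization.nabla_eq {x₀ x : M} {σ s : ∀ x, L x} (hσ : SmoothSectionOn n σ Set.univ)
    (hσ1 : ∀ᶠ y in nhds x, y ∈ bundleDomain L x₀ ∧ coord x₀ y (σ y) = 1)
    (hs : SmoothSectionOn n s Set.univ) (v : Tan n x) :
    Q.nabla s x v = dirDeriv (fun y => coord x₀ y (s y)) x v • σ x +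
      coord x₀ x (s x) • Q.nabla σ x v := by
  set f : M → ℂ := fun y => coord x₀ y (s y) with hf
  have hfm : MDifferentiableAt 𝓘(ℝ, Model n) 𝓘(ℝ, ℂ) f x :=
    (hs.contMDiffAt_coord hσ1.self_of_nhds.1).mdifferentiableAt (by simp)
  have hre : MDifferentiableAt 𝓘(ℝ, Model n) 𝓘(ℝ, ℝ) (fun y => (f y).re) x :=
    Complex.reCLM.mdifferentiableAt.comp x hfm
  have him : MDifferentiableAt 𝓘(ℝ, Model n) 𝓘(ℝ, ℝ) (fun y => (f y).im) x :=
    Complex.imCLM.mdifferentiableAt.comp x hfm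
  have hσm := hσ.mdifferentiableAt_section x
  have hIσ : SmoothSectionOn n (Complex.I • σ) Set.univ := hσ.smul Complex.I
  have hIσm := hIσ.mdifferentiableAt_section x
  have h1 := Q.nabla.isCovariantDerivativeOnUniv.leibniz hσm hre
  have h2 := Q.nabla.isCovariantDerivativeOnUniv.leibniz hIσm him
  -- The Leibniz rule of the connection concerns real functions only. Writing s = (Re f)σ + (Im
  -- f)(iσ) reduces the complex coefficient to two real ones, and complex linearity handles ∇(iσ).
  have heq : ∀ᶠ y in nhds x, s y = ((fun y => (f y).re) • σ + (fun y => (f y).im) •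
      (Complex.I • σ)) y := by
    filter_upwards [hσ1] with y hy
    refine coord_injective hy.1 ?_
    simp only [Pi.add_apply, Pi.smul_apply', map_add, coord_smul_real, hy.2, Pi.smul_apply,
      map_smul, smul_eq_mul]
    refine (Complex.re_add_im (f y)).symm.trans ?_
    ring
  have ha := Q.nabla.isCovariantDerivativeOnUniv.congr_of_eventuallyEq
    (hs.mdifferentiableAt_section x)
    (mdifferentiableAt_add_section (hre.smul_section hσm) (him.smul_section hIσm))
    Filter.univ_mem heq
  rw [ha, Q.nabla.isCovariantDerivativeOnUniv.add (hre.smul_section hσm)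
    (him.smul_section hIσm), h1, h2]
  have hI : Q.nabla (Complex.I • σ) x v = Complex.I • Q.nabla σ x v :=
    Q.nabla_smul Complex.I σ hσ x v
  have d1 : mvfderiv 𝓘(ℝ, Model n) (fun y => (f y).re) x v = (dirDeriv f x v).re :=
    mvfderiv_comp_clm Complex.reCLM hfm v
  have d2 : mvfderiv 𝓘(ℝ, Model n) (fun y => (f y).im) x v = (dirDeriv f x v).im :=
    mvfderiv_comp_clm Complex.imCLM hfm v
  simp only [add_apply, smul_apply, ContinuousLinearMap.smulRight_apply, hI, d1, d2,
    Pi.smul_apply]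
  have hz : ∀ (z : ℂ) (u : L x), z • u = z.re • u + z.im • Complex.I • u := fun z u => by
    conv_lhs => rw [← Complex.re_add_im z]
    rw [add_smul, mul_smul, Complex.coe_smul, Complex.coe_smul]
  rw [hz (dirDeriv f x v), hz (coord x₀ x (s x))]
  abel

end LineBundleCoordinates

/-! ### Totally complex subspaces -/

section TotallyComplex

variable {V : Type*} [AddCommGroup V] [Module ℝ V]

lemma smul_cvec (z : ℂ) (v w : V) :
    z • cvec v w = cvec (z.re • v - z.im • w) (z.im • v + z.re • w) := by
  have h : ∀ (c : ℂ) (u : V), c ⊗ₜ[ℝ] u =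
      c.re • ((1 : ℂ) ⊗ₜ[ℝ] u) + c.im • (Complex.I ⊗ₜ[ℝ] u) := fun c u => by
    rw [TensorProduct.smul_tmul', TensorProduct.smul_tmul', ← TensorProduct.add_tmul]
    congr 1
    simp
  simp only [cvec, smul_add, TensorProduct.smul_tmul', smul_eq_mul, mul_one]
  rw [h z v, h (z * Complex.I) w]
  simp only [TensorProduct.tmul_sub, TensorProduct.tmul_add, TensorProduct.tmul_smul,
    Complex.mul_re, Complex.mul_im, Complex.I_re, Complex.I_im]
  module

lemma sum_cvec {ι : Type*} (s : Finset ι) (v w : ι → V) :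
    ∑ j ∈ s, cvec (v j) (w j) = cvec (∑ j ∈ s, v j) (∑ j ∈ s, w j) := by
  simp only [cvec, TensorProduct.tmul_sum, Finset.sum_add_distrib]

lemma cconj_cvec (v w : V) : cconj V (cvec v w) = cvec v (-w) := by
  change TensorProduct.map Complex.conjAe.toLinearMap LinearMap.id _ = _
  simp [cvec, TensorProduct.neg_tmul, TensorProduct.tmul_neg]

/-- The real and imaginary parts of a basis of a totally complex subspace of half the dimension
span the real vector space. -/
lemma span_re_im_eq_top [FiniteDimensional ℝ V] {n : ℕ} (hn : Module.finrank ℝ V = 2 * n)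
    {W : Submodule ℂ (ℂ ⊗[ℝ] V)} (hW : Module.finrank ℂ W = n) (hWc : W ⊓ conjSubspace W = ⊥)
    {X Y : Fin n → V} (hXY : W = Submodule.span ℂ (Set.range fun j => cvec (X j) (Y j))) :
    Submodule.span ℝ (Set.range (Sum.elim X Y)) = ⊤ := by
  have hC : LinearIndependent ℂ fun j => cvec (X j) (Y j) := by
    rw [linearIndependent_iff_card_eq_finrank_span, Set.finrank, ← hXY, hW, Fintype.card_fin]
  have hR : LinearIndependent ℝ (Sum.elim X Y) := by
    rw [Fintype.linearIndependent_iff]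
    intro g hg
    simp only [Fintype.sum_sum_type, Sum.elim_inl, Sum.elim_inr] at hg
    -- With cⱼ = gⱼ − ig'ⱼ, where gⱼ and g'ⱼ are the coefficients of Xⱼ and Yⱼ, the real part of Σ
    -- cⱼ(Xⱼ + iYⱼ) is the given vanishing real combination. The sum is therefore purely imaginary,
    -- hence lies in W and in its conjugate, hence is zero.
    let c : Fin n → ℂ := fun j => ⟨g (Sum.inl j), -g (Sum.inr j)⟩
    set w : V := ∑ j, (-g (Sum.inr j) • X j + g (Sum.inl j) • Y j)
    have hsum : ∑ j, c j • cvec (X j) (Y j) = cvec 0 w := by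
      simp only [smul_cvec, sum_cvec, c, neg_smul, sub_neg_eq_add, Finset.sum_add_distrib, hg, w]
    have hmem : cvec 0 w ∈ W := by
      rw [← hsum, hXY]
      exact Submodule.sum_mem _ fun j _ =>
        Submodule.smul_mem _ _ (Submodule.subset_span ⟨j, rfl⟩)
    have hconj : cvec 0 w ∈ conjSubspace W := by
      refine ⟨-cvec 0 w, W.neg_mem hmem, ?_⟩
      rw [map_neg, cconj_cvec]
      simp [cvec, TensorProduct.tmul_neg]
    have h0 : cvec 0 w = 0 := by
      have : cvec 0 w ∈ W ⊓ conjSubspace W := ⟨hmem, hconj⟩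
      rwa [hWc, Submodule.mem_bot] at this
    rw [h0] at hsum
    have hc := Fintype.linearIndependent_iff.1 hC c hsum
    rintro (j | j)
    · exact congrArg Complex.re (hc j)
    · simpa [c] using congrArg Complex.im (hc j)
  exact hR.span_eq_top_of_card_eq_finrank' (by simp [hn, two_mul])

end TotallyComplex

/-! ### Construction of elliptic frames -/

section FrameConstruction

variable {N : ℕ} {J : Type*} [Fintype J]

/-- Smooth vector fields whose real and imaginary parts span at each point of a closed ball form
an elliptic frame. -/
lemma exists_ellipticFrame (y₀ : Euc N) (R : ℝ) {X Y : J → Euc N → Euc N}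
    (hX : ∀ j, ContDiff ℝ ∞ (X j)) (hY : ∀ j, ContDiff ℝ ∞ (Y j))
    (hspan : ∀ y ∈ Metric.closedBall y₀ R, ∀ ℓ : Euc N →L[ℝ] ℝ,
      (∀ j, ℓ (X j y) = 0 ∧ ℓ (Y j y) = 0) → ℓ = 0) :
    ∃ Φ : EllipticFrame N J, Φ.center = y₀ ∧ Φ.radius = R ∧ Φ.X = X ∧ Φ.Y = Y := by
  -- The spanning condition makes g positive on the compact product of the ball and the unit sphere
  -- of covectors. Its minimum m there extends to all covectors by homogeneity of degree two.
  let g : Euc N × (Euc N →L[ℝ] ℝ) → ℝ := fun p => ∑ j, (p.2 (X j p.1) ^ 2 + p.2 (Y j p.1) ^ 2)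
  have hXc := fun j => (hX j).continuous
  have hYc := fun j => (hY j).continuous
  have hg : Continuous g := by fun_prop
  have hK : IsCompact (Metric.closedBall y₀ R ×ˢ
      Metric.sphere (0 : Euc N →L[ℝ] ℝ) 1) :=
    (isCompact_closedBall _ _).prod (isCompact_sphere _ _)
  have hpos : ∀ p ∈ Metric.closedBall y₀ R ×ˢ Metric.sphere (0 : Euc N →L[ℝ] ℝ) 1,
      0 < g p := by
    rintro ⟨y, ℓ⟩ ⟨hy, hℓ⟩
    refine lt_of_le_of_ne (Finset.sum_nonneg fun _ _ => by positivity) fun h0 => ?_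
    have h1 := (Finset.sum_eq_zero_iff_of_nonneg fun _ _ => by positivity).1 h0.symm
    have : ℓ = 0 := hspan y hy ℓ fun j => by
      have h2 := h1 j (Finset.mem_univ j)
      constructor <;> nlinarith [sq_nonneg (ℓ (X j y)), sq_nonneg (ℓ (Y j y))]
    simp [this] at hℓ
  obtain ⟨m, hm, hmg⟩ : ∃ m > 0, ∀ p ∈ Metric.closedBall y₀ R ×ˢ
      Metric.sphere (0 : Euc N →L[ℝ] ℝ) 1, m ≤ g p := by
    -- The product can be empty, for instance when N = 0 and there are no unit covectors; any
    -- positive m then serves.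
    rcases Set.eq_empty_or_nonempty (Metric.closedBall y₀ R ×ˢ
      Metric.sphere (0 : Euc N →L[ℝ] ℝ) 1) with he | hne
    · exact ⟨1, one_pos, fun p hp => by rw [he] at hp; exact hp.elim⟩
    · obtain ⟨p, hp, hmin⟩ := hK.exists_isMinOn hne hg.continuousOn
      exact ⟨g p, hpos p hp, fun q hq => hmin hq⟩
  -- The factor N comes from bounding each of the N squares ℓ(eₖ)² by ‖ℓ‖².
  refine ⟨⟨y₀, R, X, Y, hX, hY, N / m, by positivity, fun y hy ℓ => ?_⟩, rfl, rfl, rfl, rfl⟩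
  have h1 : ∑ k, ℓ (EuclideanSpace.single k 1) ^ 2 ≤ N * ‖ℓ‖ ^ 2 := by
    have : ∀ k : Fin N, ℓ (EuclideanSpace.single k 1) ^ 2 ≤ ‖ℓ‖ ^ 2 := fun k => by
      rw [sq_le_sq, abs_norm, ← Real.norm_eq_abs]
      simpa using ℓ.le_opNorm (EuclideanSpace.single k 1)
    exact (Finset.sum_le_sum fun k _ => this k).trans_eq (by simp)
  have h2 : m * ‖ℓ‖ ^ 2 ≤ g (y, ℓ) := by
    by_cases h0 : ℓ = 0
    · simp [h0, g]
    have hn : ‖ℓ‖ ≠ 0 := norm_ne_zero_iff.2 h0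
    have h3 := hmg (y, ‖ℓ‖⁻¹ • ℓ) ⟨hy, by simp [norm_smul, hn]⟩
    have h4 : g (y, ‖ℓ‖⁻¹ • ℓ) = (‖ℓ‖ ^ 2)⁻¹ * g (y, ℓ) := by
      simp only [g, Finset.mul_sum, smul_apply, smul_eq_mul]
      exact Finset.sum_congr rfl fun j _ => by ring
    rw [h4, inv_mul_eq_div, le_div_iff₀ (by positivity)] at h3
    exact h3
  calc _ ≤ N * ‖ℓ‖ ^ 2 := h1
    _ = N / m * (m * ‖ℓ‖ ^ 2) := by field_simp
    _ ≤ N / m * g (y, ℓ) := by gcongr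

/-- Data living on a chart domain become globally smooth on ℝᴺ after multiplication by a cutoff, as
`EllipticFrame` and `IsSolution` demand. -/
lemma contDiff_smul_of_tsupport_subset {F : Type*} [NormedAddCommGroup F] [NormedSpace ℝ F]
    {χ : Euc N → ℝ} (hχ : ContDiff ℝ ∞ χ) {V : Set (Euc N)} (hV : IsOpen V)
    (hχV : tsupport χ ⊆ V) {f : Euc N → F} (hf : ContDiffOn ℝ ∞ f V) :
    ContDiff ℝ ∞ fun y => χ y • f y := by
  rw [contDiff_iff_contDiffAt]
  intro y
  by_cases hy : y ∈ V
  · exact hχ.contDiffAt.smul (hf.contDiffAt (hV.mem_nhds hy))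
  · refine contDiffAt_const (c := (0 : F)) |>.congr_of_eventuallyEq ?_
    filter_upwards [(isClosed_tsupport χ).isOpen_compl.mem_nhds fun h => hy (hχV h)] with z hz
    simp [image_eq_zero_of_notMem_tsupport hz]

end FrameConstruction

/-! ### The equation of polarized sections in a chart -/

section ChartCoordinates

set_option linter.unusedSectionVars false

variable {n : ℕ} {M : Type*} [TopologicalSpace M] [ChartedSpace (Model n) M]
  [IsManifold 𝓘(ℝ, Model n) ∞ M]

/-- The derivative of the preferred chart at `x₀`. -/
noncomputable def chartDeriv (x₀ x : M) : Tan n x →L[ℝ] Model n :=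
  mfderiv 𝓘(ℝ, Model n) 𝓘(ℝ, Model n) (chartAt (Model n) x₀) x

/-- The derivative of the inverse of the preferred chart at `x₀`. -/
noncomputable def chartDerivSymm (x₀ : M) (y : Model n) :
    Model n →L[ℝ] Tan n ((chartAt (Model n) x₀).symm y) :=
  mfderiv 𝓘(ℝ, Model n) 𝓘(ℝ, Model n) (chartAt (Model n) x₀).symm y

lemma mdifferentiableAt_chart {x₀ x : M} (hx : x ∈ (chartAt (Model n) x₀).source) :
    MDifferentiableAt 𝓘(ℝ, Model n) 𝓘(ℝ, Model n) (chartAt (Model n) x₀) x :=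
  ((contMDiffOn_chart (I := 𝓘(ℝ, Model n)) (n := ∞)).contMDiffAt
    ((chartAt (Model n) x₀).open_source.mem_nhds hx)).mdifferentiableAt (by simp)

lemma mdifferentiableAt_chart_symm {x₀ : M} {y : Model n}
    (hy : y ∈ (chartAt (Model n) x₀).target) :
    MDifferentiableAt 𝓘(ℝ, Model n) 𝓘(ℝ, Model n) (chartAt (Model n) x₀).symm y :=
  ((contMDiffOn_chart_symm (I := 𝓘(ℝ, Model n)) (n := ∞)).contMDiffAt
    ((chartAt (Model n) x₀).open_target.mem_nhds hy)).mdifferentiableAt (by simp)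

lemma chartDeriv_chartDerivSymm {x₀ : M} {y : Model n} (hy : y ∈ (chartAt (Model n) x₀).target)
    (v : Model n) :
    chartDeriv x₀ ((chartAt (Model n) x₀).symm y) (chartDerivSymm x₀ y v) = v := by
  have h := HasMFDerivAt.comp y
    (mdifferentiableAt_chart ((chartAt (Model n) x₀).map_target hy)).hasMFDerivAt
    (mdifferentiableAt_chart_symm hy).hasMFDerivAt
  have h2 : HasMFDerivAt 𝓘(ℝ, Model n) 𝓘(ℝ, Model n)
      ((chartAt (Model n) x₀) ∘ (chartAt (Model n) x₀).symm) y
      (ContinuousLinearMap.id ℝ (TangentSpace 𝓘(ℝ, Model n) y)) := by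
    refine (hasMFDerivAt_id y).congr_of_eventuallyEq ?_
    filter_upwards [(chartAt (Model n) x₀).open_target.mem_nhds hy] with z hz
    exact (chartAt (Model n) x₀).right_inv hz
  exact DFunLike.congr_fun (hasMFDerivAt_unique h h2) v

lemma chartDerivSymm_chartDeriv {x₀ : M} {y : Model n} (hy : y ∈ (chartAt (Model n) x₀).target)
    (v : Tan n ((chartAt (Model n) x₀).symm y)) :
    chartDerivSymm x₀ y (chartDeriv x₀ ((chartAt (Model n) x₀).symm y) v) = v := by
  have hs := (chartAt (Model n) x₀).map_target hy
  have hr := (chartAt (Model n) x₀).right_inv hy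
  have h := HasMFDerivAt.comp ((chartAt (Model n) x₀).symm y)
    (g := (chartAt (Model n) x₀).symm) (f := chartAt (Model n) x₀)
    (g' := chartDerivSymm x₀ y)
    (by rw [hr]; exact (mdifferentiableAt_chart_symm hy).hasMFDerivAt)
    (mdifferentiableAt_chart hs).hasMFDerivAt
  have h2 : HasMFDerivAt 𝓘(ℝ, Model n) 𝓘(ℝ, Model n)
      ((chartAt (Model n) x₀).symm ∘ (chartAt (Model n) x₀)) ((chartAt (Model n) x₀).symm y)
      (ContinuousLinearMap.id ℝ (Tan n ((chartAt (Model n) x₀).symm y))) := by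
    refine (hasMFDerivAt_id _).congr_of_eventuallyEq ?_
    filter_upwards [(chartAt (Model n) x₀).open_source.mem_nhds hs] with z hz
    exact (chartAt (Model n) x₀).left_inv hz
  exact DFunLike.congr_fun (hasMFDerivAt_unique h h2) v

lemma fderiv_comp_chart_symm {F : Type*} [NormedAddCommGroup F] [NormedSpace ℝ F]
    {x₀ : M} {y : Model n} (hy : y ∈ (chartAt (Model n) x₀).target) {f : M → F}
    (hf : MDifferentiableAt 𝓘(ℝ, Model n) 𝓘(ℝ, F) f ((chartAt (Model n) x₀).symm y))
    (v : Tan n ((chartAt (Model n) x₀).symm y)) :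
    fderiv ℝ (fun z => f ((chartAt (Model n) x₀).symm z)) y
        (chartDeriv x₀ ((chartAt (Model n) x₀).symm y) v) =
      dirDeriv f ((chartAt (Model n) x₀).symm y) v := by
  have h : HasMFDerivAt 𝓘(ℝ, Model n) 𝓘(ℝ, F) (f ∘ (chartAt (Model n) x₀).symm) y
      ((mfderiv 𝓘(ℝ, Model n) 𝓘(ℝ, F) f ((chartAt (Model n) x₀).symm y)).comp
        (chartDerivSymm x₀ y)) :=
    hf.hasMFDerivAt.comp y (mdifferentiableAt_chart_symm hy).hasMFDerivAt
  let T : Model n →L[ℝ] F := (mfderiv 𝓘(ℝ, Model n) 𝓘(ℝ, F) f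
    ((chartAt (Model n) x₀).symm y)).comp (chartDerivSymm x₀ y)
  have h2 : HasFDerivAt (f ∘ (chartAt (Model n) x₀).symm) T y := h.hasFDerivAt
  refine (DFunLike.congr_fun h2.fderiv _).trans ?_
  change mfderiv 𝓘(ℝ, Model n) 𝓘(ℝ, F) f _ (chartDerivSymm x₀ y (chartDeriv x₀ _ v)) = _
  rw [chartDerivSymm_chartDeriv hy]
  rfl

/-- On the chart domain the preferred trivialization of the tangent bundle is the derivative of the
chart, so smoothness of the field as a section is smoothness of its components. -/
lemma SmoothFieldOn.contDiffOn_chartDeriv {X : ∀ x : M, Tan n x} {U : Set M} (hU : IsOpen U)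
    (hX : SmoothFieldOn X U) (x₀ : M) :
    ContDiffOn ℝ ∞ (fun y => chartDeriv x₀ ((chartAt (Model n) x₀).symm y)
        (X ((chartAt (Model n) x₀).symm y)))
      ((chartAt (Model n) x₀).target ∩ (chartAt (Model n) x₀).symm ⁻¹' U) := by
  rw [← contMDiffOn_iff_contDiffOn]
  have hsmooth : ContMDiffOn 𝓘(ℝ, Model n) 𝓘(ℝ, Model n) ∞ (fun x => chartDeriv x₀ x (X x))
      ((chartAt (Model n) x₀).source ∩ U) := by
    have h1 := (trivializationAt (Model n) (TangentSpace 𝓘(ℝ, Model n)) x₀).contMDiffOn_section_iff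
      (IB := 𝓘(ℝ, Model n)) (n := ∞) (s := X) (a := (chartAt (Model n) x₀).source ∩ U)
      ((chartAt (Model n) x₀).open_source.inter hU)
      (by rw [TangentBundle.trivializationAt_baseSet]; exact Set.inter_subset_left)
    refine (h1.1 (hX.mono Set.inter_subset_right)).congr fun x hx => ?_
    have h2 := TangentBundle.continuousLinearMapAt_trivializationAt (I := 𝓘(ℝ, Model n)) hx.1
    have hb : x ∈ (trivializationAt (Model n) (TangentSpace 𝓘(ℝ, Model n)) x₀).baseSet := by
      rw [TangentBundle.trivializationAt_baseSet]; exact hx.1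
    have h3 := DFunLike.congr_fun h2 (X x)
    rw [Trivialization.continuousLinearMapAt_apply,
      Trivialization.coe_linearMapAt_of_mem _ hb] at h3
    exact h3.symm
  exact hsmooth.comp (contMDiffOn_chart_symm.mono Set.inter_subset_left)
    fun y hy => ⟨(chartAt (Model n) x₀).map_target hy.1, hy.2⟩

end ChartCoordinates

/-! ### Local representatives of polarized sections as solutions of an elliptic system. -/

section LocalSystem

set_option linter.unusedSectionVars false

variable {n : ℕ} {M : Type*} [TopologicalSpace M] [ChartedSpace (Model n) M]
  [IsManifold 𝓘(ℝ, Model n) ∞ M]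
  {L : M → Type*} [TopologicalSpace (TotalSpace ℂ L)] [∀ x, AddCommGroup (L x)]
  [∀ x, Module ℂ (L x)] [∀ x, TopologicalSpace (L x)] [∀ x, IsTopologicalAddGroup (L x)]
  [∀ x, ContinuousSMul ℝ (L x)] [FiberBundle ℂ L] [VectorBundle ℂ ℂ L] [VectorBundle ℝ ℂ L]
  [ContMDiffVectorBundle ∞ ℂ L 𝓘(ℝ, Model n)]
  {ħ : ℝ} {Ω : SymplecticForm n M}

/-- The section `s` is polarized at the point `x`. -/
def Prequantization.PolarizedAt (Q : Prequantization L ħ Ω) (P : ComplexPolarization Ω)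
    (s : ∀ x, L x) (x : M) : Prop :=
  ∀ v w : Tan n x, cvec v w ∈ P.toFun x → Q.nabla s x v + Complex.I • Q.nabla s x w = 0

/-- The local representative of a section in the preferred chart and trivialization at `x₀`. -/
noncomputable def localRep (x₀ : M) (s : ∀ x, L x) (y : Model n) : ℂ :=
  coord x₀ ((chartAt (Model n) x₀).symm y) (s ((chartAt (Model n) x₀).symm y))

variable (n L) in
/-- The domain of local representatives. -/
def repDomain (x₀ : M) : Set (Model n) :=
  (chartAt (Model n) x₀).target ∩ (chartAt (Model n) x₀).symm ⁻¹' bundleDomain L x₀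

lemma contDiffOn_localRep {s : ∀ x, L x} (hs : SmoothSectionOn n s Set.univ) (x₀ : M) :
    ContDiffOn ℝ ∞ (localRep (n := n) x₀ s) (repDomain n L x₀) := by
  rw [← contMDiffOn_iff_contDiffOn]
  have h : ContMDiffOn 𝓘(ℝ, Model n) 𝓘(ℝ, ℂ) ∞ (fun x => coord x₀ x (s x)) (bundleDomain L x₀) :=
    fun x hx => (hs.contMDiffAt_coord hx).contMDiffWithinAt
  exact h.comp (contMDiffOn_chart_symm.mono Set.inter_subset_left) fun y hy => hy.2

lemma localRep_sub (x₀ : M) (s t : ∀ x, L x) (y : Model n) :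
    localRep x₀ (s - t) y = localRep x₀ s y - localRep x₀ t y :=
  map_sub _ _ _

/-- The local representatives of polarized sections solve an elliptic system. -/
theorem Prequantization.exists_local_system [T2Space M] (Q : Prequantization L ħ Ω)
    (P : ComplexPolarization Ω) (hP : P.IsKahler) (x₀ : M) :
    ∃ (Φ : EllipticFrame (2 * n) (Fin n)) (A : Fin n → Unit → Unit → Euc (2 * n) → ℂ)
      (χ : Euc (2 * n) → ℝ), 0 < Φ.radius ∧ Φ.center = chartAt (Model n) x₀ x₀ ∧
      (∀ j a b, ContDiff ℝ ∞ (A j a b)) ∧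
      Metric.closedBall Φ.center Φ.radius ⊆ repDomain n L x₀ ∧
      (∀ y ∈ Metric.closedBall Φ.center Φ.radius, χ y = 1) ∧
      ∀ s : ∀ x, L x, SmoothSectionOn n s Set.univ → (∀ x, Q.PolarizedAt P s x) →
        Φ.IsSolution A fun _ y => χ y • localRep x₀ s y := by
  obtain ⟨σ, hσ, hσ1⟩ := exists_section_coord_eq_one n L x₀
  obtain ⟨U, hU, hx₀U, X, Y, hXY, hspan⟩ := P.smooth x₀
  obtain ⟨O, hOsub, hO, hx₀O⟩ := eventually_nhds_iff.1 hσ1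
  set κ := chartAt (Model n) x₀ with hκ
  have hOσ : ∀ x ∈ O, ∀ᶠ y in nhds x, y ∈ bundleDomain L x₀ ∧ coord x₀ y (σ y) = 1 :=
    fun x hx => Filter.eventually_of_mem (hO.mem_nhds hx) hOsub
  let V : Set (Model n) := κ.target ∩ κ.symm ⁻¹' (U ∩ O)
  have hV : IsOpen V := κ.isOpen_inter_preimage_symm (hU.inter hO)
  have hκx₀ : κ.symm (κ x₀) = x₀ := κ.left_inv (mem_chart_source _ _)
  have hy₀V : κ x₀ ∈ V := ⟨mem_chart_target _ _, by
    rw [Set.mem_preimage, hκx₀]; exact ⟨hx₀U, hx₀O⟩⟩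
  obtain ⟨ε, hε, hεV⟩ := Metric.nhds_basis_closedBall.mem_iff.1 (hV.mem_nhds hy₀V)
  -- One cutoff serves the fields, the coefficients and the sections. It equals 1 on the ball of
  -- radius ε/2, the ball of the elliptic frame, so the equation there is unaffected.
  let χ : ContDiffBump (κ x₀) := ⟨ε / 2, ε, by positivity, by linarith⟩
  have hχV : tsupport χ ⊆ V := by rw [χ.tsupport_eq]; exact hεV
  have hχ1 : ∀ y ∈ Metric.closedBall (κ x₀) (ε / 2), χ y = 1 := fun y hy =>
    χ.one_of_mem_closedBall hy
  have hbV : Metric.closedBall (κ x₀) (ε / 2) ⊆ V :=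
    (Metric.closedBall_subset_closedBall (by linarith)).trans hεV
  have hVrep : V ⊆ repDomain n L x₀ := fun y hy => ⟨hy.1, (hOsub _ hy.2.2).1⟩
  -- the vector fields in the chart
  let field : (∀ x : M, Tan n x) → Model n → Model n := fun Z y =>
    χ y • chartDeriv x₀ (κ.symm y) (Z (κ.symm y))
  have hfield : ∀ Z : ∀ x : M, Tan n x, SmoothFieldOn Z U → ContDiff ℝ ∞ (field Z) :=
    fun Z hZ => contDiff_smul_of_tsupport_subset χ.contDiff hV hχV
      ((hZ.contDiffOn_chartDeriv hU x₀).mono fun y hy => ⟨hy.1, hy.2.1⟩)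
  obtain ⟨Φ, hΦc, hΦr, hΦX, hΦY⟩ := exists_ellipticFrame (κ x₀) (ε / 2)
    (fun j => hfield (X j) (hXY j).1) (fun j => hfield (Y j) (hXY j).2) (by
      intro y hy ℓ hℓ
      have hyV := hbV hy
      have htop : Submodule.span ℝ (Set.range (Sum.elim (fun j => X j (κ.symm y))
          fun j => Y j (κ.symm y))) = ⊤ := @span_re_im_eq_top (Tan n (κ.symm y)) _ _
        (inferInstanceAs (FiniteDimensional ℝ (Model n))) n (finrank_euclideanSpace_fin : Module.finrank ℝ (Model n) = 2 * n) _
        (P.finrank_eq _) (hP _) _ _ (hspan _ hyV.2.1)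
      -- A covector killing all coordinate fields pulls back to one killing the real and imaginary
      -- parts of a frame of P, which span the tangent space.
      have hker : Submodule.span ℝ (Set.range (Sum.elim (fun j => X j (κ.symm y))
          fun j => Y j (κ.symm y))) ≤
          LinearMap.ker (ℓ.comp (chartDeriv x₀ (κ.symm y))).toLinearMap := by
        rw [Submodule.span_le]
        rintro _ ⟨j | j, rfl⟩
        · simpa [field, hχ1 y hy] using (hℓ j).1
        · simpa [field, hχ1 y hy] using (hℓ j).2
      rw [htop, top_le_iff] at hker
      ext v
      have := LinearMap.mem_ker.1 (hker ▸ Submodule.mem_top :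
        chartDerivSymm x₀ y v ∈ LinearMap.ker (ℓ.comp (chartDeriv x₀ (κ.symm y))).toLinearMap)
      exact (congrArg ℓ (chartDeriv_chartDerivSymm hyV.1 v)).symm.trans this)
  -- the coefficients
  have hnab : ∀ Z : ∀ x : M, Tan n x, SmoothFieldOn Z U →
      ContDiffOn ℝ ∞ (fun y => coord x₀ (κ.symm y) (Q.nabla σ (κ.symm y) (Z (κ.symm y)))) V := by
    intro Z hZ
    have h1 := Q.nabla_smooth.contMDiff.contMDiff (σ := σ) hσ
    have h2 := (h1.mono (Set.subset_univ (U ∩ O))).clm_bundle_apply (hZ.mono Set.inter_subset_left)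
    rw [(trivializationAt ℂ L x₀).contMDiffOn_section_iff (hU.inter hO)
      fun x hx => (hOsub x hx.2).1] at h2
    rw [← contMDiffOn_iff_contDiffOn]
    refine (h2.comp (contMDiffOn_chart_symm.mono Set.inter_subset_left)
      fun y hy => hy.2).congr fun y hy => ?_
    exact coord_apply (hOsub _ hy.2.2).1 _
  -- With θ the connection form in the frame σ, ∇_Zs = (Zf + θ(Z)f)σ, so the polarization equation
  -- reads Zⱼf = −θ(Zⱼ)f.
  refine ⟨Φ, fun j _ _ y => χ y • -(coord x₀ (κ.symm y) (Q.nabla σ (κ.symm y) (X j (κ.symm y))) +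
    Complex.I * coord x₀ (κ.symm y) (Q.nabla σ (κ.symm y) (Y j (κ.symm y)))), χ,
    by rw [hΦr]; positivity, hΦc, fun j _ _ => contDiff_smul_of_tsupport_subset χ.contDiff hV hχV
      ((hnab _ (hXY j).1).add (contDiffOn_const.mul (hnab _ (hXY j).2))).neg,
    by rw [hΦc, hΦr]; exact hbV.trans hVrep, by rw [hΦc, hΦr]; exact hχ1, ?_⟩
  intro s hs hpol
  refine ⟨fun _ => contDiff_smul_of_tsupport_subset χ.contDiff hV hχV
    ((contDiffOn_localRep hs x₀).mono hVrep), fun j _ y hy => ?_⟩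
  rw [hΦc, hΦr] at hy
  have hyV := hbV (Metric.ball_subset_closedBall hy)
  have hχy : χ y = 1 := hχ1 y (Metric.ball_subset_closedBall hy)
  have hev : (fun y => χ y • localRep x₀ s y) =ᶠ[nhds y] localRep x₀ s := by
    filter_upwards [Metric.isOpen_ball.mem_nhds hy] with z hz
    rw [hχ1 z (Metric.ball_subset_closedBall hz), one_smul]
  have hfd : ∀ v : Tan n (κ.symm y), fderiv ℝ (localRep x₀ s) y (chartDeriv x₀ (κ.symm y) v) =
      dirDeriv (fun x => coord x₀ x (s x)) (κ.symm y) v := fun v =>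
    fderiv_comp_chart_symm hyV.1
      ((hs.contMDiffAt_coord (hOsub _ hyV.2.2).1).mdifferentiableAt (by simp)) v
  have hcoord := congrArg (coord x₀ (κ.symm y)) (hpol (κ.symm y) (X j (κ.symm y))
    (Y j (κ.symm y)) (by
      rw [hspan _ hyV.2.1]
      exact Submodule.subset_span ⟨j, rfl⟩))
  rw [Q.nabla_eq hσ (hOσ _ hyV.2.2) hs, Q.nabla_eq hσ (hOσ _ hyV.2.2) hs] at hcoord
  simp only [map_add, map_smul, smul_eq_mul, (hOsub _ hyV.2.2).2, map_zero, mul_one] at hcoord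
  simp only [hΦX, hΦY, hev.fderiv_eq, field, hχy, one_smul, hfd, Finset.univ_unique,
    Finset.sum_singleton]
  simp only [localRep]
  linear_combination hcoord

end LocalSystem

/-! ### Comparison of the Liouville measure with Lebesgue measure -/

section ChartDensity

set_option linter.unusedSectionVars false

variable {n : ℕ} {M : Type*} [TopologicalSpace M] [ChartedSpace (Model n) M]
  [IsManifold 𝓘(ℝ, Model n) ∞ M] (Ω : SymplecticForm n M)

/-- The vector field on the chart domain with constant coordinates `v`. -/
noncomputable def coordField (x₀ : M) (v : Model n) (x : M) : Tan n x :=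
  (chartDerivSymm x₀ (chartAt (Model n) x₀ x) v : Model n)

lemma chartDeriv_coordField {x₀ x : M} (hx : x ∈ (chartAt (Model n) x₀).source) (v : Model n) :
    chartDeriv x₀ x (coordField x₀ v x) = v := by
  have h := chartDeriv_chartDerivSymm ((chartAt (Model n) x₀).map_source hx) v
  have e := (chartAt (Model n) x₀).left_inv hx
  -- The base point κ⁻¹(κ x) equals x only propositionally; generalizing it to z allows the tangent
  -- space to be transported by substitution.
  have : ∀ z : M, z = x → (chartDeriv x₀ z : Model n → Model n)
      (chartDerivSymm x₀ (chartAt (Model n) x₀ x) v : Model n) = v →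
      chartDeriv x₀ x (coordField x₀ v x) = v := by
    rintro z rfl h
    exact h
  exact this _ e h

lemma smoothFieldOn_coordField (x₀ : M) (v : Model n) :
    SmoothFieldOn (coordField x₀ v) (chartAt (Model n) x₀).source := by
  rw [SmoothFieldOn, (trivializationAt (Model n)
    (TangentSpace 𝓘(ℝ, Model n)) x₀).contMDiffOn_section_iff
    (IB := 𝓘(ℝ, Model n)) (chartAt (Model n) x₀).open_source
    (by rw [TangentBundle.trivializationAt_baseSet])]
  refine (contMDiffOn_const (c := v)).congr fun x hx => ?_
  have h2 := TangentBundle.continuousLinearMapAt_trivializationAt (I := 𝓘(ℝ, Model n)) hx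
  have hb : x ∈ (trivializationAt (Model n) (TangentSpace 𝓘(ℝ, Model n)) x₀).baseSet := by
    rw [TangentBundle.trivializationAt_baseSet]; exact hx
  have h3 := DFunLike.congr_fun h2 (coordField x₀ v x)
  rw [Trivialization.continuousLinearMapAt_apply,
    Trivialization.coe_linearMapAt_of_mem _ hb] at h3
  exact h3.trans (chartDeriv_coordField hx v)

/-- The entries of Ω on the coordinate frame are Ω evaluated on smooth fields with constant
coordinates, hence smooth on the chart domain. -/
lemma SymplecticForm.continuousOn_chart (x₀ : M) (v w : Model n) :
    ContinuousOn (fun y => Ω.toFun ((chartAt (Model n) x₀).symm y) (chartDerivSymm x₀ y v)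
      (chartDerivSymm x₀ y w)) (chartAt (Model n) x₀).target := by
  have h : ContMDiffOn 𝓘(ℝ, Model n) 𝓘(ℝ, ℝ) ∞
      (fun x => Ω.toFun x (coordField x₀ v x) (coordField x₀ w x))
      (chartAt (Model n) x₀).source := by
    have h1 : ContMDiffOn 𝓘(ℝ, Model n) (𝓘(ℝ, Model n).prod 𝓘(ℝ, ℝ)) ∞
        (fun x => TotalSpace.mk' ℝ (E := Bundle.Trivial M ℝ) x
          (Ω.toFun x (coordField x₀ v x) (coordField x₀ w x)))
        (chartAt (Model n) x₀).source :=
      ContMDiffOn.clm_bundle_apply₂ (F₁ := Model n) (F₂ := Model n)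
        Ω.smooth.contMDiffOn (smoothFieldOn_coordField x₀ v) (smoothFieldOn_coordField x₀ w)
    intro x hx
    have := h1 x hx
    simp only [contMDiffWithinAt_totalSpace] at this
    exact this.2
  refine (h.continuousOn.comp (chartAt (Model n) x₀).continuousOn_symm
    (chartAt (Model n) x₀).mapsTo_symm).congr fun y hy => ?_
  simp only [Function.comp_apply, coordField]
  have e := (chartAt (Model n) x₀).right_inv hy
  have : ∀ z, z = y → Ω.toFun ((chartAt (Model n) x₀).symm y)
      (chartDerivSymm x₀ y v : Model n) (chartDerivSymm x₀ y w : Model n) =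
      Ω.toFun ((chartAt (Model n) x₀).symm y)
      (chartDerivSymm x₀ z v : Model n) (chartDerivSymm x₀ z w : Model n) := by
    rintro z rfl
    rfl
  exact this _ e

lemma SymplecticForm.continuousOn_chartDensity (x₀ : M) :
    ContinuousOn (Ω.chartDensity (chartAt (Model n) x₀)) (chartAt (Model n) x₀).target := by
  have h := fun i j : Fin (2 * n) => Ω.continuousOn_chart x₀ (EuclideanSpace.single i 1)
    (EuclideanSpace.single j 1)
  refine ContinuousOn.abs ?_
  refine ContinuousOn.mul continuousOn_const (ContinuousOn.mul continuousOn_const ?_)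
  refine continuousOn_finsetSum _ fun σ _ => continuousOn_const.mul ?_
  exact continuousOn_finsetProd _ fun i _ => h _ _

/-- The coordinate frame is a basis of the tangent space, and the top power of Ω does not vanish on
a basis. -/
lemma SymplecticForm.chartDensity_pos {x₀ : M} {y : Model n}
    (hy : y ∈ (chartAt (Model n) x₀).target) :
    0 < Ω.chartDensity (chartAt (Model n) x₀) y := by
  let V := Tan n ((chartAt (Model n) x₀).symm y)
  let e : Model n ≃ₗ[ℝ] V := LinearEquiv.ofBijective (chartDerivSymm x₀ y).toLinearMap
    ⟨Function.LeftInverse.injective (chartDeriv_chartDerivSymm hy),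
      Function.RightInverse.surjective (chartDerivSymm_chartDeriv hy)⟩
  have := @wedgePow_ne_zero V _ _ (inferInstanceAs (FiniteDimensional ℝ (Model n)))
    (Ω.bilin ((chartAt (Model n) x₀).symm y)) (fun v => Ω.alternating _ v)
    (fun v hv => Ω.nondegenerate _ v hv) n
    (finrank_euclideanSpace_fin : Module.finrank ℝ (Model n) = 2 * n)
    ((EuclideanSpace.basisFun (Fin (2 * n)) ℝ).toBasis.map e)
  have hb : ⇑((EuclideanSpace.basisFun (Fin (2 * n)) ℝ).toBasis.map e) = fun i =>
      chartDerivSymm x₀ y (EuclideanSpace.single i (1 : ℝ)) := by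
    funext i
    rw [Module.Basis.map_apply, OrthonormalBasis.coe_toBasis, EuclideanSpace.basisFun_apply]
    rfl
  rw [hb] at this
  refine abs_pos.2 (mul_ne_zero (mul_ne_zero (by simp) (by positivity)) this)

end ChartDensity

/-! ### Control of local L² norms by the global one. -/

section LocalBound

set_option linter.unusedSectionVars false

variable {n : ℕ} {M : Type*} [TopologicalSpace M] [ChartedSpace (Model n) M]
  [IsManifold 𝓘(ℝ, Model n) ∞ M]
  {L : M → Type*} [TopologicalSpace (TotalSpace ℂ L)] [∀ x, AddCommGroup (L x)]
  [∀ x, Module ℂ (L x)] [∀ x, TopologicalSpace (L x)] [∀ x, IsTopologicalAddGroup (L x)]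
  [∀ x, ContinuousSMul ℝ (L x)] [FiberBundle ℂ L] [VectorBundle ℂ ℂ L] [VectorBundle ℝ ℂ L]
  [ContMDiffVectorBundle ∞ ℂ L 𝓘(ℝ, Model n)]
  [MeasurableSpace M] [BorelSpace M] (Ω : SymplecticForm n M)

/-- The Liouville measure dominates each chart measure, being their supremum. Only this inequality
is needed, so the agreement of chart measures on overlaps never enters. -/
lemma SymplecticForm.lintegral_chart_le (x₀ : M) {f : M → ENNReal} (hf : Measurable f) :
    ∫⁻ y in (chartAt (Model n) x₀).target,
        ENNReal.ofReal (Ω.chartDensity (chartAt (Model n) x₀) y) *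
          f ((chartAt (Model n) x₀).symm y) ≤ ∫⁻ x, f x ∂Ω.liouville := by
  set κ := chartAt (Model n) x₀
  have hκ : AEMeasurable κ.symm (volume.restrict κ.target) :=
    κ.continuousOn_symm.aemeasurable κ.open_target.measurableSet
  have hρ : AEMeasurable (fun y => ENNReal.ofReal (Ω.chartDensity κ y))
      (volume.restrict κ.target) :=
    ((Ω.continuousOn_chartDensity x₀).aemeasurable κ.open_target.measurableSet).ennreal_ofReal
  calc _ = ∫⁻ x, f x ∂Ω.chartMeasure κ := by
        rw [SymplecticForm.chartMeasure, lintegral_map' hf.aemeasurable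
          (hκ.mono_ac (withDensity_absolutelyContinuous _ _))]
        exact (lintegral_withDensity_eq_lintegral_mul₀ hρ (hf.comp_aemeasurable hκ)).symm
    _ ≤ _ := lintegral_mono' (le_iSup (fun x => Ω.chartMeasure (chartAt (Model n) x)) x₀) le_rfl

/-- The `L²` norm of local representatives is controlled by the `L²` norm of sections. -/
lemma HermitianMetric.exists_integral_localRep_le (h : HermitianMetric n L) (x₀ : M)
    {B : Set (Model n)} (hB : IsCompact B) (hBs : B ⊆ repDomain n L x₀) :
    ∃ C : ℝ, 0 ≤ C ∧ ∀ s : ∀ x, L x, SmoothSectionOn n s Set.univ →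
      Integrable (fun x => h.toFun x (s x) (s x)) Ω.liouville →
      ∫ y in B, ‖localRep x₀ s y‖ ^ 2 ≤ C * ∫ x, (h.toFun x (s x) (s x)).re ∂Ω.liouville := by
  set κ := chartAt (Model n) x₀
  obtain ⟨τ, hτs, hτ⟩ := exists_frame n L x₀
  have hhτ : ContinuousOn (fun y => (h.toFun (κ.symm y) (τ (κ.symm y)) (τ (κ.symm y))).re)
      (repDomain n L x₀) :=
    Complex.continuous_re.comp_continuousOn
      ((h.smooth _ (trivializationAt ℂ L x₀).open_baseSet τ τ hτs hτs).continuousOn.comp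
        (κ.continuousOn_symm.mono Set.inter_subset_left) fun y hy => hy.2)
  have hpos : ∀ y ∈ repDomain n L x₀, 0 < Ω.chartDensity κ y *
      (h.toFun (κ.symm y) (τ (κ.symm y)) (τ (κ.symm y))).re := fun y hy =>
    mul_pos (Ω.chartDensity_pos hy.1) (h.pos _ _ fun h0 => by
      have := hτ _ hy.2
      rw [h0, map_zero] at this
      exact zero_ne_one this)
  have hcont := ((Ω.continuousOn_chartDensity x₀).mono Set.inter_subset_left).mul hhτ
  -- In the frame τ, h(s, s) = |f|² h(τ, τ). The product of the density with h(τ, τ) is continuous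
  -- and positive on the compact set B, and its minimum compares Lebesgue with Liouville integrals.
  obtain ⟨c, hc, hcB⟩ : ∃ c > 0, ∀ y ∈ B, c ≤ Ω.chartDensity κ y *
      (h.toFun (κ.symm y) (τ (κ.symm y)) (τ (κ.symm y))).re := by
    obtain rfl | hne := B.eq_empty_or_nonempty
    · exact ⟨1, one_pos, by simp⟩
    · obtain ⟨y, hy, hmin⟩ := hB.exists_isMinOn hne (hcont.mono hBs)
      exact ⟨_, hpos y (hBs hy), fun z hz => hmin hz⟩
  refine ⟨c⁻¹, by positivity, fun s hs hsi => ?_⟩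
  have hs2 : ∀ y ∈ repDomain n L x₀, h.toFun (κ.symm y) (s (κ.symm y)) (s (κ.symm y)) =
      ((‖localRep x₀ s y‖ ^ 2 : ℝ) : ℂ) *
        h.toFun (κ.symm y) (τ (κ.symm y)) (τ (κ.symm y)) := by
    intro y hy
    have : s (κ.symm y) = localRep x₀ s y • τ (κ.symm y) := coord_injective hy.2 (by
      rw [map_smul, hτ _ hy.2, smul_eq_mul, mul_one]; rfl)
    rw [this, LinearMap.map_smulₛₗ, LinearMap.map_smul, LinearMap.smul_apply, smul_eq_mul,
      smul_eq_mul, ← mul_assoc, mul_comm (starRingEnd ℂ _), Complex.mul_conj,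
      Complex.normSq_eq_norm_sq]
  have hint : IntegrableOn (fun y => ‖localRep x₀ s y‖ ^ 2) B :=
    (((contDiffOn_localRep hs x₀).continuousOn.mono hBs).norm.pow 2).integrableOn_compact hB
  have hcs : Continuous fun x => (h.toFun x (s x) (s x)).re :=
    Complex.continuous_re.comp (h.continuous hs hs)
  rw [← div_eq_inv_mul, le_div_iff₀' hc, ← integral_const_mul]
  refine (ENNReal.ofReal_le_ofReal_iff (integral_nonneg fun x => h.self_re_nonneg x _)).1 ?_
  have hre : Integrable (fun x => (h.toFun x (s x) (s x)).re) Ω.liouville := hsi.re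
  rw [ofReal_integral_eq_lintegral_ofReal (hint.const_mul c)
    (Filter.Eventually.of_forall fun y => by positivity),
    ofReal_integral_eq_lintegral_ofReal hre
    (Filter.Eventually.of_forall fun x => h.self_re_nonneg x _)]
  refine le_trans ?_ (Ω.lintegral_chart_le x₀ hcs.measurable.ennreal_ofReal)
  refine (setLIntegral_mono' hB.measurableSet fun y hy => ?_).trans
    (lintegral_mono_set (hBs.trans Set.inter_subset_left))
  have hd := (Ω.chartDensity_pos (hBs hy).1).le
  rw [← ENNReal.ofReal_mul hd, hs2 y (hBs hy), Complex.re_ofReal_mul]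
  refine ENNReal.ofReal_le_ofReal ?_
  have := mul_le_mul_of_nonneg_right (hcB y hy) (sq_nonneg ‖localRep x₀ s y‖)
  linarith

end LocalBound

/-! ### Limits of square integrable holomorphic sections -/

section HolomorphicLimits

set_option linter.unusedSectionVars false

variable {n : ℕ} {M : Type*} [TopologicalSpace M] [ChartedSpace (Model n) M]
  [IsManifold 𝓘(ℝ, Model n) ∞ M]
  {L : M → Type*} [TopologicalSpace (TotalSpace ℂ L)] [∀ x, AddCommGroup (L x)]
  [∀ x, Module ℂ (L x)] [∀ x, TopologicalSpace (L x)] [∀ x, IsTopologicalAddGroup (L x)]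
  [∀ x, ContinuousSMul ℝ (L x)] [FiberBundle ℂ L] [VectorBundle ℂ ℂ L] [VectorBundle ℝ ℂ L]
  [ContMDiffVectorBundle ∞ ℂ L 𝓘(ℝ, Model n)]

lemma dirDeriv_eq_fderiv {F : Type*} [NormedAddCommGroup F] [NormedSpace ℝ F]
    {x₀ x : M} (hx : x ∈ (chartAt (Model n) x₀).source) {f : M → F}
    (hf : MDifferentiableAt 𝓘(ℝ, Model n) 𝓘(ℝ, F) f x) (v : Tan n x) :
    dirDeriv f x v = fderiv ℝ (fun z => f ((chartAt (Model n) x₀).symm z))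
      (chartAt (Model n) x₀ x) (chartDeriv x₀ x v) := by
  obtain ⟨y, hy, rfl⟩ : ∃ y ∈ (chartAt (Model n) x₀).target, (chartAt (Model n) x₀).symm y = x :=
    ⟨_, (chartAt (Model n) x₀).map_source hx, (chartAt (Model n) x₀).left_inv hx⟩
  rw [← fderiv_comp_chart_symm hy hf, (chartAt (Model n) x₀).right_inv hy]

lemma localRep_chart (x₀ : M) (s : ∀ x, L x) {x : M} (hx : x ∈ (chartAt (Model n) x₀).source) :
    localRep (n := n) x₀ s (chartAt (Model n) x₀ x) = coord x₀ x (s x) := by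
  rw [localRep, (chartAt (Model n) x₀).left_inv hx]

lemma HermitianMetric.self_eq (h : HermitianMetric n L) {x : M} {e : L x} (he : coord x x e = 1)
    (u : L x) : h.toFun x u u = ((‖coord x x u‖ ^ 2 : ℝ) : ℂ) * h.toFun x e e := by
  have hu : u = coord x x u • e := coord_injective (mem_baseSet_trivializationAt ℂ L x) (by
    rw [map_smul, he, smul_eq_mul, mul_one])
  conv_lhs => rw [hu]
  rw [LinearMap.map_smulₛₗ, LinearMap.map_smul, LinearMap.smul_apply, smul_eq_mul,
    smul_eq_mul, ← mul_assoc, mul_comm (starRingEnd ℂ _), Complex.mul_conj,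
    Complex.normSq_eq_norm_sq]

/-- Pointwise convergence of sections takes place in the topology of the fibres; this passes it on
to the densities h(s, s), as Fatou's lemma requires. -/
lemma HermitianMetric.continuous_self (h : HermitianMetric n L) (x : M) :
    Continuous fun u : L x => h.toFun x u u := by
  obtain ⟨e, he⟩ := coord_surjective (L := L) (mem_baseSet_trivializationAt ℂ L x) 1
  rw [funext (h.self_eq he)]
  have := continuous_coord (L := L) (mem_baseSet_trivializationAt ℂ L x)
  fun_prop

variable [MeasurableSpace M] [BorelSpace M] [SecondCountableTopology M]
  {ħ : ℝ} {Ω : SymplecticForm n M} (Q : Prequantization L ħ Ω)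

namespace Prequantization

lemma SqInt.smooth {Q : Prequantization L ħ Ω} (ψ : Q.SqInt) :
    SmoothSectionOn n ψ.sec Set.univ := ψ.2.1

lemma norm_sq_eq (ψ : Q.SqInt) : ‖ψ‖ ^ 2 = (1 / (2 * Real.pi * ħ)) ^ n *
    ∫ x, (Q.h.toFun x (ψ.sec x) (ψ.sec x)).re ∂Ω.liouville := by
  rw [← inner_self_eq_norm_sq (𝕜 := ℂ)]
  change (Q.braket ψ ψ).re = _
  rw [braket, Complex.re_ofReal_mul]
  congr 1
  exact (integral_re (Q.sqInt_integrable ψ ψ)).symm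

lemma const_pos (Q : Prequantization L ħ Ω) : 0 < (1 / (2 * Real.pi * ħ)) ^ n := by
  have := Q.hbar_pos
  positivity

lemma ofReal_norm_sq (ψ : Q.SqInt) : ENNReal.ofReal (‖ψ‖ ^ 2) =
    ENNReal.ofReal ((1 / (2 * Real.pi * ħ)) ^ n) *
      ∫⁻ x, ‖Q.h.toFun x (ψ.sec x) (ψ.sec x)‖ₑ ∂Ω.liouville := by
  have hre : Integrable (fun x => (Q.h.toFun x (ψ.sec x) (ψ.sec x)).re) Ω.liouville :=
    (Q.sqInt_integrable ψ ψ).re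
  rw [norm_sq_eq, ENNReal.ofReal_mul Q.const_pos.le, ofReal_integral_eq_lintegral_ofReal hre
    (Filter.Eventually.of_forall fun x => Q.h.self_re_nonneg x _)]
  simp only [← Q.h.norm_self, ofReal_norm]

/-- Holomorphic sections are represented by solutions of an elliptic system whose local `L²` norm
is bounded by the norm of the section. -/
theorem exists_bounded_local_system [T2Space M] (P : ComplexPolarization Ω) (hP : P.IsKahler)
    (x₀ : M) :
    ∃ (Φ : EllipticFrame (2 * n) (Fin n)) (A : Fin n → Unit → Unit → Euc (2 * n) → ℂ)
      (χ : Euc (2 * n) → ℝ), 0 < Φ.radius ∧ Φ.center = chartAt (Model n) x₀ x₀ ∧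
      (∀ j a b, ContDiff ℝ ∞ (A j a b)) ∧
      Metric.closedBall Φ.center Φ.radius ⊆ repDomain n L x₀ ∧
      (∀ y ∈ Metric.closedBall Φ.center Φ.radius, χ y = 1) ∧
      (∀ ψ ∈ Q.holSections P, Φ.IsSolution A fun _ y => χ y • localRep x₀ ψ.sec y) ∧
      ∃ C : ℝ, 0 ≤ C ∧ ∀ ψ : Q.SqInt,
        Φ.normSq (fun _ : Unit => fun y => χ y • localRep x₀ ψ.sec y) Φ.radius ≤ C * ‖ψ‖ ^ 2 := by
  obtain ⟨Φ, A, χ, hr, hc, hA, hB, hχ, hsol⟩ := Q.exists_local_system P hP x₀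
  obtain ⟨C, hC, H⟩ := Q.h.exists_integral_localRep_le Ω x₀ (isCompact_closedBall _ _) hB
  have hq := Q.const_pos
  refine ⟨Φ, A, χ, hr, hc, hA, hB, hχ, fun ψ hψ => hsol _ ψ.smooth hψ,
    C / (1 / (2 * Real.pi * ħ)) ^ n, by positivity, fun ψ => ?_⟩
  rw [Q.norm_sq_eq, ← mul_assoc, div_mul_cancel₀ _ hq.ne']
  refine le_of_eq_of_le ?_ (H ψ.sec ψ.smooth ψ.2.2)
  refine setIntegral_congr_fun Metric.isClosed_closedBall.measurableSet fun y hy => ?_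
  simp [hχ y hy]

/-- The inner product is positive definite on holomorphic sections. -/
theorem eq_zero_of_norm_eq_zero [T2Space M] {P : ComplexPolarization Ω} (hP : P.IsKahler)
    {ψ : Q.SqInt} (hψ : ψ ∈ Q.holSections P) (h0 : ‖ψ‖ = 0) : ψ = 0 := by
  refine Subtype.ext (funext fun x₀ => ?_)
  obtain ⟨Φ, A, χ, hr, hc, hA, hB, hχ, hsol, C, hC, H⟩ := Q.exists_bounded_local_system P hP x₀
  obtain ⟨D, hD, HD⟩ := EllipticFrame.exists_norm_le (Φ := Φ) hA (half_pos hr) (half_lt_self hr)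
    le_rfl
  have h1 := HD _ (hsol ψ hψ) () Φ.center (Metric.mem_closedBall_self (half_pos hr).le)
  have h2 := H ψ
  rw [h0, zero_pow two_ne_zero, mul_zero] at h2
  rw [Real.sqrt_eq_zero_of_nonpos h2, mul_zero, norm_le_zero_iff,
    hχ _ (Metric.mem_closedBall_self hr.le), one_smul, hc,
    localRep_chart _ _ (mem_chart_source _ _)] at h1
  exact coord_injective (mem_baseSet_trivializationAt ℂ L x₀) (h1.trans (map_zero _).symm)

/-- A Cauchy sequence of holomorphic sections converges pointwise to a smooth polarized section. -/
theorem exists_limit_section [T2Space M] {P : ComplexPolarization Ω} (hP : P.IsKahler)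
    {u : ℕ → Q.SqInt} (hu : ∀ k, u k ∈ Q.holSections P) (hcau : CauchySeq u) :
    ∃ t : ∀ x, L x, SmoothSectionOn n t Set.univ ∧ (∀ x, Q.PolarizedAt P t x) ∧
      ∀ x, Filter.Tendsto (fun k => (u k).sec x) Filter.atTop (nhds (t x)) := by
  choose Φ A χ hr hc hA hB hχ hsol C hC H using Q.exists_bounded_local_system P hP
  let U : M → ℕ → Unit → Euc (2 * n) → ℂ := fun x₀ k _ y => χ x₀ y • localRep x₀ (u k).sec y
  have hU : ∀ x₀ k, (Φ x₀).IsSolution (A x₀) (U x₀ k) := fun x₀ k => hsol x₀ _ (hu k)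
  have hL2 : ∀ x₀, (Φ x₀).IsCauchyL2 (U x₀) (Φ x₀).radius := by
    intro x₀ ε hε
    -- The bound on local norms is quadratic in the global norm, hence the square root; C + 1 avoids
    -- dividing by zero.
    obtain ⟨K, hK⟩ := Metric.cauchySeq_iff.1 hcau (√(ε / (C x₀ + 1)))
      (Real.sqrt_pos.2 (div_pos hε (by linarith [hC x₀])))
    refine ⟨K, fun k hk l hl => ?_⟩
    have e : U x₀ k - U x₀ l = fun _ y => χ x₀ y • localRep x₀ (u k - u l).sec y := by
      funext a y
      change χ x₀ y • localRep x₀ (u k).sec y - χ x₀ y • localRep x₀ (u l).sec y = _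
      rw [← smul_sub, ← localRep_sub]
      rfl
    have h1 := hK k hk l hl
    rw [dist_eq_norm, Real.lt_sqrt (norm_nonneg _), lt_div_iff₀ (by linarith [hC x₀])] at h1
    rw [e]
    refine (H x₀ (u k - u l)).trans_lt ?_
    nlinarith [sq_nonneg ‖u k - u l‖]
  have hhalf : ∀ x₀, 0 < (Φ x₀).radius / 2 ∧ (Φ x₀).radius / 2 < (Φ x₀).radius := fun x₀ =>
    ⟨half_pos (hr x₀), half_lt_self (hr x₀)⟩
  -- pointwise convergence
  have hlim : ∀ x, ∃ t : L x, Filter.Tendsto (fun k => (u k).sec x) Filter.atTop (nhds t) := by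
    intro x
    have h1 := ((hL2 x).uniformCauchySeqOn (hA x) (hhalf x).1 (hhalf x).2 le_rfl (hU x) ()).cauchySeq
      (Metric.mem_closedBall_self (hhalf x).1.le)
    obtain ⟨z, hz⟩ := cauchySeq_tendsto_of_complete h1
    obtain ⟨t, rfl⟩ := coord_surjective (L := L) (mem_baseSet_trivializationAt ℂ L x) z
    refine ⟨t, tendsto_of_coord (mem_baseSet_trivializationAt ℂ L x) (hz.congr fun k => ?_)⟩
    simp only [U]
    rw [hχ x _ (Metric.mem_closedBall_self (hr x).le), one_smul, hc x,
      localRep_chart _ _ (mem_chart_source _ _)]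
  choose t ht using hlim
  have hsub : ∀ x₀, Metric.ball (Φ x₀).center ((Φ x₀).radius / 2) ⊆
      Metric.closedBall (Φ x₀).center (Φ x₀).radius := fun x₀ =>
    Metric.ball_subset_closedBall.trans (Metric.closedBall_subset_closedBall (hhalf x₀).2.le)
  have hw : ∀ x₀, ∀ _ : Unit, ∀ y ∈ Metric.ball (Φ x₀).center ((Φ x₀).radius / 2),
      Filter.Tendsto (fun k => U x₀ k () y) Filter.atTop (nhds (localRep x₀ t y)) := by
    intro x₀ _ y hy
    have hyB := hsub x₀ hy
    have h1 := ((continuous_coord (L := L) (hB x₀ hyB).2).tendsto _).comp (ht _)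
    refine h1.congr fun k => ?_
    simp only [U, hχ x₀ y hyB, one_smul]
    rfl
  have hd := fun x₀ => (hL2 x₀).hasFDerivAt_limit (hA x₀) (hhalf x₀).1 (hhalf x₀).2 le_rfl (hU x₀)
    (w := fun _ => localRep x₀ t) (hw x₀) () (Φ x₀).center (Metric.mem_ball_self (hhalf x₀).1)
  have hsmooth : ∀ x₀, ContDiffOn ℝ ∞ (localRep x₀ t)
      (Metric.ball (Φ x₀).center ((Φ x₀).radius / 2)) := fun x₀ => contDiffOn_infty.2 fun m =>
    (hL2 x₀).contDiffOn_limit m (hA x₀) (hhalf x₀).1 (hhalf x₀).2 le_rfl (hU x₀)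
      (w := fun _ => localRep x₀ t) (hw x₀) ()
  have hts : SmoothSectionOn n t Set.univ := by
    refine smoothSectionOn_univ_of_coord fun x₀ => ?_
    have h1 : ContMDiffAt 𝓘(ℝ, Model n) 𝓘(ℝ, ℂ) ∞ (localRep x₀ t) (chartAt (Model n) x₀ x₀) :=
      ((hsmooth x₀).contDiffAt (Metric.isOpen_ball.mem_nhds
        (by rw [← hc x₀]; exact Metric.mem_ball_self (hhalf x₀).1))).contMDiffAt
    have h2 : ContMDiffAt 𝓘(ℝ, Model n) 𝓘(ℝ, Model n) ∞ (chartAt (Model n) x₀) x₀ :=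
      contMDiffOn_chart.contMDiffAt
        ((chartAt (Model n) x₀).open_source.mem_nhds (mem_chart_source _ _))
    refine (h1.comp x₀ h2).congr_of_eventuallyEq ?_
    filter_upwards [(chartAt (Model n) x₀).open_source.mem_nhds (mem_chart_source _ x₀)] with x hx
    exact (localRep_chart x₀ t hx).symm
  refine ⟨t, hts, fun x => ?_, ht⟩
  -- convergence of the covariant derivatives
  have hxb := mem_baseSet_trivializationAt ℂ L x
  have hdir : ∀ v : Tan n x, Filter.Tendsto
      (fun k => dirDeriv (fun y => coord x y ((u k).sec y)) x v) Filter.atTop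
      (nhds (dirDeriv (fun y => coord x y (t y)) x v)) := by
    intro v
    have hd' := fun (s : ∀ x, L x) (hs : SmoothSectionOn n s Set.univ) =>
      dirDeriv_eq_fderiv (mem_chart_source (Model n) x)
        ((hs.contMDiffAt_coord hxb).mdifferentiableAt (by simp)) v
    rw [hd' t hts]
    have h1 := ((ContinuousLinearMap.apply ℝ ℂ (chartDeriv x x v)).continuous.tendsto _).comp
      (hd x).2
    rw [hc x] at h1
    refine h1.congr fun k => ?_
    rw [hd' _ (u k).smooth]
    change fderiv ℝ (U x k ()) _ _ = _
    refine DFunLike.congr_fun (Filter.EventuallyEq.fderiv_eq ?_) _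
    filter_upwards [Metric.isOpen_ball.mem_nhds (show chartAt (Model n) x x ∈ Metric.ball
      (Φ x).center (Φ x).radius by rw [← hc x]; exact Metric.mem_ball_self (hr x))] with z hz
    simp only [U, hχ x z (Metric.ball_subset_closedBall hz), one_smul]
    rfl
  obtain ⟨σ, hσ, hσ1⟩ := exists_section_coord_eq_one n L x
  have hnab : ∀ v : Tan n x, Filter.Tendsto (fun k => coord x x (Q.nabla (u k).sec x v))
      Filter.atTop (nhds (coord x x (Q.nabla t x v))) := by
    intro v
    rw [Q.nabla_eq hσ hσ1 hts]
    simp only [Q.nabla_eq hσ hσ1 (u _).smooth, map_add, map_smul, smul_eq_mul]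
    exact ((hdir v).mul_const _).add
      ((((continuous_coord hxb).tendsto _).comp (ht x)).mul_const _)
  intro v w hvw
  refine coord_injective hxb ?_
  rw [map_zero, map_add, map_smul]
  -- Values and first derivatives converge at x, so the polarization equation for the limit is a
  -- limit of equations whose left sides are all zero.
  refine tendsto_nhds_unique ((hnab v).add ((hnab w).const_smul Complex.I)) ?_
  refine tendsto_const_nhds.congr fun k => ?_
  rw [← map_smul, ← map_add, hu k x v w hvw, map_zero]

end Prequantization

end HolomorphicLimits

/-! ### Completeness, and approximation by compactly supported sections -/

section Completeness

set_option linter.unusedSectionVars false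

variable {n : ℕ} {M : Type*} [TopologicalSpace M] [ChartedSpace (Model n) M]
  [IsManifold 𝓘(ℝ, Model n) ∞ M]
  {L : M → Type*} [TopologicalSpace (TotalSpace ℂ L)] [∀ x, AddCommGroup (L x)]
  [∀ x, Module ℂ (L x)] [∀ x, TopologicalSpace (L x)] [∀ x, IsTopologicalAddGroup (L x)]
  [∀ x, ContinuousSMul ℝ (L x)] [FiberBundle ℂ L] [VectorBundle ℂ ℂ L] [VectorBundle ℝ ℂ L]
  [ContMDiffVectorBundle ∞ ℂ L 𝓘(ℝ, Model n)]
  [MeasurableSpace M] [BorelSpace M] [SecondCountableTopology M]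
  {ħ : ℝ} {Ω : SymplecticForm n M} (Q : Prequantization L ħ Ω)

namespace Prequantization

lemma mem_sqIntSubmodule_of_lintegral {s : ∀ x, L x} (hs : SmoothSectionOn n s Set.univ)
    (hfin : ∫⁻ x, ‖Q.h.toFun x (s x) (s x)‖ₑ ∂Ω.liouville < ⊤) : s ∈ Q.sqIntSubmodule :=
  ⟨hs, (Q.h.continuous hs hs).aestronglyMeasurable, hfin⟩

/-- The pointwise limit of a Cauchy sequence of square integrable sections is a limit in norm,
if it is smooth. -/
lemma exists_tendsto_of_pointwise {u : ℕ → Q.SqInt} (hcau : CauchySeq u) {t : ∀ x, L x}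
    (hts : SmoothSectionOn n t Set.univ)
    (ht : ∀ x, Filter.Tendsto (fun k => (u k).sec x) Filter.atTop (nhds (t x))) :
    ∃ T : Q.SqInt, T.sec = t ∧ Filter.Tendsto u Filter.atTop (nhds T) := by
  have hq := Q.const_pos
  set q := (1 / (2 * Real.pi * ħ)) ^ n with hqdef
  have hsub : ∀ l, SmoothSectionOn n (t - (u l).sec) Set.univ := fun l => by
    have := hts.add ((u l).smooth.smul (-1))
    rwa [neg_one_smul, ← sub_eq_add_neg] at this
  -- For fixed l, the density of t − u_l is the pointwise limit of the densities of u_k − u_l, whose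
  -- integrals are eventually small; Fatou's lemma bounds the integral of the limit.
  have hfatou : ∀ ε > 0, ∃ K, ∀ l ≥ K,
      ENNReal.ofReal q * ∫⁻ x, ‖Q.h.toFun x ((t - (u l).sec) x) ((t - (u l).sec) x)‖ₑ ∂Ω.liouville ≤
        ENNReal.ofReal (ε ^ 2) := by
    intro ε hε
    obtain ⟨K, hK⟩ := Metric.cauchySeq_iff.1 hcau ε hε
    refine ⟨K, fun l hl => ?_⟩
    have hpt : ∀ x, ‖Q.h.toFun x ((t - (u l).sec) x) ((t - (u l).sec) x)‖ₑ =
        Filter.liminf (fun k => ‖Q.h.toFun x ((u k - u l).sec x) ((u k - u l).sec x)‖ₑ)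
          Filter.atTop := fun x => by
      refine (Filter.Tendsto.liminf_eq ?_).symm
      exact (((Q.h.continuous_self x).enorm.tendsto _).comp ((ht x).sub_const _))
    have hm : ∀ k, Measurable fun x =>
        ‖Q.h.toFun x ((u k - u l).sec x) ((u k - u l).sec x)‖ₑ := fun k =>
      (Q.h.continuous (u k - u l).smooth (u k - u l).smooth).measurable.enorm
    simp only [hpt]
    calc _ ≤ ENNReal.ofReal q * Filter.liminf (fun k => ∫⁻ x,
          ‖Q.h.toFun x ((u k - u l).sec x) ((u k - u l).sec x)‖ₑ ∂Ω.liouville) Filter.atTop := by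
          gcongr
          exact lintegral_liminf_le hm
      _ ≤ ENNReal.ofReal q * (ENNReal.ofReal (ε ^ 2) / ENNReal.ofReal q) := by
          gcongr
          refine Filter.liminf_le_of_frequently_le' (Filter.Eventually.frequently ?_)
          filter_upwards [Filter.eventually_ge_atTop K] with k hk
          rw [ENNReal.le_div_iff_mul_le (Or.inl (by simpa using hq)) (Or.inl ENNReal.ofReal_ne_top),
            mul_comm, ← Q.ofReal_norm_sq]
          have h1 := hK k hk l hl
          rw [dist_eq_norm] at h1
          gcongr
      _ = _ := ENNReal.mul_div_cancel (by simpa using hq) ENNReal.ofReal_ne_top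
  obtain ⟨K, hK⟩ := hfatou 1 one_pos
  -- One such finite bound suffices: t is the sum of t − u_K and u_K, both square integrable.
  have hmem : t - (u K).sec ∈ Q.sqIntSubmodule := by
    refine Q.mem_sqIntSubmodule_of_lintegral (hsub K) ?_
    have h1 := (hK K le_rfl).trans_lt ENNReal.ofReal_lt_top
    by_contra h2
    rw [not_lt, top_le_iff] at h2
    rw [h2, ENNReal.mul_top (by simpa using hq)] at h1
    exact lt_irrefl _ h1
  have htm : t ∈ Q.sqIntSubmodule := by
    have := Q.sqIntSubmodule.add_mem hmem (u K).2
    rwa [show t - (u K).sec + (u K).1 = t from sub_add_cancel _ _] at this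
  let T : Q.SqInt := ⟨t, htm⟩
  refine ⟨T, rfl, Metric.tendsto_atTop.2 fun ε hε => ?_⟩
  obtain ⟨K, hK⟩ := hfatou (ε / 2) (half_pos hε)
  refine ⟨K, fun l hl => ?_⟩
  have h1 := hK l hl
  have h2 := Q.ofReal_norm_sq (T - u l)
  rw [show (T - u l).sec = t - (u l).sec from rfl, ← hqdef] at h2
  rw [← h2, ENNReal.ofReal_le_ofReal_iff (by positivity)] at h1
  rw [dist_comm, dist_eq_norm]
  exact (le_of_sq_le_sq h1 (by positivity)).trans_lt (half_lt_self hε)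

/-- Elliptic regularity supplies a smooth polarized pointwise limit, and Fatou's lemma makes it
square integrable and a limit in norm. -/
theorem completeSpace_holSections [T2Space M] {P : ComplexPolarization Ω} (hP : P.IsKahler) :
    CompleteSpace (Q.holSections P) := by
  refine Metric.complete_of_cauchySeq_tendsto fun u hu => ?_
  have hcau : CauchySeq fun k => (u k : Q.SqInt) :=
    hu.map uniformContinuous_subtype_val
  obtain ⟨t, hts, htp, ht⟩ := Q.exists_limit_section hP (fun k => (u k).2) hcau
  obtain ⟨T, rfl, hT⟩ := Q.exists_tendsto_of_pointwise hcau hts ht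
  exact ⟨⟨T, htp⟩, tendsto_subtype_rng.2 hT⟩

/-- Square integrable smooth sections are approximated by compactly supported ones. -/
theorem mem_closure_compactlySupported [T2Space M] (ψ : Q.SqInt) :
    ψ ∈ closure (Q.compactlySupported : Set Q.SqInt) := by
  have : LocallyCompactSpace M := ChartedSpace.locallyCompactSpace (Model n) M
  let K := CompactExhaustion.choice M
  -- The cutoffs take values in [0, 1], equal 1 on the k-th set of a compact exhaustion and vanish
  -- outside the next. The density of ψ therefore dominates that of the remainder (1 − fₖ)ψ, which
  -- tends to zero pointwise because it is eventually zero at each point.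
  have hf : ∀ k, ∃ f : C^∞⟮𝓘(ℝ, Model n), M; 𝓘(ℝ, ℝ), ℝ⟯, Set.EqOn f 0 (interior (K (k + 1)))ᶜ ∧
      Set.EqOn f 1 (K k) ∧ ∀ x, f x ∈ Set.Icc (0 : ℝ) 1 := fun k =>
    exists_contMDiffMap_zero_one_of_isClosed 𝓘(ℝ, Model n) isOpen_interior.isClosed_compl
      (K.isCompact k).isClosed
      (Set.disjoint_compl_left_iff_subset.2 (K.subset_interior_succ k))
  choose f hf0 hf1 hf01 using hf
  have hh : ∀ (r : ℝ) x (v : L x), Q.h.toFun x (r • v) (r • v) =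
      ((r ^ 2 : ℝ) : ℂ) * Q.h.toFun x v v := fun r x v => by
    rw [← Complex.coe_smul, LinearMap.map_smulₛₗ, LinearMap.map_smul, LinearMap.smul_apply,
      smul_eq_mul, smul_eq_mul, Complex.conj_ofReal, ← mul_assoc]
    push_cast
    ring
  have hsm : ∀ k, SmoothSectionOn n (fun x => f k x • ψ.sec x) Set.univ := fun k =>
    ContMDiffOn.smul_section (f k).contMDiff.contMDiffOn ψ.smooth
  have hfin : ∫⁻ x, ‖Q.h.toFun x (ψ.sec x) (ψ.sec x)‖ₑ ∂Ω.liouville < ⊤ := ψ.2.2.2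
  have hle : ∀ (r : ℝ), r ∈ Set.Icc (0 : ℝ) 1 → ∀ x, ‖Q.h.toFun x (r • ψ.sec x) (r • ψ.sec x)‖ₑ ≤
      ‖Q.h.toFun x (ψ.sec x) (ψ.sec x)‖ₑ := fun r hr x => by
    rw [enorm_le_iff_norm_le, hh, norm_mul, Complex.norm_real, Real.norm_of_nonneg (sq_nonneg r)]
    exact mul_le_of_le_one_left (norm_nonneg _) (pow_le_one₀ hr.1 hr.2)
  let φ : ℕ → Q.SqInt := fun k => ⟨fun x => f k x • ψ.sec x,
    Q.mem_sqIntSubmodule_of_lintegral (hsm k)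
      ((lintegral_mono fun x => hle _ (hf01 k x) x).trans_lt hfin)⟩
  have hφ : ∀ k, φ k ∈ Q.compactlySupported := fun k => by
    refine (K.isCompact (k + 1)).of_isClosed_subset isClosed_closure
      (closure_minimal (fun x hx => ?_) (K.isCompact (k + 1)).isClosed)
    by_contra hxK
    refine hx ?_
    change f k x • ψ.sec x = 0
    rw [hf0 k (fun h => hxK (interior_subset h)), Pi.zero_apply, zero_smul]
  have hsec : ∀ k x, (ψ - φ k).sec x = (1 - f k x) • ψ.sec x := fun k x => by
    rw [sub_smul, one_smul]
    rfl
  have hlim : Filter.Tendsto (fun k => ∫⁻ x,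
      ‖Q.h.toFun x ((ψ - φ k).sec x) ((ψ - φ k).sec x)‖ₑ ∂Ω.liouville) Filter.atTop (nhds 0) := by
    rw [show (0 : ENNReal) = ∫⁻ _, 0 ∂Ω.liouville by simp]
    refine tendsto_lintegral_of_dominated_convergence
      (fun x => ‖Q.h.toFun x (ψ.sec x) (ψ.sec x)‖ₑ)
      (fun k => (Q.h.continuous (ψ - φ k).smooth (ψ - φ k).smooth).measurable.enorm)
      (fun k => Filter.Eventually.of_forall fun x => ?_) hfin.ne
      (Filter.Eventually.of_forall fun x => ?_)
    · simp only [hsec]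
      have := hf01 k x
      exact hle _ ⟨by linarith [this.2], by linarith [this.1]⟩ x
    · obtain ⟨k₀, hk₀⟩ := K.exists_mem x
      refine tendsto_const_nhds.congr' ?_
      filter_upwards [Filter.eventually_ge_atTop k₀] with k hk
      rw [hsec, hf1 k (K.subset hk hk₀)]
      simp
  have hnorm : Filter.Tendsto (fun k => ‖ψ - φ k‖ ^ 2) Filter.atTop (nhds 0) := by
    have h1 := ENNReal.Tendsto.const_mul (a := ENNReal.ofReal ((1 / (2 * Real.pi * ħ)) ^ n)) hlim
      (Or.inr ENNReal.ofReal_ne_top)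
    simp only [← Q.ofReal_norm_sq, mul_zero] at h1
    have h2 := (ENNReal.tendsto_toReal ENNReal.zero_ne_top).comp h1
    refine h2.congr fun k => ?_
    exact ENNReal.toReal_ofReal (sq_nonneg _)
  refine mem_closure_of_tendsto (f := φ) (b := Filter.atTop) ?_ (Filter.Eventually.of_forall hφ)
  rw [tendsto_iff_norm_sub_tendsto_zero]
  have h3 := (Real.continuous_sqrt.tendsto 0).comp hnorm
  rw [Real.sqrt_zero] at h3
  refine h3.congr fun k => ?_
  rw [Function.comp_apply, Real.sqrt_sq (norm_nonneg _), norm_sub_rev]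

/-- Holomorphy plays no role in the containment: every square integrable smooth section is a norm
limit of compactly supported ones. -/
lemma toL2_mem_HP [T2Space M] (ψ : Q.SqInt) : Q.toL2 ψ ∈ Q.HP :=
  map_mem_closure Q.toL2.continuous (Q.mem_closure_compactlySupported ψ)
    fun φ hφ => ⟨φ, hφ, rfl⟩

/-- An isometry carries a complete set to a complete set, and complete sets in the Hausdorff space
`L2` are closed. -/
lemma isClosed_map_holSections [T2Space M] {P : ComplexPolarization Ω} (hP : P.IsKahler) :
    IsClosed ((Q.holSections P).map Q.toL2.toLinearMap : Set Q.L2) := by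
  have := Q.completeSpace_holSections hP
  have h1 : IsComplete (Q.holSections P : Set Q.SqInt) := completeSpace_coe_iff_isComplete.1 this
  exact ((isComplete_image_iff Q.toL2.isometry.isUniformInducing).2 h1).isClosed

end Prequantization

end Completeness

end GeometricQuantization

/-! ### Assembly of the theorem. -/

theorem mainTheorem8 {n : ℕ} {M : Type*} [TopologicalSpace M] [T2Space M]
    [SecondCountableTopology M] [ChartedSpace (GeometricQuantization.Model n) M]
    [IsManifold 𝓘(ℝ, GeometricQuantization.Model n) ∞ M] [MeasurableSpace M] [BorelSpace M]
    (Ω : GeometricQuantization.SymplecticForm n M)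
    {L : M → Type*} [TopologicalSpace (TotalSpace ℂ L)] [∀ x, AddCommGroup (L x)]
    [∀ x, Module ℂ (L x)] [∀ x, TopologicalSpace (L x)] [∀ x, IsTopologicalAddGroup (L x)]
    [∀ x, ContinuousSMul ℝ (L x)] [FiberBundle ℂ L] [VectorBundle ℂ ℂ L] [VectorBundle ℝ ℂ L]
    [ContMDiffVectorBundle ∞ ℂ L 𝓘(ℝ, GeometricQuantization.Model n)]
    {ħ : ℝ} (Q : GeometricQuantization.Prequantization L ħ Ω)
    (P : GeometricQuantization.ComplexPolarization Ω) (hP : P.IsKahler) :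
    (Q.holSections P).map Q.toL2.toLinearMap ≤ Q.HP ∧
    IsClosed {ξ : Q.HP | (ξ : Q.L2) ∈ (Q.holSections P).map Q.toL2.toLinearMap} ∧
    (∀ ψ ∈ Q.holSections P, Q.braket ψ ψ = 0 → ψ = 0) ∧
    CompleteSpace (Q.holSections P) := by
  refine ⟨?_, ?_, fun ψ hψ h0 => ?_, Q.completeSpace_holSections hP⟩
  · rintro _ ⟨ψ, -, rfl⟩
    exact Q.toL2_mem_HP ψ
  · exact (Q.isClosed_map_holSections hP).preimage continuous_subtype_val
  · refine Q.eq_zero_of_norm_eq_zero hP hψ ?_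
    -- On the diagonal, the exchange of arguments between `braket` and `inner` has no effect, so the
    -- two agree by definition.
    have h1 : (inner ℂ ψ ψ : ℂ) = 0 := h0
    rw [← sq_eq_zero_iff, ← inner_self_eq_norm_sq (𝕜 := ℂ), h1, map_zero]
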